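/- **Setting.** Let $\Theta\subseteq\mathbb R^p$ be a convex parameter space, $\{p(x|\theta):\theta\in\Theta\}$ a family of strictly positive probability densities (with respect to some measure) on a measurable space $\mathcal X$, $\pi$ a prior density on $\Theta$, and $P_0$ a probability distribution on $\mathcal X$ (not necessarily in the family). Put $\ell(\theta,x)=\log p(x|\theta)$, assume that $\ell(\theta,X)$ is integrable under $X\sim P_0$ for every $\theta\in\Theta$, let $\theta^*$ be an interior point of $\Theta$ that maximises $\mathbb E[\ell(\theta,X)]$ over $\Theta$, and let $H=-\mathbb E[\nabla^2\ell(\theta^*,X)]$ (derivatives are in $\theta$). Assume: 1. $\pi>0$ on $\Theta$ and, for some constants $\eta_1,M_1>0$, $|\log\pi(\theta)-\log\pi(\theta^*)|\le M_1(1+|\theta-\theta^*|_2^{\eta_1})$ for all $\theta\in\Theta$. 2. $\Theta$ is bounded; for some $c_l>0$, $\mathbb E[\ell(\theta^*,X)]-\mathbb E[\ell(\theta,X)]\ge c_l|\theta-\theta^*|_2^2$ for all $\theta\in\Theta$; and for some $\rho\in(0,1]$ all eigenvalues of $H$ lie in $[\rho,\rho^{-1}]$. 3. For some $\eta_2,M_2>0$: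 $\mathbb E[\exp\{\eta_2|v^{\top}\nabla\ell(\theta,X)|\}]\le M_2$ for all unit vectors $v$ and all $\theta\in\Theta$. 4. For some $\eta_3,M_3>0$: $\mathbb E[\exp\{\eta_3 v^{\top}\nabla^2\ell(\theta,X)v\}]\le M_3$ for all unit vectors $v$ and all $\theta\in\Theta$. 5. For every $x$, $\ell(\cdot,x)$ is three times differentiable at every point of $\Theta$, and for some $L_1>0$ all its third-order partial derivatives are bounded by $L_1$ in absolute value, for all $x$ and all $\theta\in\Theta$. The data consist of $m\ge1$ blocks of $n\ge1$ observations $X_{j,i}$, $1\le j\le m$, $1\le i\le n$. For a number $\alpha\in[0,1/2)$ and a fixed set $\mathcal B\subseteq\{1,\dots,m\}$ with $|\mathcal B|=\lfloor\alpha m\rfloor$, the observations in the blocks $j\notin\mathcal B$ are i.i.d. with law $P_0$; those in the blocks $j\in\mathcal B$ are arbitrary. For $j\notin\mathcal B$ let $\hat\theta_j\in\operatorname{argmax}_{\theta\in\Theta}\sum_{i=1}^n\ell(\theta,X_{j,i})$. For $\tau\in(0,1)$ let $$\mathcal F_\tau(\theta_f,\theta_g)=\mathrm{quan}_\tau\big\{(\theta_f-\hat\theta_j)^{\top}H(\theta_f-\hat\theta_j)-(\theta_g-\hat\theta_j)^{\top}H(\theta_g-\hat\theta_j)\,\big|\,j\notin\mathcal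 B\big\},$$ where the $\tau$-quantile of finitely many reals is the least $t$ such that at least a fraction $\tau$ of them is $\le t$, and let $\hat\theta_{f,\tau}\in\operatorname{argmin}_{\theta_f}\max_{\theta_g}\mathcal F_\tau(\theta_f,\theta_g)$, where $\theta_f,\theta_g$ both range over one set $T$, which is either $\Theta$ or all of $\mathbb R^p$ (and $\max$ is read as a supremum if it is not attained). **Theorem.** For either choice of $T$ and for every $\delta>0$ and $\gamma>0$ there are constants $C_1,C_2,C_3>0$, which may depend on the model, $P_0$, $T$, $\delta$ and $\gamma$ but not on $m,n,\tau,\alpha,\mathcal B$ or the data, such that for all $m,n\ge1$, all $\tau\in[\delta,1-\delta]$, all $\alpha\in[0,1/2)$ and all $\mathcal B$ as above the following holds. With probability at least $1-C_3n^{-\gamma}$, for every choice of the maximisers $\hat\theta_j$ and of the minimiser $\hat\theta_{f,\tau}$, $$|\hat\theta_{f,\tau}-\theta^*|_2\le\frac{C_1}{\sqrt n}\Big(\big|\tau-\tfrac12\big|+\sqrt{\tfrac{\log n}{m}}+\tfrac{\log n}{\sqrt n}\Big)$$ and $$\max_{\theta_g}\mathcal F_\tau(\hat\theta_{f,\tau},\theta_g)\le\frac{C_2}{n}\Big(\big|\tau-\tfrac12\big|^2+\tfrac{\log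 n}{m}+\tfrac{(\log n)^2}{n}\Big).$$ -/

import Mathlib

open MeasureTheory ProbabilityTheory Set Filter
open scoped Matrix Topology ENNReal

noncomputable section

/-- A Bayesian model with parameter space `Θ ⊆ ℝᵖ` (with its Euclidean norm): the densities `p(x | θ)`
with respect to a reference measure `ν`, and a prior density on `Θ` with respect to Lebesgue
measure. Nothing relates the family to the distribution of the data (misspecification is allowed). -/
structure BayesModel (p : ℕ) (𝒳 : Type*) [MeasurableSpace 𝒳] where
  /-- the parameter space -/
  Θ : Set (EuclideanSpace ℝ (Fin p))
  /-- the reference measure on the sample space -/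
  ν : Measure 𝒳
  /-- the density `p(x | θ)` -/
  dens : EuclideanSpace ℝ (Fin p) → 𝒳 → ℝ
  /-- the prior density -/
  prior : EuclideanSpace ℝ (Fin p) → ℝ
  convex_Θ : Convex ℝ Θ
  measurable_dens : ∀ θ ∈ Θ, Measurable (dens θ)
  dens_pos : ∀ θ ∈ Θ, ∀ x, 0 < dens θ x
  lintegral_dens : ∀ θ ∈ Θ, ∫⁻ x, ENNReal.ofReal (dens θ x) ∂ν = 1
  aemeasurable_prior : AEMeasurable prior (volume.restrict Θ)
  prior_nonneg : ∀ θ ∈ Θ, 0 ≤ prior θ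
  lintegral_prior : ∫⁻ θ in Θ, ENNReal.ofReal (prior θ) = 1

namespace BayesModel

variable {p : ℕ} {𝒳 : Type*} [MeasurableSpace 𝒳]

/-- The log-likelihood `ℓ(θ, x) = log p(x | θ)`. -/
def logLik (M : BayesModel p 𝒳) (θ : EuclideanSpace ℝ (Fin p)) (x : 𝒳) : ℝ :=
  Real.log (M.dens θ x)

/-- First derivative in the parameter: `M.grad θ x v = vᵀ ∇ℓ(θ, x)`. -/
def grad (M : BayesModel p 𝒳) (θ : EuclideanSpace ℝ (Fin p)) (x : 𝒳) :
    EuclideanSpace ℝ (Fin p) →L[ℝ] ℝ :=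
  fderiv ℝ (fun θ' => M.logLik θ' x) θ

/-- Second derivative in the parameter: `M.hess θ x u v = uᵀ ∇²ℓ(θ, x) v`. -/
def hess (M : BayesModel p 𝒳) (θ : EuclideanSpace ℝ (Fin p)) (x : 𝒳) :
    EuclideanSpace ℝ (Fin p) →L[ℝ] EuclideanSpace ℝ (Fin p) →L[ℝ] ℝ :=
  fderiv ℝ (fun θ' => M.grad θ' x) θ

/-- Third derivative in the parameter. -/
def third (M : BayesModel p 𝒳) (θ : EuclideanSpace ℝ (Fin p)) (x : 𝒳) :
    EuclideanSpace ℝ (Fin p) →L[ℝ]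
      EuclideanSpace ℝ (Fin p) →L[ℝ] EuclideanSpace ℝ (Fin p) →L[ℝ] ℝ :=
  fderiv ℝ (fun θ' => M.hess θ' x) θ

/-- The `i`-th standard basis vector of `ℝᵖ`. -/
def stdVec (i : Fin p) : EuclideanSpace ℝ (Fin p) := EuclideanSpace.single i (1 : ℝ)

/-- The information matrix `H = -E[∇²ℓ(θ, X)]`, `X ∼ P₀` (used at the true parameter). -/
def fisher (M : BayesModel p 𝒳) (P₀ : Measure 𝒳) (θ : EuclideanSpace ℝ (Fin p)) :
    Matrix (Fin p) (Fin p) ℝ :=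
  Matrix.of fun i j => -∫ x, M.hess θ x (stdVec i) (stdVec j) ∂P₀

/-- `θ⋆ = argmax_{θ ∈ Θ} E[ℓ(θ, X)]`, `X ∼ P₀`, with finite expectations; `θ⋆` is an interior point
of `Θ`. -/
structure IsTrueParam (M : BayesModel p 𝒳) (P₀ : Measure 𝒳)
    (θs : EuclideanSpace ℝ (Fin p)) : Prop where
  mem_interior : θs ∈ interior M.Θ
  integrable : ∀ θ ∈ M.Θ, Integrable (M.logLik θ) P₀
  isMaxOn : IsMaxOn (fun θ => ∫ x, M.logLik θ x ∂P₀) M.Θ θs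

/-- Prior condition: positive density, with polynomially controlled log-density. -/
def PriorCond (M : BayesModel p 𝒳) (θs : EuclideanSpace ℝ (Fin p)) : Prop :=
  ∃ η₁ > (0 : ℝ), ∃ M₁ > (0 : ℝ), ∀ θ ∈ M.Θ, 0 < M.prior θ ∧
    |Real.log (M.prior θ) - Real.log (M.prior θs)| ≤ M₁ * (1 + ‖θ - θs‖ ^ η₁)

/-- Bounded parameter space, quadratic growth, and eigenvalues of `H` in `[ρ, ρ⁻¹]`. -/
def GrowthCond (M : BayesModel p 𝒳) (P₀ : Measure 𝒳) (θs : EuclideanSpace ℝ (Fin p)) : Prop :=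
  Bornology.IsBounded M.Θ ∧
  (∃ c > (0 : ℝ), ∀ θ ∈ M.Θ,
    c * ‖θ - θs‖ ^ 2 ≤ (∫ x, M.logLik θs x ∂P₀) - ∫ x, M.logLik θ x ∂P₀) ∧
  (∃ ρ : ℝ, 0 < ρ ∧ ρ ≤ 1 ∧ spectrum ℝ (M.fisher P₀ θs) ⊆ Icc ρ ρ⁻¹)

/-- Uniformly sub-exponential gradient. -/
def GradCond (M : BayesModel p 𝒳) (P₀ : Measure 𝒳) : Prop :=
  ∃ η₂ > (0 : ℝ), ∃ M₂ > (0 : ℝ), ∀ v : EuclideanSpace ℝ (Fin p), ‖v‖ = 1 → ∀ θ ∈ M.Θ,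
    ∫⁻ x, ENNReal.ofReal (Real.exp (η₂ * |M.grad θ x v|)) ∂P₀ ≤ ENNReal.ofReal M₂

/-- Uniformly bounded exponential moments of the quadratic forms of the Hessian. -/
def HessCond (M : BayesModel p 𝒳) (P₀ : Measure 𝒳) : Prop :=
  ∃ η₃ > (0 : ℝ), ∃ M₃ > (0 : ℝ), ∀ v : EuclideanSpace ℝ (Fin p), ‖v‖ = 1 → ∀ θ ∈ M.Θ,
    ∫⁻ x, ENNReal.ofReal (Real.exp (η₃ * M.hess θ x v v)) ∂P₀ ≤ ENNReal.ofReal M₃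

/-- Three times differentiable in the parameter at every point of `Θ`, with uniformly bounded
third-order partial derivatives. -/
def SmoothCond (M : BayesModel p 𝒳) : Prop :=
  (∀ x, ∀ θ ∈ M.Θ,
    (∀ᶠ θ' in 𝓝 θ, DifferentiableAt ℝ (fun t => M.logLik t x) θ') ∧
    (∀ᶠ θ' in 𝓝 θ, DifferentiableAt ℝ (fun t => M.grad t x) θ') ∧
    DifferentiableAt ℝ (fun t => M.hess t x) θ) ∧
  ∃ L₁ > (0 : ℝ), ∀ x, ∀ θ ∈ M.Θ, ∀ i j k : Fin p,
    |M.third θ x (stdVec i) (stdVec j) (stdVec k)| ≤ L₁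

/-- `θ ∈ Θ` maximises over `Θ` the log-likelihood `∑ᵢ ℓ(·, xᵢ)` of one block of observations. -/
def IsLocalMax (M : BayesModel p 𝒳) {n : ℕ} (x : Fin n → 𝒳)
    (θ : EuclideanSpace ℝ (Fin p)) : Prop :=
  θ ∈ M.Θ ∧ IsMaxOn (fun θ' => ∑ i, M.logLik θ' (x i)) M.Θ θ

end BayesModel

/-- The observations outside the corrupted blocks `B` are i.i.d. with law `P₀`; those in the blocks
`j ∈ B` are arbitrary. -/
structure IsCleanSample {Ω 𝒳 : Type*} [MeasurableSpace Ω] [MeasurableSpace 𝒳] {m n : ℕ}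
    (P : Measure Ω) (P₀ : Measure 𝒳) (B : Finset (Fin m))
    (X : Fin m → Fin n → Ω → 𝒳) : Prop where
  measurable : ∀ j, j ∉ B → ∀ i, Measurable (X j i)
  law : ∀ j, j ∉ B → ∀ i, P.map (X j i) = P₀
  indep : iIndepFun (fun q : {j : Fin m // j ∉ B} × Fin n => X q.1 q.2) P

/-- The `τ`-quantile of the values `x j`, `j ∈ s`: the least `t` such that at least a fraction `τ` of
the values is `≤ t`. -/
def quantile {ι : Type*} (τ : ℝ) (s : Finset ι) (x : ι → ℝ) : ℝ :=
  sInf {t : ℝ | τ * (s.card : ℝ) ≤ (((s.filter fun j => x j ≤ t).card : ℕ) : ℝ)}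

/-- The quadratic form `vᵀ H v`. -/
def quadForm {p : ℕ} (H : Matrix (Fin p) (Fin p) ℝ) (v : EuclideanSpace ℝ (Fin p)) : ℝ :=
  v.ofLp ⬝ᵥ (H *ᵥ v.ofLp)

/-- `𝓕_τ(θ_f, θ_g)`: the `τ`-quantile over the uncorrupted blocks `j ∉ B` of
`(θ_f - θ̂_j)ᵀ H (θ_f - θ̂_j) - (θ_g - θ̂_j)ᵀ H (θ_g - θ̂_j)`. -/
def lossQuantile {p m : ℕ} (H : Matrix (Fin p) (Fin p) ℝ) (B : Finset (Fin m))
    (θhat : Fin m → EuclideanSpace ℝ (Fin p)) (τ : ℝ) (θf θg : EuclideanSpace ℝ (Fin p)) : ℝ :=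
  quantile τ Bᶜ fun j => quadForm H (θf - θhat j) - quadForm H (θg - θhat j)

/-- `sup_{θ_g ∈ T} 𝓕_τ(θ_f, θ_g)`, as an extended real number. -/
def worstLoss {p m : ℕ} (H : Matrix (Fin p) (Fin p) ℝ) (B : Finset (Fin m))
    (θhat : Fin m → EuclideanSpace ℝ (Fin p)) (τ : ℝ) (T : Set (EuclideanSpace ℝ (Fin p)))
    (θf : EuclideanSpace ℝ (Fin p)) : EReal :=
  ⨆ θg ∈ T, ((lossQuantile H B θhat τ θf θg : ℝ) : EReal)

/-- `θf ∈ argmin_{θ_f ∈ T} max_{θ_g ∈ T} 𝓕_τ(θ_f, θ_g)`. -/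
def IsMinMaxEstimator {p m : ℕ} (H : Matrix (Fin p) (Fin p) ℝ) (B : Finset (Fin m))
    (θhat : Fin m → EuclideanSpace ℝ (Fin p)) (τ : ℝ) (T : Set (EuclideanSpace ℝ (Fin p)))
    (θf : EuclideanSpace ℝ (Fin p)) : Prop :=
  θf ∈ T ∧ IsMinOn (worstLoss H B θhat τ T) T θf

end

/-! Put uⱼ = θ̂ⱼ − θ⋆ and v = θ − θ⋆. By polarisation the loss of θ minus the loss of θ⋆ on block j
is vᵀHv − 2vᵀHuⱼ, so 𝓕_τ against θ⋆ depends on the blocks only through the order statistics of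
vᵀHuⱼ. Let d = |τ − 1/2|, let ρ be the lower bound on the eigenvalues of H, and suppose that in
every direction v more than a fraction 1/2 + d of the good blocks satisfy vᵀHuⱼ ≤ ‖v‖ε
(`IsBalanced`). Then 𝓕_τ(θ⋆, θg) ≤ sup_v (2‖v‖ε − ρ‖v‖²) = ε²/ρ for all θg, so the min-max value is
at most ε²/ρ. Conversely 𝓕_τ(θf, θ⋆) ≥ ρ‖v‖² − 2‖v‖ε with v = θf − θ⋆. Together these force ‖θf −
θ⋆‖ ≤ 3ε/ρ. Of T only θ⋆ ∈ T matters.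

It remains to prove balancedness with probability 1 − O(n^{-γ}) for ε of order (d + √(log n/m) + log
n/√n)/√n (`exists_measure_not_isBalanced_le`). Three ingredients enter.

Linearisation (`exists_measure_not_linear_le`): for a single block, outside probability O(n^{-γ-1}),
Huⱼ is the mean score at θ⋆ up to O(log n/n). Since m is not controlled by n, no union bound over
blocks is available; instead Markov's inequality shows that the exceptional blocks form a fraction
below 1/√n.

Central limit theorem (`exists_measure_sum_grad_le_ge`): a Berry–Esseen bound with error log n/√n
gives a score sum at most Ax√n with probability at least 1/2 + x − O(log n/√n), uniformly over
bounded directions, even for a singular score covariance.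

Concentration over blocks: Hoeffding's inequality on a grid of O(nᵖ) directions costs √(log n/m).
This needs x bounded away from 1/2, hence m at least of order log n. For smaller m, sub-exponential
tails and a Chernoff bound show that all but a small fraction of blocks have score sums O(√n · √(log
n/m)), which suffices because 1/2 + d ≤ 1 − δ. -/

noncomputable section

/-! ### Gaussian density and distribution function -/

/-- The centred Gaussian density of variance `a`. -/
def gaussDens (a u : ℝ) : ℝ := (Real.sqrt (2 * Real.pi * a))⁻¹ * Real.exp (-u ^ 2 / (2 * a))

/-- The centred Gaussian distribution function of variance `a`. -/
def gaussCdf (a y : ℝ) : ℝ := 1 / 2 + ∫ u in (0 : ℝ)..y, gaussDens a u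

lemma continuous_gaussDens (a : ℝ) : Continuous (gaussDens a) := by
  unfold gaussDens; fun_prop

lemma gaussDens_nonneg (a u : ℝ) : 0 ≤ gaussDens a u := by
  unfold gaussDens; positivity

lemma gaussDens_neg (a u : ℝ) : gaussDens a (-u) = gaussDens a u := by
  simp [gaussDens]

lemma gaussDens_anti {a u v : ℝ} (ha : 0 < a) (hu : 0 ≤ u) (huv : u ≤ v) :
    gaussDens a v ≤ gaussDens a u := by
  unfold gaussDens
  gcongr

lemma gaussDens_one_le (u : ℝ) : gaussDens 1 u ≤ 1 := by
  unfold gaussDens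
  have h1 : (Real.sqrt (2 * Real.pi * 1))⁻¹ ≤ 1 := by
    apply inv_le_one_of_one_le₀
    rw [Real.one_le_sqrt]
    nlinarith [Real.pi_gt_three]
  have h2 : Real.exp (-u ^ 2 / (2 * 1)) ≤ 1 := by
    rw [Real.exp_le_one_iff]; nlinarith [sq_nonneg u]
  calc _ ≤ (1 : ℝ) * 1 := by gcongr
    _ = 1 := one_mul 1

lemma gaussDens_eq_integral_cos {a : ℝ} (ha : 0 < a) (u : ℝ) :
    gaussDens a u = (2 * Real.pi)⁻¹ * ∫ t : ℝ, Real.cos (t * u) * Real.exp (-a * t ^ 2 / 2) := by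
  have hb : 0 < ((a / 2 : ℝ) : ℂ).re := by simp; positivity
  have h := fourierIntegral_gaussian hb (u : ℂ)
  have hint : Integrable (fun x : ℝ => Complex.exp (Complex.I * u * x) *
      Complex.exp (-((a / 2 : ℝ) : ℂ) * x ^ 2)) := by
    have := integrable_cexp_quadratic hb (Complex.I * u) 0
    refine this.congr (ae_of_all _ fun x => ?_)
    simp only [← Complex.exp_add]
    congr 1; ring
  have h2 := congrArg Complex.re h
  rw [← RCLike.re_eq_complex_re, ← integral_re hint] at h2
  have h3 : ∀ t : ℝ, RCLike.re (Complex.exp (Complex.I * u * t) *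
      Complex.exp (-((a / 2 : ℝ) : ℂ) * t ^ 2)) =
      Real.cos (t * u) * Real.exp (-a * t ^ 2 / 2) := by
    intro t
    have e1 : Complex.exp (-((a / 2 : ℝ) : ℂ) * t ^ 2) = ((Real.exp (-a * t ^ 2 / 2) : ℝ) : ℂ) := by
      rw [Complex.ofReal_exp]; congr 1; push_cast; ring
    have e2 : Complex.I * u * t = ((t * u : ℝ) : ℂ) * Complex.I := by push_cast; ring
    rw [e1, e2, RCLike.re_eq_complex_re, Complex.re_mul_ofReal, Complex.exp_ofReal_mul_I_re]
  simp_rw [h3] at h2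
  rw [h2]
  have e1 : ((Real.pi : ℂ) / ((a / 2 : ℝ) : ℂ)) ^ (1 / 2 : ℂ) =
      ((Real.sqrt (Real.pi / (a / 2)) : ℝ) : ℂ) := by
    rw [Real.sqrt_eq_rpow, Complex.ofReal_cpow (by positivity)]
    push_cast; rfl
  have e2 : Complex.exp (-(u : ℂ) ^ 2 / (4 * ((a / 2 : ℝ) : ℂ))) =
      ((Real.exp (-u ^ 2 / (2 * a)) : ℝ) : ℂ) := by
    rw [Complex.ofReal_exp]; congr 1; push_cast; ring
  rw [e1, e2, ← Complex.ofReal_mul, RCLike.re_eq_complex_re, Complex.ofReal_re, gaussDens, ← mul_assoc]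
  congr 1
  have h5 : Real.sqrt (Real.pi / (a / 2)) * Real.sqrt (2 * Real.pi * a) = 2 * Real.pi := by
    rw [← Real.sqrt_mul (by positivity)]
    rw [show Real.pi / (a / 2) * (2 * Real.pi * a) = (2 * Real.pi) ^ 2 by field_simp]
    exact Real.sqrt_sq (by positivity)
  apply inv_eq_of_mul_eq_one_right
  calc _ = (2 * Real.pi)⁻¹ * (Real.sqrt (Real.pi / (a / 2)) * Real.sqrt (2 * Real.pi * a)) := by ring
    _ = 1 := by rw [h5]; exact inv_mul_cancel₀ (by positivity)

lemma integrable_gaussDens {a : ℝ} (ha : 0 < a) : Integrable (gaussDens a) := by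
  unfold gaussDens
  apply Integrable.const_mul
  have := integrable_exp_neg_mul_sq (b := 1 / (2 * a)) (by positivity)
  refine this.congr (ae_of_all _ fun x => ?_)
  simp only; congr 1; ring

lemma integral_Ioi_gaussDens {a : ℝ} (ha : 0 < a) : ∫ u in Ioi (0 : ℝ), gaussDens a u = 1 / 2 := by
  have h := integral_gaussian_Ioi (1 / (2 * a))
  unfold gaussDens
  rw [integral_const_mul]
  have : ∀ x : ℝ, Real.exp (-x ^ 2 / (2 * a)) = Real.exp (-(1 / (2 * a)) * x ^ 2) := by
    intro x; congr 1; ring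
  simp_rw [this, h]
  rw [show Real.pi / (1 / (2 * a)) = 2 * Real.pi * a by field_simp]
  have h6 : 0 < Real.sqrt (2 * Real.pi * a) := Real.sqrt_pos.2 (by positivity)
  field_simp

lemma intervalIntegral_gaussDens_add_tail {a r : ℝ} (ha : 0 < a) (hr : 0 ≤ r) :
    (∫ u in (0 : ℝ)..r, gaussDens a u) + ∫ u in Ioi r, gaussDens a u = 1 / 2 := by
  rw [← integral_Ioi_gaussDens ha, intervalIntegral.integral_of_le hr]
  rw [← setIntegral_union (by simp [Set.disjoint_left]) measurableSet_Ioi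
    (integrable_gaussDens ha).integrableOn (integrable_gaussDens ha).integrableOn,
    Ioc_union_Ioi_eq_Ioi hr]

/-- Shift by r and use (u + r)² ≥ u² + r² for u, r ≥ 0. -/
lemma integral_Ioi_gaussDens_le {a r : ℝ} (ha : 0 < a) (hr : 0 ≤ r) :
    ∫ u in Ioi r, gaussDens a u ≤ Real.exp (-r ^ 2 / (2 * a)) / 2 := by
  have h1 : ∫ u in Ioi r, gaussDens a u = ∫ u in Ioi (0 : ℝ), gaussDens a (u + r) := by
    have := (measurePreserving_add_right (volume : Measure ℝ) r).setIntegral_preimage_emb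
      (measurableEmbedding_addRight r) (gaussDens a) (Ioi r)
    rw [← this]; simp
  have h2 : ∫ u in Ioi (0 : ℝ), gaussDens a (u + r) ≤
      ∫ u in Ioi (0 : ℝ), Real.exp (-r ^ 2 / (2 * a)) * gaussDens a u := by
    apply setIntegral_mono_on
    · exact ((integrable_gaussDens ha).comp_add_right r).integrableOn
    · exact ((integrable_gaussDens ha).const_mul _).integrableOn
    · exact measurableSet_Ioi
    · intro u hu
      have hu' : 0 < u := hu
      unfold gaussDens
      rw [mul_left_comm, ← Real.exp_add]
      gcongr
      rw [← add_div]
      gcongr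
      nlinarith
  rw [h1]
  refine h2.trans (le_of_eq ?_)
  rw [integral_const_mul, integral_Ioi_gaussDens ha]; ring

lemma gaussCdf_neg (a y : ℝ) : gaussCdf a (-y) = 1 - gaussCdf a y := by
  unfold gaussCdf
  have : ∫ u in (0 : ℝ)..(-y), gaussDens a u = -∫ u in (0 : ℝ)..y, gaussDens a u := by
    have h := intervalIntegral.integral_comp_neg (a := 0) (b := y) (gaussDens a)
    simp only [gaussDens_neg, neg_zero] at h
    rw [h, intervalIntegral.integral_symm]
  rw [this]; ring

lemma gaussCdf_mono (a : ℝ) : Monotone (gaussCdf a) := by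
  intro x y hxy
  have h : ∀ x y, IntervalIntegrable (gaussDens a) volume x y := fun x y =>
    (continuous_gaussDens a).intervalIntegrable x y
  have := intervalIntegral.integral_add_adjacent_intervals (h 0 x) (h x y)
  unfold gaussCdf
  rw [← this]
  have : 0 ≤ ∫ u in x..y, gaussDens a u :=
    intervalIntegral.integral_nonneg hxy fun u _ => gaussDens_nonneg a u
  linarith

lemma gaussCdf_eq_one_sub_tail {a r : ℝ} (ha : 0 < a) (hr : 0 ≤ r) :
    gaussCdf a r = 1 - ∫ u in Ioi r, gaussDens a u := by
  have := intervalIntegral_gaussDens_add_tail ha hr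
  unfold gaussCdf; linarith

lemma gaussCdf_le_one {a : ℝ} (ha : 0 < a) (y : ℝ) : gaussCdf a y ≤ 1 := by
  refine (gaussCdf_mono a (le_abs_self y)).trans ?_
  rw [gaussCdf_eq_one_sub_tail ha (abs_nonneg y)]
  have : 0 ≤ ∫ u in Ioi |y|, gaussDens a u := integral_nonneg fun u => gaussDens_nonneg a u
  linarith

lemma gaussCdf_neg_le {a r : ℝ} (ha : 0 < a) (hr : 0 ≤ r) :
    gaussCdf a (-r) ≤ Real.exp (-r ^ 2 / (2 * a)) / 2 := by
  rw [gaussCdf_neg, gaussCdf_eq_one_sub_tail ha hr]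
  linarith [integral_Ioi_gaussDens_le ha hr]

lemma gaussCdf_nonneg {a : ℝ} (ha : 0 < a) (y : ℝ) : 0 ≤ gaussCdf a y := by
  have := gaussCdf_le_one ha (-y)
  rw [gaussCdf_neg] at this; linarith

lemma continuous_gaussCdf (a : ℝ) : Continuous (gaussCdf a) :=
  continuous_const.add (intervalIntegral.continuous_primitive
    (fun x y => (continuous_gaussDens a).intervalIntegrable x y) 0)

lemma gaussCdf_scale {a : ℝ} (ha : 0 < a) (y : ℝ) :
    gaussCdf a y = gaussCdf 1 (y / Real.sqrt a) := by
  have hs : 0 < Real.sqrt a := Real.sqrt_pos.2 ha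
  unfold gaussCdf
  congr 1
  have h := intervalIntegral.integral_comp_div (a := 0) (b := y) (gaussDens 1) hs.ne'
  rw [zero_div, smul_eq_mul] at h
  have h2 : ∀ u, gaussDens a u = (Real.sqrt a)⁻¹ * gaussDens 1 (u / Real.sqrt a) := by
    intro u
    unfold gaussDens
    rw [← mul_assoc, ← mul_inv, mul_one, mul_comm (Real.sqrt a), ← Real.sqrt_mul (by positivity),
      div_pow, Real.sq_sqrt ha.le]
    congr 2; field_simp
  simp_rw [h2]
  rw [intervalIntegral.integral_const_mul, h]
  field_simp

lemma gaussCdf_one_sub_le {x y : ℝ} (hxy : x ≤ y) : gaussCdf 1 y - gaussCdf 1 x ≤ y - x := by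
  have h : ∀ x y, IntervalIntegrable (gaussDens 1) volume x y := fun x y =>
    (continuous_gaussDens 1).intervalIntegrable x y
  have h1 := intervalIntegral.integral_add_adjacent_intervals (h 0 x) (h x y)
  have h2 : ∫ u in x..y, gaussDens 1 u ≤ ∫ _ in x..y, (1 : ℝ) :=
    intervalIntegral.integral_mono_on hxy (h x y) (by simp) fun u _ => gaussDens_one_le u
  simp at h2
  unfold gaussCdf; linarith

/-- Concavity of the distribution function on [0, ∞): the density decreases there, so after the
substitution u ↦ lu the integrands compare pointwise. -/
lemma gaussCdf_one_concave {y l : ℝ} (hy : 0 ≤ y) (hl0 : 0 ≤ l) (hl : l ≤ 1) :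
    l * (gaussCdf 1 y - 1 / 2) ≤ gaussCdf 1 (l * y) - 1 / 2 := by
  have h := intervalIntegral.mul_integral_comp_mul_left (a := 0) (b := y) (f := gaussDens 1) (c := l)
  rw [mul_zero] at h
  unfold gaussCdf
  simp only [add_sub_cancel_left]
  rw [← h]
  apply mul_le_mul_of_nonneg_left _ hl0
  apply intervalIntegral.integral_mono_on hy
  · exact (continuous_gaussDens 1).intervalIntegrable _ _
  · exact ((continuous_gaussDens 1).comp (continuous_const.mul continuous_id)).intervalIntegrable _ _
  · intro u hu
    exact gaussDens_anti one_pos (mul_nonneg hl0 hu.1) (by nlinarith [hu.1])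

lemma exists_gaussCdf_one_ge {q : ℝ} (hq : q < 1) : ∃ y > 0, q ≤ gaussCdf 1 y := by
  have h1 : Tendsto (fun r : ℝ => Real.exp (-r ^ 2 / (2 * 1)) / 2) atTop (𝓝 0) := by
    have : Tendsto (fun r : ℝ => -r ^ 2 / (2 * 1)) atTop atBot := by
      have h0 : Tendsto (fun r : ℝ => r ^ 2 / 2) atTop atTop :=
        (tendsto_pow_atTop (by norm_num)).atTop_div_const (by norm_num)
      refine (tendsto_neg_atTop_atBot.comp h0).congr fun r => ?_
      simp only [Function.comp]; ring
    simpa using (Real.tendsto_exp_atBot.comp this).div_const 2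
  obtain ⟨r, hr, hr0⟩ := ((h1.eventually (gt_mem_nhds (sub_pos.2 hq))).and
    (eventually_gt_atTop 0)).exists
  refine ⟨r, hr0, ?_⟩
  have := gaussCdf_neg_le one_pos hr0.le
  rw [gaussCdf_neg] at this
  linarith

/-- By concavity the distribution function lies above its chord from 0 to a point y where it already
reaches 1/2 + x₀, so A = y / x₀ works. This converts an excess probability x into a threshold linear
in x, and is the reason why x, and later τ, must stay away from the extremes. -/
lemma exists_gaussCdf_linear_lower {x₀ : ℝ} (hx₀ : 0 < x₀) (hx : x₀ < 1 / 2) :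
    ∃ A > 0, ∀ x, 0 ≤ x → x ≤ x₀ → 1 / 2 + x ≤ gaussCdf 1 (A * x) := by
  obtain ⟨y, hy, hq⟩ := exists_gaussCdf_one_ge (q := 1 / 2 + x₀) (by linarith)
  refine ⟨y / x₀, by positivity, fun x h0 h1 => ?_⟩
  have hc := gaussCdf_one_concave hy.le (div_nonneg h0 hx₀.le) (div_le_one_of_le₀ h1 hx₀.le)
  rw [show y / x₀ * x = x / x₀ * y by ring]
  have : x ≤ x / x₀ * (gaussCdf 1 y - 1 / 2) := by
    calc x = x / x₀ * x₀ := by field_simp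
      _ ≤ _ := by gcongr; linarith
  linarith

/-- `∫₀ʸ cos (t u) du`, that is `sin (t y) / t`. -/
lemma intervalIntegral_cos_mul {t : ℝ} (ht : t ≠ 0) (y : ℝ) :
    ∫ u in (0 : ℝ)..y, Real.cos (t * u) = Real.sin (t * y) / t := by
  have := intervalIntegral.integral_comp_mul_left (a := 0) (b := y) Real.cos ht
  rw [this]; simp [div_eq_inv_mul]

lemma integrable_exp_neg_half {a : ℝ} (ha : 0 < a) :
    Integrable (fun t : ℝ => Real.exp (-a * t ^ 2 / 2)) := by
  refine (integrable_exp_neg_mul_sq (b := a / 2) (by positivity)).congr (ae_of_all _ fun t => ?_)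
  simp only; congr 1; ring

/-- Inversion formula: integrate the cosine representation of the density in u. The kernel sin(ty)/t
is bounded by |y|, so the integral converges absolutely at t = 0 and no principal value is needed.
-/
lemma gaussCdf_eq_integral {a : ℝ} (ha : 0 < a) (y : ℝ) :
    gaussCdf a y = 1 / 2 + (2 * Real.pi)⁻¹ *
      ∫ t : ℝ, Real.sin (t * y) / t * Real.exp (-a * t ^ 2 / 2) := by
  unfold gaussCdf
  congr 1
  simp_rw [gaussDens_eq_integral_cos ha]
  rw [intervalIntegral.integral_const_mul]
  congr 1
  have hsw : ∫ u in (0 : ℝ)..y, ∫ t : ℝ, Real.cos (t * u) * Real.exp (-a * t ^ 2 / 2) =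
      ∫ t : ℝ, ∫ u in (0 : ℝ)..y, Real.cos (t * u) * Real.exp (-a * t ^ 2 / 2) := by
    apply intervalIntegral_integral_swap
    have h1 : Integrable (fun z : ℝ × ℝ => (1 : ℝ) * Real.exp (-a * z.2 ^ 2 / 2))
        ((volume.restrict (uIoc 0 y)).prod volume) :=
      Integrable.mul_prod (μ := volume.restrict (uIoc 0 y)) (ν := volume) (f := fun _ => (1 : ℝ))
        (g := fun t => Real.exp (-a * t ^ 2 / 2)) (by rw [uIoc]; exact integrable_const _)
        (integrable_exp_neg_half ha)
    refine h1.mono' ?_ (ae_of_all _ fun z => ?_)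
    · apply Continuous.aestronglyMeasurable
      simp only [Function.uncurry_def]; fun_prop
    · simp only [Function.uncurry_def, norm_mul, Real.norm_eq_abs, Real.abs_exp]
      gcongr
      exact Real.abs_cos_le_one _
  rw [hsw]
  apply integral_congr_ae
  have : ∀ᵐ t : ℝ, t ≠ 0 := by
    simp [ae_iff]
  filter_upwards [this] with t ht
  rw [intervalIntegral.integral_mul_const, intervalIntegral_cos_mul ht]


/-! ### Characteristic functions of normalised sums -/

lemma norm_cexp_mul_I_sub_taylor_le (x : ℝ) :
    ‖Complex.exp (x * Complex.I) - (1 + x * Complex.I - (x : ℂ) ^ 2 / 2)‖ ≤ 4 * |x| ^ 3 := by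
  rcases le_or_gt |x| 1 with hx | hx
  · have h := Complex.exp_bound (x := x * Complex.I) (by simpa using hx) (n := 3) (by norm_num)
    have e : ∑ m ∈ Finset.range 3, ((x : ℂ) * Complex.I) ^ m / (m.factorial : ℂ) =
        1 + x * Complex.I - (x : ℂ) ^ 2 / 2 := by
      simp [Finset.sum_range_succ, Nat.factorial, mul_pow]
      ring
    rw [e] at h
    refine h.trans ?_
    have : ‖(x : ℂ) * Complex.I‖ = |x| := by simp
    rw [this]
    have h3 : 0 ≤ |x| ^ 3 := by positivity
    norm_num [Nat.factorial]
    nlinarith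
  · have h1 : ‖Complex.exp (x * Complex.I)‖ = 1 := Complex.norm_exp_ofReal_mul_I x
    have h2 : ‖(1 + x * Complex.I - (x : ℂ) ^ 2 / 2)‖ ≤ 1 + |x| + |x| ^ 2 / 2 := by
      refine (norm_sub_le _ _).trans ?_
      refine add_le_add ((norm_add_le _ _).trans ?_) ?_ <;> simp
    have h3 := norm_sub_le (Complex.exp (x * Complex.I)) (1 + x * Complex.I - (x : ℂ) ^ 2 / 2)
    have h4 : 1 ≤ |x| ^ 2 := one_le_pow₀ hx.le
    have h5 : |x| ^ 2 ≤ |x| ^ 3 := pow_le_pow_right₀ hx.le (by norm_num)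
    have h6 : |x| ≤ |x| ^ 2 := by nlinarith
    linarith

lemma norm_pow_succ_sub_pow_succ_le {a b : ℂ} {r : ℝ} (ha : ‖a‖ ≤ r) (hb : ‖b‖ ≤ r) (n : ℕ) :
    ‖a ^ (n + 1) - b ^ (n + 1)‖ ≤ (n + 1) * r ^ n * ‖a - b‖ := by
  induction n with
  | zero => simp
  | succ n ih =>
    have hr : 0 ≤ r := (norm_nonneg a).trans ha
    have e : a ^ (n + 1 + 1) - b ^ (n + 1 + 1) =
        a * (a ^ (n + 1) - b ^ (n + 1)) + (a - b) * b ^ (n + 1) := by ring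
    rw [e]
    refine (norm_add_le _ _).trans ?_
    rw [norm_mul, norm_mul, norm_pow]
    have h1 : ‖a‖ * ‖a ^ (n + 1) - b ^ (n + 1)‖ ≤ r * ((n + 1) * r ^ n * ‖a - b‖) := by gcongr
    have h2 : ‖a - b‖ * ‖b‖ ^ (n + 1) ≤ ‖a - b‖ * r ^ (n + 1) := by gcongr
    push_cast
    calc _ ≤ r * ((n + 1) * r ^ n * ‖a - b‖) + ‖a - b‖ * r ^ (n + 1) := add_le_add h1 h2
      _ = _ := by ring

section CharFun

variable {𝒳 : Type*} [MeasurableSpace 𝒳]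

lemma integrable_of_abs_pow_three {μ : Measure 𝒳} [IsProbabilityMeasure μ] {Y : 𝒳 → ℝ}
    (hm : Measurable Y) (h3 : Integrable (fun x => |Y x| ^ 3) μ) :
    Integrable Y μ ∧ Integrable (fun x => Y x ^ 2) μ := by
  have hd : Integrable (fun x => 1 + |Y x| ^ 3) μ := (integrable_const _).add h3
  have hb : ∀ y : ℝ, 0 ≤ y → y ≤ 1 + y ^ 3 ∧ y ^ 2 ≤ 1 + y ^ 3 := by
    intro y hy
    rcases le_or_gt y 1 with h | h
    · have : 0 ≤ y ^ 3 := by positivity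
      constructor <;> nlinarith
    · have h1 : y ^ 2 ≤ y ^ 3 := pow_le_pow_right₀ h.le (by norm_num)
      constructor <;> nlinarith
  constructor
  · refine hd.mono' hm.aestronglyMeasurable (ae_of_all _ fun x => ?_)
    exact (hb _ (abs_nonneg (Y x))).1
  · refine hd.mono' (hm.pow_const 2).aestronglyMeasurable (ae_of_all _ fun x => ?_)
    rw [Real.norm_eq_abs, abs_pow]
    exact (hb _ (abs_nonneg (Y x))).2

lemma norm_integral_cexp_sub_le {μ : Measure 𝒳} [IsProbabilityMeasure μ] {Y : 𝒳 → ℝ} {K : ℝ}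
    (hm : Measurable Y) (h3 : Integrable (fun x => |Y x| ^ 3) μ) (h0 : ∫ x, Y x ∂μ = 0)
    (h2 : ∫ x, Y x ^ 2 ∂μ = 1) (hK : ∫ x, |Y x| ^ 3 ∂μ ≤ K) (u : ℝ) :
    ‖(∫ x, Complex.exp ((u * Y x : ℝ) * Complex.I) ∂μ) - (1 - (u : ℂ) ^ 2 / 2)‖ ≤
      4 * K * |u| ^ 3 := by
  obtain ⟨i1, i2⟩ := integrable_of_abs_pow_three hm h3
  have iexp : Integrable (fun x => Complex.exp ((u * Y x : ℝ) * Complex.I)) μ := by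
    refine (integrable_const (1 : ℝ)).mono' ?_ (ae_of_all _ fun x => ?_)
    · exact Measurable.aestronglyMeasurable (by fun_prop)
    · rw [Complex.norm_exp_ofReal_mul_I]
  have i1' : Integrable (fun x => ((Y x : ℝ) : ℂ)) μ := i1.ofReal
  have i2' : Integrable (fun x => ((Y x ^ 2 : ℝ) : ℂ)) μ := i2.ofReal
  have ipoly : Integrable (fun x => (1 : ℂ) + (u * Complex.I) * ((Y x : ℝ) : ℂ) -
      ((u : ℂ) ^ 2 / 2) * ((Y x ^ 2 : ℝ) : ℂ)) μ :=
    ((integrable_const _).add (i1'.const_mul _)).sub (i2'.const_mul _)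
  have e : ∫ x, ((1 : ℂ) + (u * Complex.I) * ((Y x : ℝ) : ℂ) -
      ((u : ℂ) ^ 2 / 2) * ((Y x ^ 2 : ℝ) : ℂ)) ∂μ = 1 - (u : ℂ) ^ 2 / 2 := by
    have ia : Integrable (fun x => (1 : ℂ) + (u * Complex.I) * ((Y x : ℝ) : ℂ)) μ :=
      (integrable_const _).add (i1'.const_mul _)
    rw [integral_sub ia (i2'.const_mul _), integral_add (integrable_const _) (i1'.const_mul _), integral_const_mul, integral_const_mul,
      integral_complex_ofReal, integral_complex_ofReal, h0, h2]
    simp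
  rw [← e, ← integral_sub iexp ipoly]
  calc _ ≤ ∫ x, 4 * |u| ^ 3 * |Y x| ^ 3 ∂μ := by
        refine norm_integral_le_of_norm_le (h3.const_mul _) (ae_of_all _ fun x => ?_)
        have := norm_cexp_mul_I_sub_taylor_le (u * Y x)
        rw [abs_mul, mul_pow, ← mul_assoc] at this
        refine le_trans (le_of_eq ?_) this
        congr 2
        push_cast; ring
    _ = 4 * |u| ^ 3 * ∫ x, |Y x| ^ 3 ∂μ := integral_const_mul _ _
    _ ≤ 4 * |u| ^ 3 * K := by gcongr
    _ = _ := by ring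

/-- With u = t/√n, both φ(u) and exp(−u²/2) have modulus at most exp(−u²/4) and differ by at most
5K|u|³. Telescoping the difference of nth powers leaves n − 1 factors exp(−u²/4); since n − 1 ≥ n/2,
they yield exp(−t²/8). -/
lemma norm_integral_cexp_pow_sub_le {μ : Measure 𝒳} [IsProbabilityMeasure μ] {Y : 𝒳 → ℝ} {K : ℝ}
    (hK1 : 1 ≤ K)
    (hm : Measurable Y) (h3 : Integrable (fun x => |Y x| ^ 3) μ) (h0 : ∫ x, Y x ∂μ = 0)
    (h2 : ∫ x, Y x ^ 2 ∂μ = 1) (hK : ∫ x, |Y x| ^ 3 ∂μ ≤ K) {n : ℕ} (hn : 2 ≤ n) {t : ℝ}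
    (ht : |t| ≤ Real.sqrt n / (16 * K)) :
    ‖(∫ x, Complex.exp ((t / Real.sqrt n * Y x : ℝ) * Complex.I) ∂μ) ^ n -
      (Real.exp (-t ^ 2 / 2) : ℝ)‖ ≤ 5 * K * |t| ^ 3 / Real.sqrt n * Real.exp (-t ^ 2 / 8) := by
  have hn0 : (0 : ℝ) < n := by positivity
  have hs : 0 < Real.sqrt n := Real.sqrt_pos.2 hn0
  have hs2 : Real.sqrt n ^ 2 = n := Real.sq_sqrt hn0.le
  set u := t / Real.sqrt n with hu
  set φ := ∫ x, Complex.exp ((u * Y x : ℝ) * Complex.I) ∂μ with hφ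
  have hu1 : |u| ≤ 1 / (16 * K) := by
    rw [hu, abs_div, abs_of_pos hs, div_le_iff₀ hs]
    calc |t| ≤ _ := ht
      _ = _ := by ring
  have hu2 : |u| ≤ 1 := hu1.trans (by rw [div_le_one (by positivity)]; linarith)
  have huK : 16 * K * |u| ≤ 1 := by
    rw [le_div_iff₀ (by positivity)] at hu1; linarith
  have hsq : |u| ^ 2 = u ^ 2 := sq_abs u
  have hu0 := abs_nonneg u
  have hd := norm_integral_cexp_sub_le hm h3 h0 h2 hK u
  rw [← hφ] at hd
  -- The cutoff on t enters here: the cubic remainder is at most half the quadratic term, so ‖φ‖ ≤ 1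
  -- − u²/4.
  have hcub : 4 * K * |u| ^ 3 ≤ u ^ 2 / 4 := by
    rw [← hsq]
    have : 4 * K * |u| ^ 3 = (16 * K * |u|) * |u| ^ 2 / 4 := by ring
    rw [this]
    have : (16 * K * |u|) * |u| ^ 2 ≤ 1 * |u| ^ 2 := by gcongr
    linarith
  have husq : u ^ 2 ≤ 1 := by rw [← hsq]; exact pow_le_one₀ hu0 hu2
  have e0 : (1 - (u : ℂ) ^ 2 / 2) = ((1 - u ^ 2 / 2 : ℝ) : ℂ) := by push_cast; ring
  have hφn : ‖φ‖ ≤ Real.exp (-u ^ 2 / 4) := by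
    have h := norm_sub_norm_le φ (1 - (u : ℂ) ^ 2 / 2)
    rw [e0, Complex.norm_real, Real.norm_of_nonneg (by linarith), ← e0] at h
    have h' := Real.add_one_le_exp (-u ^ 2 / 4)
    linarith
  have hg : ‖((Real.exp (-u ^ 2 / 2) : ℝ) : ℂ)‖ ≤ Real.exp (-u ^ 2 / 4) := by
    rw [Complex.norm_real, Real.norm_of_nonneg (Real.exp_pos _).le]
    apply Real.exp_le_exp.2
    nlinarith [sq_nonneg u]
  have hgd : ‖φ - ((Real.exp (-u ^ 2 / 2) : ℝ) : ℂ)‖ ≤ 5 * K * |u| ^ 3 := by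
    have h1 : ‖(1 - (u : ℂ) ^ 2 / 2) - ((Real.exp (-u ^ 2 / 2) : ℝ) : ℂ)‖ ≤ |u| ^ 3 := by
      rw [e0, ← Complex.ofReal_sub, Complex.norm_real, Real.norm_eq_abs]
      have hb := Real.abs_exp_sub_one_sub_id_le (x := -u ^ 2 / 2) (by
        rw [abs_le]; constructor <;> nlinarith [sq_nonneg u])
      rw [abs_sub_comm]
      have : Real.exp (-u ^ 2 / 2) - (1 - u ^ 2 / 2) =
        Real.exp (-u ^ 2 / 2) - 1 - (-u ^ 2 / 2) := by ring
      rw [this]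
      refine hb.trans ?_
      have h4 : |u| ^ 4 ≤ |u| ^ 3 := pow_le_pow_of_le_one hu0 hu2 (by norm_num)
      have : (-u ^ 2 / 2) ^ 2 = |u| ^ 4 / 4 := by rw [← hsq]; ring
      rw [this]
      have : 0 ≤ |u| ^ 4 := by positivity
      linarith
    have h2 := norm_sub_le_norm_sub_add_norm_sub φ (1 - (u : ℂ) ^ 2 / 2)
      ((Real.exp (-u ^ 2 / 2) : ℝ) : ℂ)
    have : |u| ^ 3 ≤ K * |u| ^ 3 := le_mul_of_one_le_left (by positivity) hK1
    linarith
  obtain ⟨k, rfl⟩ : ∃ k, n = k + 1 := ⟨n - 1, by omega⟩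
  have hp := norm_pow_succ_sub_pow_succ_le hφn hg k
  have ht2 : t ^ 2 = u ^ 2 * ((k + 1 : ℕ) : ℝ) := by
    rw [hu, div_pow, hs2]; field_simp
  have e1 : (((Real.exp (-u ^ 2 / 2) : ℝ) : ℂ)) ^ (k + 1) = ((Real.exp (-t ^ 2 / 2) : ℝ) : ℂ) := by
    rw [← Complex.ofReal_pow, ← Real.exp_nat_mul, ht2]
    congr 2; ring
  rw [e1] at hp
  refine hp.trans ?_
  have hk : (1 : ℝ) ≤ k := by
    have : 1 ≤ k := by omega
    exact_mod_cast this
  have e2 : Real.exp (-u ^ 2 / 4) ^ k ≤ Real.exp (-t ^ 2 / 8) := by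
    rw [← Real.exp_nat_mul]
    apply Real.exp_le_exp.2
    rw [ht2]; push_cast
    nlinarith [sq_nonneg u, mul_nonneg (sub_nonneg.2 hk) (sq_nonneg u)]
  have e3 : ((k : ℝ) + 1) * |u| ^ 3 = |t| ^ 3 / Real.sqrt ((k + 1 : ℕ) : ℝ) := by
    have : |t| = |u| * Real.sqrt ((k + 1 : ℕ) : ℝ) := by
      rw [hu, abs_div, abs_of_pos hs]; field_simp
    rw [this, mul_pow, eq_div_iff hs.ne']
    have : ((k : ℝ) + 1) = Real.sqrt ((k + 1 : ℕ) : ℝ) ^ 2 := by rw [hs2]; push_cast; ring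
    rw [this]; ring
  calc ((k : ℝ) + 1) * Real.exp (-u ^ 2 / 4) ^ k * ‖φ - ((Real.exp (-u ^ 2 / 2) : ℝ) : ℂ)‖
      ≤ ((k : ℝ) + 1) * Real.exp (-t ^ 2 / 8) * (5 * K * |u| ^ 3) := by gcongr
    _ = 5 * K * (((k : ℝ) + 1) * |u| ^ 3) * Real.exp (-t ^ 2 / 8) := by ring
    _ = _ := by rw [e3]; ring

end CharFun

/-! ### Gaussian smoothing and a Berry–Esseen bound -/

lemma abs_sin_mul_div_le (t y : ℝ) : |Real.sin (t * y) / t| ≤ |y| := by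
  rcases eq_or_ne t 0 with rfl | ht
  · simp
  · rw [abs_div, div_le_iff₀ (abs_pos.2 ht)]
    calc |Real.sin (t * y)| ≤ |t * y| := Real.abs_sin_le_abs
      _ = |y| * |t| := by rw [abs_mul, mul_comm]

/-- Smoothing: the distribution function of `W` plus an independent Gaussian of variance `a`
compared with the Gaussian one, through the characteristic function. -/
lemma abs_integral_gaussCdf_sub_le {Ω : Type*} [MeasurableSpace Ω] {ν : Measure Ω}
    [IsProbabilityMeasure ν] {W : Ω → ℝ} (hW : Measurable W) (hWi : Integrable W ν)
    {a : ℝ} (ha : 0 < a) {h : ℝ → ℝ} (hh : Integrable h)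
    (hb : ∀ t : ℝ, t ≠ 0 → ‖(∫ ω, Complex.exp ((-t * W ω : ℝ) * Complex.I) ∂ν) -
      (Real.exp (-t ^ 2 / 2) : ℝ)‖ / |t| * Real.exp (-a * t ^ 2 / 2) ≤ h t) (s : ℝ) :
    |(∫ ω, gaussCdf a (s - W ω) ∂ν) - gaussCdf (a + 1) s| ≤ (2 * Real.pi)⁻¹ * ∫ t, h t := by
  have hbound : Integrable (fun z : Ω × ℝ => |s - W z.1| * Real.exp (-a * z.2 ^ 2 / 2))
      (ν.prod volume) :=
    Integrable.mul_prod (f := fun ω => |s - W ω|) (g := fun t : ℝ => Real.exp (-a * t ^ 2 / 2))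
      ((integrable_const s).sub hWi).abs (integrable_exp_neg_half ha)
  have hprod : Integrable (Function.uncurry fun (ω : Ω) (t : ℝ) =>
      Real.sin (t * (s - W ω)) / t * Real.exp (-a * t ^ 2 / 2)) (ν.prod volume) := by
    refine hbound.mono' ?_ (ae_of_all _ fun z => ?_)
    · apply Measurable.aestronglyMeasurable
      simp only [Function.uncurry_def]
      fun_prop
    · simp only [Function.uncurry_def, norm_mul, Real.norm_eq_abs, Real.abs_exp]
      exact mul_le_mul_of_nonneg_right (abs_sin_mul_div_le _ _) (Real.exp_pos _).le
  have e1 : ∫ ω, gaussCdf a (s - W ω) ∂ν = 1 / 2 + (2 * Real.pi)⁻¹ *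
      ∫ t : ℝ, ∫ ω, Real.sin (t * (s - W ω)) / t * Real.exp (-a * t ^ 2 / 2) ∂ν := by
    have hl : Integrable (fun ω => ∫ t : ℝ, Real.sin (t * (s - W ω)) / t *
        Real.exp (-a * t ^ 2 / 2)) ν := hprod.integral_prod_left
    simp_rw [gaussCdf_eq_integral ha]
    rw [← integral_integral_swap hprod, integral_add (integrable_const _)
      (hl.const_mul _), integral_const_mul]
    simp
  have e2 : gaussCdf (a + 1) s = 1 / 2 + (2 * Real.pi)⁻¹ *
      ∫ t : ℝ, Real.sin (t * s) / t * Real.exp (-t ^ 2 / 2) * Real.exp (-a * t ^ 2 / 2) := by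
    rw [gaussCdf_eq_integral (by linarith)]
    congr 2
    refine integral_congr_ae (ae_of_all _ fun t => ?_)
    simp only
    rw [mul_assoc, ← Real.exp_add]
    congr 2; ring
  have i1 : Integrable (fun t : ℝ => ∫ ω, Real.sin (t * (s - W ω)) / t *
      Real.exp (-a * t ^ 2 / 2) ∂ν) := hprod.integral_prod_right
  have i2 : Integrable (fun t : ℝ => Real.sin (t * s) / t * Real.exp (-t ^ 2 / 2) *
      Real.exp (-a * t ^ 2 / 2)) := by
    refine ((integrable_exp_neg_half ha).const_mul |s|).mono' ?_ (ae_of_all _ fun t => ?_)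
    · exact Measurable.aestronglyMeasurable (by fun_prop)
    · simp only [norm_mul, Real.norm_eq_abs, Real.abs_exp]
      gcongr
      have h1 := abs_sin_mul_div_le t s
      have h2 : Real.exp (-t ^ 2 / 2) ≤ 1 := by
        rw [Real.exp_le_one_iff]; nlinarith [sq_nonneg t]
      calc _ ≤ |s| * 1 := by gcongr
        _ = |s| := mul_one _
  rw [e1, e2, add_sub_add_left_eq_sub, ← mul_sub, abs_mul, abs_of_pos (by positivity),
    ← integral_sub i1 i2]
  gcongr
  rw [← Real.norm_eq_abs]
  refine norm_integral_le_of_norm_le hh ?_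
  have : ∀ᵐ t : ℝ, t ≠ 0 := by simp [ae_iff]
  filter_upwards [this] with t ht
  refine le_trans ?_ (hb t ht)
  rw [integral_mul_const, ← sub_mul, norm_mul, Real.norm_eq_abs, Real.norm_eq_abs, Real.abs_exp]
  gcongr
  rw [integral_div, div_mul_eq_mul_div, ← sub_div, abs_div]
  gcongr
  have iexp : Integrable (fun ω => Complex.exp ((-t * W ω : ℝ) * Complex.I)) ν := by
    refine (integrable_const (1 : ℝ)).mono' ?_ (ae_of_all _ fun x => ?_)
    · exact Measurable.aestronglyMeasurable (by fun_prop)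
    · rw [Complex.norm_exp_ofReal_mul_I]
  set φ := ∫ ω, Complex.exp ((-t * W ω : ℝ) * Complex.I) ∂ν with hφ
  have e3 : ∫ ω, Real.sin (t * (s - W ω)) ∂ν = (Complex.exp ((t * s : ℝ) * Complex.I) * φ).im := by
    rw [hφ, ← integral_const_mul, ← RCLike.im_eq_complex_im, ← integral_im (iexp.const_mul _)]
    refine integral_congr_ae (ae_of_all _ fun ω => ?_)
    simp only [RCLike.im_eq_complex_im]
    rw [← Complex.exp_add, ← add_mul, ← Complex.ofReal_add, Complex.exp_ofReal_mul_I_im]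
    congr 1; ring
  have e4 : Real.sin (t * s) * Real.exp (-t ^ 2 / 2) =
      (Complex.exp ((t * s : ℝ) * Complex.I) * ((Real.exp (-t ^ 2 / 2) : ℝ) : ℂ)).im := by
    rw [Complex.im_mul_ofReal, Complex.exp_ofReal_mul_I_im]
  rw [e3, e4, ← Complex.sub_im, ← mul_sub]
  refine (Complex.abs_im_le_norm _).trans ?_
  rw [norm_mul, Complex.norm_exp_ofReal_mul_I, one_mul]


lemma integrable_sq_mul_exp_neg : Integrable (fun t : ℝ => t ^ 2 * Real.exp (-t ^ 2 / 8)) := by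
  have h := integrable_rpow_mul_exp_neg_mul_sq (b := 1 / 8) (by norm_num) (s := 2) (by norm_num)
  refine h.congr (ae_of_all _ fun t => ?_)
  simp only [Real.rpow_two]
  congr 2; ring

lemma integral_exp_neg_quarter {a : ℝ} (ha : 0 < a) :
    Integrable (fun t : ℝ => Real.exp (-a * t ^ 2 / 4)) ∧
    ∫ t : ℝ, Real.exp (-a * t ^ 2 / 4) = Real.sqrt (4 * Real.pi / a) := by
  have e : (fun t : ℝ => Real.exp (-a * t ^ 2 / 4)) = fun t => Real.exp (-(a / 4) * t ^ 2) := by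
    ext t; congr 1; ring
  rw [e]
  refine ⟨integrable_exp_neg_mul_sq (by positivity), ?_⟩
  rw [integral_gaussian]
  congr 1; field_simp

section Sample

variable {𝒳 : Type*} [MeasurableSpace 𝒳]

lemma integral_cexp_sum_eq_pow (μ : Measure 𝒳) [IsProbabilityMeasure μ] (Y : 𝒳 → ℝ) (n : ℕ)
    (v : ℝ) :
    ∫ x : Fin n → 𝒳, Complex.exp ((v * ∑ i, Y (x i) : ℝ) * Complex.I) ∂(Measure.pi fun _ => μ) =
      (∫ x, Complex.exp ((v * Y x : ℝ) * Complex.I) ∂μ) ^ n := by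
  have := integral_fintype_prod_eq_pow (ι := Fin n) (μ := μ)
    (fun x => Complex.exp ((v * Y x : ℝ) * Complex.I))
  rw [Fintype.card_fin] at this
  rw [← this]
  congr 1; ext x
  rw [← Complex.exp_sum, ← Finset.sum_mul, ← Complex.ofReal_sum, Finset.mul_sum]

/-- Below the cutoff c = √n/(16K) the expansion of the characteristic function gives an integrable
error of order 1/√n. Above it the trivial bound 2 is used, and the smoothing factor makes that range
negligible. The variance is of order log n / n precisely so that this factor is polynomially small
at the cutoff. -/
lemma abs_gaussCdf_smoothing_sum_le (μ : Measure 𝒳) [IsProbabilityMeasure μ] {K : ℝ} (hK1 : 1 ≤ K)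
    {n : ℕ} (hn : 3 ≤ n) {Y : 𝒳 → ℝ}
    (hm : Measurable Y) (h3 : Integrable (fun x => |Y x| ^ 3) μ) (h0 : ∫ x, Y x ∂μ = 0)
    (h2 : ∫ x, Y x ^ 2 ∂μ = 1) (hK : ∫ x, |Y x| ^ 3 ∂μ ≤ K) (s : ℝ) :
    |(∫ x : Fin n → 𝒳, gaussCdf (1024 * K ^ 2 * Real.log n / n)
        (s - (∑ i, Y (x i)) / Real.sqrt n) ∂(Measure.pi fun _ => μ)) -
      gaussCdf (1024 * K ^ 2 * Real.log n / n + 1) s| ≤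
      (5 * K * (∫ t : ℝ, t ^ 2 * Real.exp (-t ^ 2 / 8)) + 32 * K) / Real.sqrt n := by
  have hn0 : (0 : ℝ) < n := by positivity
  have hn3 : (3 : ℝ) ≤ n := by exact_mod_cast hn
  have hlog : 1 ≤ Real.log n := by
    rw [Real.le_log_iff_exp_le hn0]
    exact (Real.exp_one_lt_three.le).trans hn3
  have hs : 0 < Real.sqrt n := Real.sqrt_pos.2 hn0
  have hs1 : 1 ≤ Real.sqrt n := Real.one_le_sqrt.2 (by linarith)
  have hs2 : Real.sqrt n ^ 2 = n := Real.sq_sqrt hn0.le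
  have hK0 : 0 < K := by linarith
  set a := 1024 * K ^ 2 * Real.log n / n with ha_def
  have ha : 0 < a := by positivity
  set c := Real.sqrt n / (16 * K) with hc
  have hc0 : 0 < c := by positivity
  obtain ⟨iq, eq⟩ := integral_exp_neg_quarter ha
  obtain ⟨i1, -⟩ := integrable_of_abs_pow_three hm h3
  have hWm : Measurable fun x : Fin n → 𝒳 => (∑ i, Y (x i)) / Real.sqrt n := by fun_prop
  have hWi : Integrable (fun x : Fin n → 𝒳 => (∑ i, Y (x i)) / Real.sqrt n)
      (Measure.pi fun _ => μ) :=
    (integrable_finsetSum _ fun i _ => integrable_comp_eval i1).div_const _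
  -- Half of the exponent a t²/2 is spent at the cutoff to gain 1/n; the other half keeps the
  -- integrand integrable.
  have hdecay : Real.exp (-a * c ^ 2 / 4) = (n : ℝ)⁻¹ := by
    have : -a * c ^ 2 / 4 = -Real.log n := by
      rw [hc, ha_def, div_pow, hs2]; field_simp; ring
    rw [this, Real.exp_neg, Real.exp_log hn0]
  have key := abs_integral_gaussCdf_sub_le (ν := Measure.pi fun _ : Fin n => μ) hWm hWi ha
    (h := fun t => 5 * K / Real.sqrt n * (t ^ 2 * Real.exp (-t ^ 2 / 8)) +
      2 / c * (n : ℝ)⁻¹ * Real.exp (-a * t ^ 2 / 4))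
    ((integrable_sq_mul_exp_neg.const_mul _).add (iq.const_mul _)) ?_ s
  · refine key.trans ?_
    rw [integral_add (integrable_sq_mul_exp_neg.const_mul _) (iq.const_mul _),
      integral_const_mul, integral_const_mul, eq]
    have hI : 0 ≤ ∫ t : ℝ, t ^ 2 * Real.exp (-t ^ 2 / 8) := integral_nonneg fun t => by positivity
    have hpi : (2 * Real.pi)⁻¹ ≤ 1 := inv_le_one_of_one_le₀ (by linarith [Real.pi_gt_three])
    have hsq : Real.sqrt (4 * Real.pi / a) ≤ Real.sqrt n := by
      apply Real.sqrt_le_sqrt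
      rw [div_le_iff₀ ha, ha_def]
      have h4 : 4 * Real.pi ≤ 1024 * 1 := by linarith [Real.pi_le_four]
      have h5 : (1 : ℝ) ≤ K ^ 2 * Real.log n := by
        have : (1 : ℝ) ≤ K ^ 2 := one_le_pow₀ hK1
        nlinarith
      calc 4 * Real.pi ≤ 1024 * (K ^ 2 * Real.log n) := by linarith
        _ = _ := by field_simp
    have hsecond : 2 / c * (n : ℝ)⁻¹ * Real.sqrt (4 * Real.pi / a) ≤ 32 * K / Real.sqrt n := by
      calc _ ≤ 2 / c * (n : ℝ)⁻¹ * Real.sqrt n := by gcongr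
        _ = 32 * K / n := by rw [hc]; field_simp; norm_num
        _ ≤ 32 * K / Real.sqrt n := by
          gcongr
          calc Real.sqrt n = Real.sqrt n * 1 := (mul_one _).symm
            _ ≤ Real.sqrt n * Real.sqrt n := by gcongr
            _ = n := by rw [← sq, hs2]
    calc _ ≤ 1 * (5 * K / Real.sqrt n * (∫ t : ℝ, t ^ 2 * Real.exp (-t ^ 2 / 8)) +
          2 / c * (n : ℝ)⁻¹ * Real.sqrt (4 * Real.pi / a)) := by gcongr
      _ ≤ 5 * K / Real.sqrt n * (∫ t : ℝ, t ^ 2 * Real.exp (-t ^ 2 / 8)) + 32 * K / Real.sqrt n := by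
          rw [one_mul]; gcongr
      _ = _ := by ring
  · intro t ht
    have ht0 : 0 < |t| := abs_pos.2 ht
    have e : ∫ x : Fin n → 𝒳, Complex.exp ((-t * ((∑ i, Y (x i)) / Real.sqrt n) : ℝ) * Complex.I)
        ∂(Measure.pi fun _ => μ) =
        (∫ x, Complex.exp ((-t / Real.sqrt n * Y x : ℝ) * Complex.I) ∂μ) ^ n := by
      rw [← integral_cexp_sum_eq_pow]
      congr 1; ext x; congr 3; ring
    rw [e]
    have hterm2 : 0 ≤ 2 / c * (n : ℝ)⁻¹ * Real.exp (-a * t ^ 2 / 4) := by positivity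
    have hterm1 : 0 ≤ 5 * K / Real.sqrt n * (t ^ 2 * Real.exp (-t ^ 2 / 8)) := by positivity
    have he1 : Real.exp (-a * t ^ 2 / 2) ≤ 1 := by
      rw [Real.exp_le_one_iff]; nlinarith [mul_nonneg ha.le (sq_nonneg t)]
    rcases le_or_gt |t| c with htc | htc
    · have hb := norm_integral_cexp_pow_sub_le hK1 hm h3 h0 h2 hK (n := n) (by omega) (t := -t)
        (by rwa [abs_neg])
      rw [abs_neg, neg_sq] at hb
      refine le_trans ?_ (le_add_of_nonneg_right hterm2)
      calc _ ≤ (5 * K * |t| ^ 3 / Real.sqrt n * Real.exp (-t ^ 2 / 8)) / |t| * 1 := by gcongr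
        _ = 5 * K / Real.sqrt n * (|t| ^ 2 * Real.exp (-t ^ 2 / 8)) := by field_simp
        _ = _ := by rw [sq_abs]
    · refine le_trans ?_ (le_add_of_nonneg_left hterm1)
      have hn2 : ‖(∫ x, Complex.exp ((-t / Real.sqrt n * Y x : ℝ) * Complex.I) ∂μ) ^ n -
          ((Real.exp (-t ^ 2 / 2) : ℝ) : ℂ)‖ ≤ 2 := by
        refine (norm_sub_le _ _).trans ?_
        have h1 : ‖(∫ x, Complex.exp ((-t / Real.sqrt n * Y x : ℝ) * Complex.I) ∂μ) ^ n‖ ≤ 1 := by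
          rw [norm_pow]
          apply pow_le_one₀ (norm_nonneg _)
          refine (norm_integral_le_integral_norm _).trans ?_
          simp_rw [Complex.norm_exp_ofReal_mul_I]; simp
        have h2 : ‖((Real.exp (-t ^ 2 / 2) : ℝ) : ℂ)‖ ≤ 1 := by
          rw [Complex.norm_real, Real.norm_of_nonneg (Real.exp_pos _).le, Real.exp_le_one_iff]
          nlinarith [sq_nonneg t]
        linarith
      have hexp : Real.exp (-a * t ^ 2 / 2) ≤ (n : ℝ)⁻¹ * Real.exp (-a * t ^ 2 / 4) := by
        rw [← hdecay, ← Real.exp_add]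
        apply Real.exp_le_exp.2
        have : c ^ 2 ≤ t ^ 2 := by rw [← sq_abs t]; gcongr
        nlinarith [mul_le_mul_of_nonneg_left this ha.le]
      calc _ ≤ 2 / c * ((n : ℝ)⁻¹ * Real.exp (-a * t ^ 2 / 4)) := by gcongr
        _ = _ := by ring

/-- Lower bound for the distribution function of a normalised i.i.d. sum, with a Berry–Esseen error
of order `log n / √n`. -/
theorem gaussCdf_sub_le_measure_sum_le (μ : Measure 𝒳) [IsProbabilityMeasure μ] {K : ℝ}
    (hK1 : 1 ≤ K) : ∃ C > 0, ∃ n₀ : ℕ, ∀ n ≥ n₀, ∀ Y : 𝒳 → ℝ, Measurable Y →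
      Integrable (fun x => |Y x| ^ 3) μ → ∫ x, Y x ∂μ = 0 → ∫ x, Y x ^ 2 ∂μ = 1 →
      ∫ x, |Y x| ^ 3 ∂μ ≤ K → ∀ s : ℝ, 0 ≤ s →
      gaussCdf 1 (s / 2) - C * Real.log n / Real.sqrt n ≤
        (Measure.pi fun _ : Fin n => μ).real {x | ∑ i, Y (x i) ≤ s * Real.sqrt n} := by
  set C₁ := 5 * K * (∫ t : ℝ, t ^ 2 * Real.exp (-t ^ 2 / 8)) + 32 * K with hC₁
  have hI : 0 ≤ ∫ t : ℝ, t ^ 2 * Real.exp (-t ^ 2 / 8) := integral_nonneg fun t => by positivity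
  have hC₁0 : 0 < C₁ := by positivity
  have hlim : Tendsto (fun n : ℕ => 1024 * K ^ 2 * (Real.log n / n)) atTop (𝓝 0) := by
    have h := (Real.isLittleO_log_id_atTop.tendsto_div_nhds_zero).comp tendsto_natCast_atTop_atTop
    simpa using h.const_mul (1024 * K ^ 2)
  obtain ⟨n₁, hn₁⟩ := eventually_atTop.1 (hlim.eventually (gt_mem_nhds (show (0 : ℝ) < 3 by norm_num)))
  refine ⟨Real.sqrt (2 * (1024 * K ^ 2)) + C₁ + 1, by positivity, max 3 n₁, ?_⟩
  intro n hn Y hm h3 h0 h2 hK s hs0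
  have hn3 : 3 ≤ n := (le_max_left _ _).trans hn
  have ha3 := hn₁ n ((le_max_right _ _).trans hn)
  rw [← mul_div_assoc] at ha3
  have hsm := fun s => abs_gaussCdf_smoothing_sum_le μ hK1 hn3 hm h3 h0 h2 hK s
  have hn3' : (3 : ℝ) ≤ n := by exact_mod_cast hn3
  have hn0 : (0 : ℝ) < n := by positivity
  have hlog : 1 ≤ Real.log n := by
    rw [Real.le_log_iff_exp_le hn0]
    exact (Real.exp_one_lt_three.le).trans hn3'
  have hs : 0 < Real.sqrt n := Real.sqrt_pos.2 hn0
  have hs1 : 1 ≤ Real.sqrt n := Real.one_le_sqrt.2 (by linarith)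
  have hs2 : Real.sqrt n ^ 2 = n := Real.sq_sqrt hn0.le
  set a := 1024 * K ^ 2 * Real.log n / n with ha_def
  have ha : 0 < a := by positivity
  -- Chosen so that r²/(2a) = log n: the smoothing Gaussian exceeds r with probability at most 1/n.
  -- This shift is of order log n/√n and is the source of the logarithm in the error.
  set r := Real.sqrt (2 * (1024 * K ^ 2)) * Real.log n / Real.sqrt n with hr
  have hr0 : 0 ≤ r := by positivity
  have htail : gaussCdf a (-r) ≤ (n : ℝ)⁻¹ := by
    refine (gaussCdf_neg_le ha hr0).trans ?_
    have : -r ^ 2 / (2 * a) = -Real.log n := by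
      rw [hr, ha_def, div_pow, mul_pow, hs2, Real.sq_sqrt (by positivity)]
      field_simp
    rw [this, Real.exp_neg, Real.exp_log hn0]
    have : (0 : ℝ) < (n : ℝ)⁻¹ := by positivity
    linarith
  set Q := Measure.pi fun _ : Fin n => μ with hQ
  set A : Set (Fin n → 𝒳) := {x | ∑ i, Y (x i) ≤ s * Real.sqrt n} with hA
  have hAm : MeasurableSet A := measurableSet_le (by fun_prop) measurable_const
  have hWm : Measurable fun x : Fin n → 𝒳 => (∑ i, Y (x i)) / Real.sqrt n := by fun_prop
  -- Unsmoothing: if W > s, then s − r − W < −r and the smoothed value is at most the tail 1/n.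
  have hpt : ∀ x : Fin n → 𝒳, gaussCdf a (s - r - (∑ i, Y (x i)) / Real.sqrt n) ≤
      A.indicator 1 x + (n : ℝ)⁻¹ := by
    intro x
    by_cases hx : x ∈ A
    · rw [indicator_of_mem hx]
      have := gaussCdf_le_one ha (s - r - (∑ i, Y (x i)) / Real.sqrt n)
      have : (0 : ℝ) < (n : ℝ)⁻¹ := by positivity
      simp only [Pi.one_apply]; linarith
    · rw [indicator_of_notMem hx, zero_add]
      refine (gaussCdf_mono a ?_).trans htail
      have hx' : s * Real.sqrt n < ∑ i, Y (x i) := not_le.1 hx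
      have : s ≤ (∑ i, Y (x i)) / Real.sqrt n := by rw [le_div_iff₀ hs]; exact hx'.le
      linarith
  have hint : ∫ x, gaussCdf a (s - r - (∑ i, Y (x i)) / Real.sqrt n) ∂Q ≤ Q.real A + (n : ℝ)⁻¹ := by
    have i2 : Integrable (A.indicator (1 : (Fin n → 𝒳) → ℝ)) Q :=
      (integrable_const (1 : ℝ)).indicator hAm
    have e : ∫ x, (A.indicator (1 : (Fin n → 𝒳) → ℝ) x + (n : ℝ)⁻¹) ∂Q = Q.real A + (n : ℝ)⁻¹ := by
      rw [integral_add i2 (integrable_const _), integral_indicator_one hAm]; simp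
    rw [← e]
    refine integral_mono ?_ (i2.add (integrable_const _)) hpt
    refine (integrable_const (1 : ℝ)).mono' ?_ (ae_of_all _ fun x => ?_)
    · exact ((continuous_gaussCdf a).measurable.comp (hWm.const_sub _)).aestronglyMeasurable
    · rw [Real.norm_of_nonneg (gaussCdf_nonneg ha _)]
      exact gaussCdf_le_one ha _
  have h1 := (abs_le.1 (hsm (s - r))).1
  rw [← hC₁] at h1
  have hsq1 : 1 ≤ Real.sqrt (a + 1) := Real.one_le_sqrt.2 (by linarith)
  have hsq2 : Real.sqrt (a + 1) ≤ 2 := by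
    rw [Real.sqrt_le_left (by norm_num)]; linarith
  -- The smoothed limit has variance a + 1 ≤ 4; for s ≥ 0 this costs at most the factor 2 in s / 2.
  -- Only a linear lower bound on the distribution function is wanted later, so the factor is
  -- harmless.
  have h4 : gaussCdf 1 (s / 2) - r ≤ gaussCdf (a + 1) (s - r) := by
    rw [gaussCdf_scale (a := a + 1) (by linarith)]
    have e : s / 2 ≤ s / Real.sqrt (a + 1) := by gcongr
    have e2 : (s - r) / Real.sqrt (a + 1) ≤ s / Real.sqrt (a + 1) := by gcongr; linarith
    have e3 := gaussCdf_one_sub_le e2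
    have e4 := gaussCdf_mono 1 e
    have e5 : s / Real.sqrt (a + 1) - (s - r) / Real.sqrt (a + 1) ≤ r := by
      rw [← sub_div, sub_sub_cancel]; exact div_le_self hr0 hsq1
    linarith
  have h5 : (n : ℝ)⁻¹ ≤ Real.log n / Real.sqrt n := by
    rw [inv_eq_one_div]
    gcongr
    calc Real.sqrt n = Real.sqrt n * 1 := (mul_one _).symm
      _ ≤ Real.sqrt n * Real.sqrt n := by gcongr
      _ = n := by rw [← sq, hs2]
  have h6 : C₁ / Real.sqrt n ≤ C₁ * Real.log n / Real.sqrt n := by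
    gcongr; exact le_mul_of_one_le_right hC₁0.le hlog
  have h7 : (Real.sqrt (2 * (1024 * K ^ 2)) + C₁ + 1) * Real.log n / Real.sqrt n =
      r + C₁ * Real.log n / Real.sqrt n + Real.log n / Real.sqrt n := by rw [hr]; ring
  rw [h7]
  linarith

end Sample


/-! ### Sub-exponential functions and concentration of their sums -/

section SubExp

variable {𝒳 : Type*} [MeasurableSpace 𝒳]

/-- A measurable function with a finite exponential moment of its absolute value. -/
def SubExp (μ : Measure 𝒳) (Y : 𝒳 → ℝ) : Prop :=
  Measurable Y ∧ ∃ η > (0 : ℝ), Integrable (fun x => Real.exp (η * |Y x|)) μ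

namespace SubExp

variable {μ : Measure 𝒳} {Y Z : 𝒳 → ℝ}

lemma measurable (hY : SubExp μ Y) : Measurable Y := hY.1

lemma mono (hZ : SubExp μ Z) (hm : Measurable Y) (h : ∀ x, |Y x| ≤ |Z x|) : SubExp μ Y := by
  obtain ⟨hZm, η, hη, hi⟩ := hZ
  refine ⟨hm, η, hη, hi.mono' ?_ (ae_of_all _ fun x => ?_)⟩
  · exact Measurable.aestronglyMeasurable (by fun_prop)
  · rw [Real.norm_eq_abs, Real.abs_exp]
    exact Real.exp_le_exp.2 (mul_le_mul_of_nonneg_left (h x) hη.le)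

/-- With half the smaller exponent, the exponential of |Y + Z| is at most the larger of the two
given exponentials, hence at most their sum; no Hölder inequality is required. -/
lemma add (hY : SubExp μ Y) (hZ : SubExp μ Z) : SubExp μ (fun x => Y x + Z x) := by
  obtain ⟨hYm, η, hη, hi⟩ := hY
  obtain ⟨hZm, ζ, hζ, hj⟩ := hZ
  refine ⟨hYm.add hZm, min η ζ / 2, by positivity, ?_⟩
  refine (hi.add hj).mono' ?_ (ae_of_all _ fun x => ?_)
  · exact Measurable.aestronglyMeasurable (by fun_prop)
  · rw [Real.norm_eq_abs, Real.abs_exp]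
    have h1 : min η ζ / 2 * |Y x + Z x| ≤ max (η * |Y x|) (ζ * |Z x|) := by
      have a1 := mul_le_mul_of_nonneg_right (min_le_left η ζ) (abs_nonneg (Y x))
      have a2 := mul_le_mul_of_nonneg_right (min_le_right η ζ) (abs_nonneg (Z x))
      have a3 := le_max_left (η * |Y x|) (ζ * |Z x|)
      have a4 := le_max_right (η * |Y x|) (ζ * |Z x|)
      have a5 : min η ζ / 2 * |Y x + Z x| ≤ min η ζ / 2 * (|Y x| + |Z x|) := by
        gcongr; exact abs_add_le _ _
      linarith
    refine (Real.exp_le_exp.2 h1).trans ?_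
    rcases max_choice (η * |Y x|) (ζ * |Z x|) with h | h <;> rw [h] <;>
      simp only [Pi.add_apply] <;> linarith [Real.exp_pos (η * |Y x|), Real.exp_pos (ζ * |Z x|)]

lemma const_mul (hY : SubExp μ Y) (c : ℝ) : SubExp μ (fun x => c * Y x) := by
  obtain ⟨hYm, η, hη, hi⟩ := hY
  refine ⟨hYm.const_mul c, η / (|c| + 1), by positivity, hi.mono' ?_ (ae_of_all _ fun x => ?_)⟩
  · exact Measurable.aestronglyMeasurable (by fun_prop)
  · rw [Real.norm_eq_abs, Real.abs_exp]
    apply Real.exp_le_exp.2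
    rw [abs_mul, div_mul_eq_mul_div, div_le_iff₀ (by positivity)]
    nlinarith [mul_nonneg hη.le (abs_nonneg (Y x))]

lemma const [IsFiniteMeasure μ] (c : ℝ) : SubExp μ (fun _ => c) :=
  ⟨measurable_const, 1, one_pos, integrable_const _⟩

lemma abs (hY : SubExp μ Y) : SubExp μ (fun x => |Y x|) :=
  hY.mono (by have := hY.1; fun_prop) fun x => by simp

lemma sum [IsFiniteMeasure μ] {ι : Type*} (s : Finset ι) {Y : ι → 𝒳 → ℝ}
    (hY : ∀ i ∈ s, SubExp μ (Y i)) : SubExp μ (fun x => ∑ i ∈ s, Y i x) := by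
  classical
  induction s using Finset.induction_on with
  | empty => simpa using SubExp.const (μ := μ) 0
  | insert i s hi ih =>
    simp_rw [Finset.sum_insert hi]
    exact (hY i (Finset.mem_insert_self i s)).add
      (ih fun j hj => hY j (Finset.mem_insert_of_mem hj))

lemma integrable_abs_pow (hY : SubExp μ Y) (k : ℕ) : Integrable (fun x => |Y x| ^ k) μ := by
  obtain ⟨hYm, η, hη, hi⟩ := hY
  refine (hi.const_mul (k.factorial / η ^ k)).mono' ?_ (ae_of_all _ fun x => ?_)
  · exact Measurable.aestronglyMeasurable (by fun_prop)
  · have h := Real.pow_div_factorial_le_exp (η * |Y x|) (by positivity) k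
    rw [Real.norm_of_nonneg (by positivity)]
    rw [div_le_iff₀ (by positivity), mul_pow] at h
    rw [div_mul_eq_mul_div, le_div_iff₀ (by positivity)]
    linarith

lemma integrable (hY : SubExp μ Y) : Integrable Y μ := by
  have := hY.integrable_abs_pow 1
  simp only [pow_one] at this
  exact (integrable_norm_iff hY.1.aestronglyMeasurable).1 this

lemma sub_const [IsFiniteMeasure μ] (hY : SubExp μ Y) (c : ℝ) : SubExp μ (fun x => Y x - c) := by
  simpa [sub_eq_add_neg] using hY.add (SubExp.const (-c))

end SubExp

lemma exp_le_one_add_add_sq_mul_exp_abs (y : ℝ) :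
    Real.exp y ≤ 1 + y + y ^ 2 * Real.exp |y| := by
  have h := Complex.norm_exp_sub_sum_le_norm_mul_exp (y : ℂ) 2
  have e : Complex.exp y - ∑ m ∈ Finset.range 2, (y : ℂ) ^ m / (m.factorial : ℂ) =
      ((Real.exp y - 1 - y : ℝ) : ℂ) := by
    simp [Finset.sum_range_succ]; ring
  rw [e, Complex.norm_real, Complex.norm_real, Real.norm_eq_abs, Real.norm_eq_abs, sq_abs] at h
  linarith [le_abs_self (Real.exp y - 1 - y)]

/-- In exp y ≤ 1 + y + y² exp|y| the linear term integrates to zero. For |t| ≤ η/2, one half of the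
exponent η dominates Z² and the other half dominates exp|tZ|. -/
lemma SubExp.exists_integral_exp_le {μ : Measure 𝒳} [IsProbabilityMeasure μ] {Z : 𝒳 → ℝ}
    (hZ : SubExp μ Z) (h0 : ∫ x, Z x ∂μ = 0) :
    ∃ C > 0, ∃ t₀ > 0, ∀ t : ℝ, |t| ≤ t₀ → Integrable (fun x => Real.exp (t * Z x)) μ ∧
      ∫ x, Real.exp (t * Z x) ∂μ ≤ Real.exp (C * t ^ 2) := by
  have hZi := hZ.integrable
  obtain ⟨hm, η, hη, hi⟩ := hZ
  have hpos : 0 < ∫ x, Real.exp (η * |Z x|) ∂μ := integral_exp_pos hi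
  refine ⟨8 / η ^ 2 * ∫ x, Real.exp (η * |Z x|) ∂μ, by positivity, η / 2, by positivity,
    fun t ht => ?_⟩
  have hint : Integrable (fun x => Real.exp (t * Z x)) μ := by
    refine hi.mono' (Measurable.aestronglyMeasurable (by fun_prop)) (ae_of_all _ fun x => ?_)
    rw [Real.norm_eq_abs, Real.abs_exp]
    apply Real.exp_le_exp.2
    calc t * Z x ≤ |t * Z x| := le_abs_self _
      _ = |t| * |Z x| := abs_mul _ _
      _ ≤ η * |Z x| := by gcongr; linarith
  refine ⟨hint, ?_⟩
  have hb : ∀ x, Real.exp (t * Z x) ≤ 1 + t * Z x + t ^ 2 * (8 / η ^ 2) * Real.exp (η * |Z x|) := by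
    intro x
    refine (exp_le_one_add_add_sq_mul_exp_abs _).trans ?_
    have h1 : Real.exp |t * Z x| ≤ Real.exp (η / 2 * |Z x|) := by
      rw [abs_mul]; gcongr
    have h2 : (Z x) ^ 2 ≤ 8 / η ^ 2 * Real.exp (η / 2 * |Z x|) := by
      have h := Real.pow_div_factorial_le_exp (η / 2 * |Z x|) (by positivity) 2
      rw [mul_pow, sq_abs] at h
      simp only [Nat.factorial] at h
      rw [div_mul_eq_mul_div, le_div_iff₀ (by positivity)]
      push_cast at h
      linarith
    have h3 : Real.exp (η * |Z x|) = Real.exp (η / 2 * |Z x|) * Real.exp (η / 2 * |Z x|) := by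
      rw [← Real.exp_add]; congr 1; ring
    have : (t * Z x) ^ 2 * Real.exp |t * Z x| ≤ t ^ 2 * (8 / η ^ 2) * Real.exp (η * |Z x|) := by
      rw [h3, mul_pow]
      calc _ ≤ t ^ 2 * (8 / η ^ 2 * Real.exp (η / 2 * |Z x|)) * Real.exp (η / 2 * |Z x|) := by gcongr
        _ = _ := by ring
    linarith
  have hI : ∫ x, (1 + t * Z x + t ^ 2 * (8 / η ^ 2) * Real.exp (η * |Z x|)) ∂μ =
      1 + t ^ 2 * (8 / η ^ 2) * ∫ x, Real.exp (η * |Z x|) ∂μ := by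
    have ia : Integrable (fun x => 1 + t * Z x) μ := (integrable_const _).add (hZi.const_mul t)
    rw [integral_add ia (hi.const_mul _), integral_add (integrable_const _) (hZi.const_mul t),
      integral_const_mul, integral_const_mul, h0]
    simp
  have ib : Integrable (fun x => 1 + t * Z x + t ^ 2 * (8 / η ^ 2) * Real.exp (η * |Z x|)) μ :=
    ((integrable_const (1 : ℝ)).add (hZi.const_mul t)).add (hi.const_mul _)
  refine (integral_mono hint ib hb).trans ?_
  rw [hI]
  have := Real.add_one_le_exp (8 / η ^ 2 * (∫ x, Real.exp (η * |Z x|) ∂μ) * t ^ 2)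
  linarith

lemma SubExp.exists_measure_sum_ge_le {μ : Measure 𝒳} [IsProbabilityMeasure μ] {Z : 𝒳 → ℝ}
    (hZ : SubExp μ Z) (h0 : ∫ x, Z x ∂μ = 0) :
    ∃ C > 0, ∃ t₀ > 0, ∀ (n : ℕ) (t s : ℝ), 0 ≤ t → t ≤ t₀ →
      (Measure.pi fun _ : Fin n => μ).real {x | s ≤ |∑ i, Z (x i)|} ≤
        2 * Real.exp (C * n * t ^ 2 - t * s) := by
  obtain ⟨C, hC, t₀, ht₀, h⟩ := hZ.exists_integral_exp_le h0
  have hm := hZ.measurable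
  refine ⟨C, hC, t₀, ht₀, fun n t s ht ht' => ?_⟩
  set Q := Measure.pi fun _ : Fin n => μ
  have hmgf : ∀ t : ℝ, |t| ≤ t₀ → Integrable (fun x : Fin n → 𝒳 => Real.exp (t * ∑ i, Z (x i))) Q ∧
      mgf (fun x : Fin n → 𝒳 => ∑ i, Z (x i)) Q t ≤ Real.exp (C * n * t ^ 2) := by
    intro t ht
    obtain ⟨hi, hle⟩ := h t ht
    have e : (fun x : Fin n → 𝒳 => Real.exp (t * ∑ i, Z (x i))) =
        fun x => ∏ i, Real.exp (t * Z (x i)) := by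
      ext x; rw [Finset.mul_sum, Real.exp_sum]
    refine ⟨?_, ?_⟩
    · rw [e]
      exact Integrable.fintype_prod (f := fun _ x => Real.exp (t * Z x)) fun _ => hi
    · unfold mgf
      rw [e, integral_fintype_prod_eq_pow (fun x => Real.exp (t * Z x)), Fintype.card_fin]
      calc _ ≤ (Real.exp (C * t ^ 2)) ^ n := by
            gcongr
        _ = _ := by rw [← Real.exp_nat_mul]; congr 1; ring
  obtain ⟨i1, m1⟩ := hmgf t (by rwa [abs_of_nonneg ht])
  obtain ⟨i2, m2⟩ := hmgf (-t) (by rwa [abs_neg, abs_of_nonneg ht])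
  have u1 := measure_ge_le_exp_mul_mgf s ht i1
  have u2 := measure_le_le_exp_mul_mgf (-s) (neg_nonpos.2 ht) i2
  have hsub : {x : Fin n → 𝒳 | s ≤ |∑ i, Z (x i)|} ⊆
      {x | s ≤ ∑ i, Z (x i)} ∪ {x | ∑ i, Z (x i) ≤ -s} := by
    intro x hx
    rcases le_abs.1 (show s ≤ |∑ i, Z (x i)| from hx) with h | h
    · exact Or.inl h
    · exact Or.inr (show _ ≤ -s by linarith)
  have e1 : Real.exp (-t * s) * Real.exp (C * n * t ^ 2) = Real.exp (C * n * t ^ 2 - t * s) := by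
    rw [← Real.exp_add]; congr 1; ring
  have e2 : Real.exp (- -t * -s) * Real.exp (C * n * (-t) ^ 2) =
      Real.exp (C * n * t ^ 2 - t * s) := by
    rw [← Real.exp_add]; congr 1; ring
  calc _ ≤ Q.real ({x | s ≤ ∑ i, Z (x i)} ∪ {x | ∑ i, Z (x i) ≤ -s}) := measureReal_mono hsub
    _ ≤ Q.real {x | s ≤ ∑ i, Z (x i)} + Q.real {x | ∑ i, Z (x i) ≤ -s} := measureReal_union_le _ _
    _ ≤ Real.exp (-t * s) * Real.exp (C * n * t ^ 2) +
        Real.exp (- -t * -s) * Real.exp (C * n * (-t) ^ 2) := by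
      refine add_le_add (u1.trans ?_) (u2.trans ?_) <;> gcongr
    _ = _ := by rw [e1, e2]; ring

/-- Gaussian-type tail of the centred sums of finitely many sub-exponential functions, in the range
of moderate deviations. -/
lemma exists_measure_exists_sum_ge_le {μ : Measure 𝒳} [IsProbabilityMeasure μ] {ι : Type*}
    (s : Finset ι) {Y : ι → 𝒳 → ℝ} (hY : ∀ k ∈ s, SubExp μ (Y k)) :
    ∃ D > 0, ∃ c > 0, ∀ (n : ℕ) (r : ℝ), 0 ≤ r → r ≤ c * Real.sqrt n →
      (Measure.pi fun _ : Fin n => μ).real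
        {x | ∃ k ∈ s, r * Real.sqrt n ≤ |∑ i, (Y k (x i) - ∫ y, Y k y ∂μ)|} ≤
        D * Real.exp (-c * r ^ 2) := by
  classical
  induction s using Finset.induction_on with
  | empty => exact ⟨1, one_pos, 1, one_pos, fun n r _ _ => by simp; positivity⟩
  | insert k s hk ih =>
    obtain ⟨D, hD, c, hc, h⟩ := ih fun j hj => hY j (Finset.mem_insert_of_mem hj)
    have hYk := hY k (Finset.mem_insert_self k s)
    have hZ := hYk.sub_const (∫ y, Y k y ∂μ)
    obtain ⟨C, hC, t₀, ht₀, hb⟩ := hZ.exists_measure_sum_ge_le (by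
      rw [integral_sub hYk.integrable (integrable_const _)]; simp)
    -- The Chernoff exponent C n t² − t r √n is minimised at t = r/(2C√n), with value −r²/(4C). The
    -- constraint t ≤ t₀ becomes r ≤ 2C t₀ √n.
    refine ⟨D + 2, by positivity, min c (min (1 / (4 * C)) (2 * C * t₀)), by positivity,
      fun n r hr hrc => ?_⟩
    set c' := min c (min (1 / (4 * C)) (2 * C * t₀)) with hc'
    have c1 : c' ≤ c := min_le_left _ _
    have c2 : c' ≤ 1 / (4 * C) := (min_le_right _ _).trans (min_le_left _ _)
    have c3 : c' ≤ 2 * C * t₀ := (min_le_right _ _).trans (min_le_right _ _)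
    have h1 := h n r hr (hrc.trans (by gcongr))
    have h2 : (Measure.pi fun _ : Fin n => μ).real
        {x | r * Real.sqrt n ≤ |∑ i, (Y k (x i) - ∫ y, Y k y ∂μ)|} ≤ 2 * Real.exp (-c' * r ^ 2) := by
      rcases Nat.eq_zero_or_pos n with hn | hn
      · have : r = 0 := le_antisymm (by simpa [hn] using hrc) hr
        subst this
        simp
      · have hn0 : (0 : ℝ) < n := by exact_mod_cast hn
        have hs : 0 < Real.sqrt n := Real.sqrt_pos.2 hn0
        have hs2 : Real.sqrt n ^ 2 = n := Real.sq_sqrt hn0.le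
        refine (hb n (r / (2 * C * Real.sqrt n)) (r * Real.sqrt n) (by positivity) ?_).trans ?_
        · rw [div_le_iff₀ (by positivity)]
          calc r ≤ c' * Real.sqrt n := hrc
            _ ≤ 2 * C * t₀ * Real.sqrt n := by gcongr
            _ = _ := by ring
        · have e : C * n * (r / (2 * C * Real.sqrt n)) ^ 2 -
              r / (2 * C * Real.sqrt n) * (r * Real.sqrt n) = -(1 / (4 * C)) * r ^ 2 := by
            rw [div_pow, mul_pow, hs2]; field_simp; ring
          rw [e]
          gcongr
    have hsub : {x : Fin n → 𝒳 | ∃ j ∈ insert k s,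
          r * Real.sqrt n ≤ |∑ i, (Y j (x i) - ∫ y, Y j y ∂μ)|} ⊆
        {x | ∃ j ∈ s, r * Real.sqrt n ≤ |∑ i, (Y j (x i) - ∫ y, Y j y ∂μ)|} ∪
        {x | r * Real.sqrt n ≤ |∑ i, (Y k (x i) - ∫ y, Y k y ∂μ)|} := by
      rintro x ⟨j, hj, hx⟩
      rcases Finset.mem_insert.1 hj with rfl | hj
      · exact Or.inr hx
      · exact Or.inl ⟨j, hj, hx⟩
    refine (measureReal_mono hsub).trans ((measureReal_union_le _ _).trans ?_)
    have h3 : D * Real.exp (-c * r ^ 2) ≤ D * Real.exp (-c' * r ^ 2) := by gcongr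
    linarith

lemma tendsto_log_div_sqrt_zero :
    Tendsto (fun n : ℕ => Real.log n / Real.sqrt n) atTop (𝓝 0) := by
  have h := (isLittleO_log_rpow_atTop (r := 1 / 2) (by norm_num)).tendsto_div_nhds_zero
  refine (h.comp tendsto_natCast_atTop_atTop).congr fun n => ?_
  simp [Real.sqrt_eq_rpow]

lemma eventually_mul_log_div_sqrt_le (a : ℝ) {ε : ℝ} (hε : 0 < ε) :
    ∀ᶠ n : ℕ in atTop, a * (Real.log n / Real.sqrt n) ≤ ε := by
  have := (tendsto_log_div_sqrt_zero.const_mul a)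
  rw [mul_zero] at this
  exact (this.eventually (gt_mem_nhds hε)).mono fun n h => h.le

lemma one_le_log_of_three_le {n : ℕ} (hn : 3 ≤ n) : 1 ≤ Real.log n := by
  have hn3 : (3 : ℝ) ≤ n := by exact_mod_cast hn
  rw [Real.le_log_iff_exp_le (by linarith)]
  exact (Real.exp_one_lt_three.le).trans hn3

lemma eventually_mul_sqrt_log_le (a : ℝ) {ε : ℝ} (hε : 0 < ε) :
    ∀ᶠ n : ℕ in atTop, a * Real.sqrt (Real.log n) ≤ ε * Real.sqrt n := by
  filter_upwards [eventually_mul_log_div_sqrt_le |a| hε, eventually_ge_atTop 3] with n h hn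
  have hl := one_le_log_of_three_le hn
  have hs : 0 < Real.sqrt n := Real.sqrt_pos.2 (by positivity)
  rw [← mul_div_assoc, div_le_iff₀ hs] at h
  refine le_trans ?_ h
  refine mul_le_mul (le_abs_self a) ?_ (Real.sqrt_nonneg _) (abs_nonneg a)
  rw [Real.sqrt_le_left (by linarith)]
  nlinarith

/-- Uniform concentration of finitely many averages at the scale `√(log n / n)`, outside an event of
polynomially small probability. -/
lemma exists_measure_exists_sum_ge_sqrt_log_le {μ : Measure 𝒳} [IsProbabilityMeasure μ] {ι : Type*}
    (s : Finset ι) {Y : ι → 𝒳 → ℝ} (hY : ∀ k ∈ s, SubExp μ (Y k)) {κ : ℝ} (hκ : 0 < κ) :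
    ∃ D > 0, ∃ b > 0, ∃ n₀ : ℕ, ∀ n ≥ n₀,
      (Measure.pi fun _ : Fin n => μ).real
        {x | ∃ k ∈ s, b * Real.sqrt (Real.log n) * Real.sqrt n ≤
          |∑ i, (Y k (x i) - ∫ y, Y k y ∂μ)|} ≤ D * (n : ℝ) ^ (-κ) := by
  obtain ⟨D, hD, c, hc, h⟩ := exists_measure_exists_sum_ge_le s hY
  have hb : 0 < Real.sqrt (κ / c) := Real.sqrt_pos.2 (by positivity)
  obtain ⟨n₁, hn₁⟩ := eventually_atTop.1 (eventually_mul_sqrt_log_le (Real.sqrt (κ / c)) hc)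
  -- With b² = κ/c the tail exponent c b² log n equals κ log n.
  refine ⟨D, hD, Real.sqrt (κ / c), hb, max n₁ 3, fun n hn => ?_⟩
  have hn3 : 3 ≤ n := (le_max_right _ _).trans hn
  have hl := one_le_log_of_three_le hn3
  refine (h n (Real.sqrt (κ / c) * Real.sqrt (Real.log n)) (by positivity)
    (hn₁ n ((le_max_left _ _).trans hn))).trans (le_of_eq ?_)
  congr 1
  have hn0 : (0 : ℝ) < n := by positivity
  rw [mul_pow, Real.sq_sqrt (by positivity), Real.sq_sqrt (by linarith), Real.rpow_def_of_pos hn0]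
  congr 1
  field_simp

end SubExp


/-! ### Taylor expansions of the log-likelihood -/

section EuclideanBasis

variable {p : ℕ} {F : Type*} [NormedAddCommGroup F] [NormedSpace ℝ F]

lemma EuclideanSpace.sum_smul_stdVec (u : EuclideanSpace ℝ (Fin p)) :
    u = ∑ i, u i • BayesModel.stdVec i := by
  ext j
  simp [BayesModel.stdVec, Pi.single_apply]

lemma norm_le_sum_norm_stdVec (T : EuclideanSpace ℝ (Fin p) →L[ℝ] F) :
    ‖T‖ ≤ ∑ i, ‖T (BayesModel.stdVec i)‖ := by
  refine T.opNorm_le_bound (Finset.sum_nonneg fun i _ => norm_nonneg _) fun u => ?_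
  conv_lhs => rw [EuclideanSpace.sum_smul_stdVec u]
  rw [map_sum, Finset.sum_mul]
  refine (norm_sum_le _ _).trans (Finset.sum_le_sum fun i _ => ?_)
  rw [map_smul, norm_smul, mul_comm]
  gcongr
  exact PiLp.norm_apply_le u i

lemma norm_le_of_forall_stdVec (T : EuclideanSpace ℝ (Fin p) →L[ℝ] F) {C : ℝ}
    (h : ∀ i, ‖T (BayesModel.stdVec i)‖ ≤ C) : ‖T‖ ≤ p * C := by
  refine (norm_le_sum_norm_stdVec T).trans ?_
  refine (Finset.sum_le_sum fun i _ => h i).trans ?_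
  simp

end EuclideanBasis

namespace BayesModel

variable {p : ℕ} {𝒳 : Type*} [MeasurableSpace 𝒳] {M : BayesModel p 𝒳}

section Deterministic

set_option maxSynthPendingDepth 3

variable (hsm : M.SmoothCond)
include hsm

lemma SmoothCond.hasFDerivAt_logLik (x : 𝒳) {θ : EuclideanSpace ℝ (Fin p)} (hθ : θ ∈ M.Θ) :
    HasFDerivAt (fun t => M.logLik t x) (M.grad θ x) θ :=
  (hsm.1 x θ hθ).1.self_of_nhds.hasFDerivAt

lemma SmoothCond.hasFDerivAt_grad (x : 𝒳) {θ : EuclideanSpace ℝ (Fin p)} (hθ : θ ∈ M.Θ) :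
    HasFDerivAt (fun t => M.grad t x) (M.hess θ x) θ :=
  (hsm.1 x θ hθ).2.1.self_of_nhds.hasFDerivAt

lemma SmoothCond.hasFDerivAt_hess (x : 𝒳) {θ : EuclideanSpace ℝ (Fin p)} (hθ : θ ∈ M.Θ) :
    HasFDerivAt (fun t => M.hess t x) (M.third θ x) θ :=
  (hsm.1 x θ hθ).2.2.hasFDerivAt

lemma SmoothCond.hess_symm (x : 𝒳) {θ : EuclideanSpace ℝ (Fin p)} (hθ : θ ∈ M.Θ)
    (u v : EuclideanSpace ℝ (Fin p)) : M.hess θ x u v = M.hess θ x v u :=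
  second_derivative_symmetric_of_eventually
    ((hsm.1 x θ hθ).1.mono fun _ h => h.hasFDerivAt) (hsm.hasFDerivAt_grad x hθ) u v

lemma SmoothCond.exists_norm_third_le :
    ∃ L > 0, ∀ x, ∀ θ ∈ M.Θ, ‖M.third θ x‖ ≤ L := by
  obtain ⟨L₁, hL₁, h⟩ := hsm.2
  refine ⟨p * (p * (p * L₁)) + 1, by positivity, fun x θ hθ => ?_⟩
  refine (norm_le_of_forall_stdVec _ (C := p * (p * L₁)) fun i => ?_).trans (by linarith)
  refine norm_le_of_forall_stdVec _ fun j => norm_le_of_forall_stdVec _ fun k => ?_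
  exact h x θ hθ i j k

variable {L : ℝ} (hL : ∀ x, ∀ θ ∈ M.Θ, ‖M.third θ x‖ ≤ L)
include hL

lemma norm_hess_sub_le (x : 𝒳) {θ θ' : EuclideanSpace ℝ (Fin p)} (hθ : θ ∈ M.Θ) (hθ' : θ' ∈ M.Θ) :
    ‖M.hess θ' x - M.hess θ x‖ ≤ L * ‖θ' - θ‖ :=
  M.convex_Θ.norm_image_sub_le_of_norm_hasFDerivWithin_le
    (fun _ hy => (hsm.hasFDerivAt_hess x hy).hasFDerivWithinAt) (fun y hy => hL x y hy) hθ hθ'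

/-- Mean value inequality for the gradient minus its linearisation, on the segment rather than on
all of Θ, so that the derivative is bounded by L‖θ' − θ‖. The next order is obtained the same way;
the constants are not optimal. -/
lemma norm_grad_sub_taylor_le (x : 𝒳) {θ θ' : EuclideanSpace ℝ (Fin p)} (hθ : θ ∈ M.Θ)
    (hθ' : θ' ∈ M.Θ) :
    ‖M.grad θ' x - M.grad θ x - M.hess θ x (θ' - θ)‖ ≤ L * ‖θ' - θ‖ ^ 2 := by
  have hseg : segment ℝ θ θ' ⊆ M.Θ := M.convex_Θ.segment_subset hθ hθ'
  have hL0 : 0 ≤ L := (norm_nonneg _).trans (hL x θ hθ)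
  have h := (convex_segment θ θ').norm_image_sub_le_of_norm_hasFDerivWithin_le
    (f := fun t => M.grad t x - M.hess θ x (t - θ)) (f' := fun t => M.hess t x - M.hess θ x)
    (C := L * ‖θ' - θ‖) (fun y hy => ?_) (fun y hy => ?_) (left_mem_segment ℝ θ θ')
    (right_mem_segment ℝ θ θ')
  · simp only [sub_self, map_zero, sub_zero] at h
    calc _ = ‖M.grad θ' x - M.hess θ x (θ' - θ) - M.grad θ x‖ := by congr 1; abel
      _ ≤ _ := h
      _ = _ := by ring
  · refine ((hsm.hasFDerivAt_grad x (hseg hy)).sub ?_).hasFDerivWithinAt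
    exact (M.hess θ x).hasFDerivAt.comp y ((hasFDerivAt_id y).sub_const θ)
  · refine (norm_hess_sub_le hsm hL x hθ (hseg hy)).trans ?_
    gcongr
    exact norm_sub_le_of_mem_segment hy

lemma abs_logLik_sub_taylor_le (x : 𝒳) {θ θ' : EuclideanSpace ℝ (Fin p)} (hθ : θ ∈ M.Θ)
    (hθ' : θ' ∈ M.Θ) :
    |M.logLik θ' x - M.logLik θ x - M.grad θ x (θ' - θ) -
      (1 / 2) * M.hess θ x (θ' - θ) (θ' - θ)| ≤ L * ‖θ' - θ‖ ^ 3 := by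
  have hseg : segment ℝ θ θ' ⊆ M.Θ := M.convex_Θ.segment_subset hθ hθ'
  have hL0 : 0 ≤ L := (norm_nonneg _).trans (hL x θ hθ)
  have h := (convex_segment θ θ').norm_image_sub_le_of_norm_hasFDerivWithin_le
    (f := fun t => M.logLik t x - M.grad θ x (t - θ) - (1 / 2 : ℝ) * M.hess θ x (t - θ) (t - θ))
    (f' := fun t => M.grad t x - M.grad θ x - M.hess θ x (t - θ))
    (C := L * ‖θ' - θ‖ ^ 2) (fun y hy => ?_) (fun y hy => ?_) (left_mem_segment ℝ θ θ')
    (right_mem_segment ℝ θ θ')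
  · simp only [sub_self, map_zero, sub_zero, mul_zero, Real.norm_eq_abs] at h
    calc _ = |M.logLik θ' x - M.grad θ x (θ' - θ) -
          (1 / 2 : ℝ) * M.hess θ x (θ' - θ) (θ' - θ) - M.logLik θ x| := by congr 1; ring
      _ ≤ _ := h
      _ = _ := by ring
  · have hid : HasFDerivAt (fun t : EuclideanSpace ℝ (Fin p) => t - θ)
        (ContinuousLinearMap.id ℝ _) y := (hasFDerivAt_id y).sub_const θ
    have h1 := (M.grad θ x).hasFDerivAt.comp y hid
    have h2 := ((M.hess θ x).hasFDerivAt.comp y hid).clm_apply hid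
    refine (((hsm.hasFDerivAt_logLik x (hseg hy)).sub h1).sub (h2.const_mul (1 / 2))).congr_fderiv
      ?_ |>.hasFDerivWithinAt
    ext v
    simp only [Function.comp_def, ContinuousLinearMap.comp_id, sub_apply,
      smul_apply, add_apply,
      ContinuousLinearMap.flip_apply, smul_eq_mul]
    rw [hsm.hess_symm x hθ v (y - θ)]
    ring
  · refine (norm_grad_sub_taylor_le hsm hL x hθ (hseg hy)).trans ?_
    have := norm_sub_le_of_mem_segment hy
    gcongr

/-- Bounded third derivatives dominate the gradient on all of Θ by finitely many derivatives at one
point. The result is a random Lipschitz constant of ℓ(·, x) which inherits exponential moments. -/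
lemma norm_grad_le (x : 𝒳) {θ θ' : EuclideanSpace ℝ (Fin p)} (hθ : θ ∈ M.Θ)
    (hθ' : θ' ∈ M.Θ) {D : ℝ} (hD : ‖θ' - θ‖ ≤ D) :
    ‖M.grad θ' x‖ ≤ (∑ i, |M.grad θ x (stdVec i)|) +
      D * (∑ i, ∑ j, |M.hess θ x (stdVec i) (stdVec j)|) + L * D ^ 2 := by
  have hL0 : 0 ≤ L := (norm_nonneg _).trans (hL x θ hθ)
  have h1 := norm_grad_sub_taylor_le hsm hL x hθ hθ'
  have h2 : ‖M.grad θ x‖ ≤ ∑ i, |M.grad θ x (stdVec i)| := norm_le_sum_norm_stdVec _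
  have h3 : ‖M.hess θ x‖ ≤ ∑ i, ∑ j, |M.hess θ x (stdVec i) (stdVec j)| :=
    (norm_le_sum_norm_stdVec _).trans (Finset.sum_le_sum fun i _ => norm_le_sum_norm_stdVec _)
  have h4 : ‖M.hess θ x (θ' - θ)‖ ≤ D * (∑ i, ∑ j, |M.hess θ x (stdVec i) (stdVec j)|) := by
    refine ((M.hess θ x).le_opNorm _).trans ?_
    rw [mul_comm]
    gcongr
    exact (norm_nonneg _).trans hD
  have h5 : L * ‖θ' - θ‖ ^ 2 ≤ L * D ^ 2 := by gcongr
  have e : M.grad θ' x = M.grad θ x + M.hess θ x (θ' - θ) +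
      (M.grad θ' x - M.grad θ x - M.hess θ x (θ' - θ)) := by abel
  rw [e]
  exact (norm_add_le _ _).trans (add_le_add ((norm_add_le _ _).trans (add_le_add h2 (h4)))
    (h1.trans h5))

lemma abs_logLik_sub_le (x : 𝒳) {θ₀ θ θ' : EuclideanSpace ℝ (Fin p)} (hθ₀ : θ₀ ∈ M.Θ)
    (hθ : θ ∈ M.Θ) (hθ' : θ' ∈ M.Θ) {D : ℝ} (hD : ∀ t ∈ M.Θ, ‖t - θ₀‖ ≤ D) :
    |M.logLik θ' x - M.logLik θ x| ≤ ((∑ i, |M.grad θ₀ x (stdVec i)|) +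
      D * (∑ i, ∑ j, |M.hess θ₀ x (stdVec i) (stdVec j)|) + L * D ^ 2) * ‖θ' - θ‖ :=
  M.convex_Θ.norm_image_sub_le_of_norm_hasFDerivWithin_le
    (fun _ hy => (hsm.hasFDerivAt_logLik x hy).hasFDerivWithinAt)
    (fun y hy => norm_grad_le hsm hL x hθ₀ hy (hD y hy)) hθ hθ'

end Deterministic

/-! ### Measurability and moments of the derivatives; first-order condition -/

section Measurability

lemma measurable_fderiv_apply {F : EuclideanSpace ℝ (Fin p) → 𝒳 → ℝ}
    {G : 𝒳 → EuclideanSpace ℝ (Fin p) →L[ℝ] ℝ} {U : Set (EuclideanSpace ℝ (Fin p))}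
    {θ : EuclideanSpace ℝ (Fin p)} (hU : U ∈ 𝓝 θ) (hF : ∀ t ∈ U, Measurable (F t))
    (hd : ∀ x, HasFDerivAt (fun t => F t x) (G x) θ) (v : EuclideanSpace ℝ (Fin p)) :
    Measurable fun x => G x v := by
  have hlim : Tendsto (fun k : ℕ => θ + (k : ℝ)⁻¹ • v) atTop (𝓝 θ) := by
    have h1 : Tendsto (fun k : ℕ => ((k : ℝ))⁻¹) atTop (𝓝 0) := tendsto_inv_atTop_nhds_zero_nat
    simpa using (h1.smul_const v).const_add θ
  obtain ⟨k₀, hk₀⟩ := eventually_atTop.1 (hlim.eventually hU)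
  refine measurable_of_tendsto_metrizable
    -- The derivative is a limit of difference quotients with increments v/k; the shift by k₀ keeps
    -- the evaluation points in U.
    (f := fun (k : ℕ) x => ((k + k₀ : ℕ) : ℝ) • (F (θ + ((k + k₀ : ℕ) : ℝ)⁻¹ • v) x - F θ x))
    (fun k => ?_) ?_
  · exact ((hF _ (hk₀ _ (Nat.le_add_left _ _))).sub (hF _ (mem_of_mem_nhds hU))).const_mul _
  · rw [tendsto_pi_nhds]
    intro x
    have h2 := ((hd x).lim_real v).comp
      (tendsto_natCast_atTop_atTop.comp (tendsto_add_atTop_nat k₀))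
    exact h2

lemma measurable_logLik {θ : EuclideanSpace ℝ (Fin p)} (hθ : θ ∈ M.Θ) : Measurable (M.logLik θ) :=
  Real.measurable_log.comp (M.measurable_dens θ hθ)

lemma measurable_grad (hsm : M.SmoothCond) {θ : EuclideanSpace ℝ (Fin p)} (hθ : θ ∈ interior M.Θ)
    (v : EuclideanSpace ℝ (Fin p)) : Measurable fun x => M.grad θ x v :=
  measurable_fderiv_apply (mem_interior_iff_mem_nhds.1 hθ) (fun _ ht => measurable_logLik ht)
    (fun x => hsm.hasFDerivAt_logLik x (interior_subset hθ)) v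

lemma measurable_hess (hsm : M.SmoothCond) {θ : EuclideanSpace ℝ (Fin p)} (hθ : θ ∈ interior M.Θ)
    (u v : EuclideanSpace ℝ (Fin p)) : Measurable fun x => M.hess θ x u v := by
  have := measurable_fderiv_apply (F := fun t x => M.grad t x v)
    (G := fun x => (M.hess θ x).flip v) (isOpen_interior.mem_nhds hθ)
    (fun t ht => measurable_grad hsm ht v) (fun x => ?_) u
  · simpa using this
  · have h := (hsm.hasFDerivAt_grad x (interior_subset hθ)).clm_apply (hasFDerivAt_const v θ)
    refine h.congr_fderiv ?_
    ext w; simp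

end Measurability

section Integrability

set_option maxSynthPendingDepth 3

variable {P₀ : Measure 𝒳} [IsProbabilityMeasure P₀]

lemma subExp_grad (hsm : M.SmoothCond) (hg : M.GradCond P₀) {θ : EuclideanSpace ℝ (Fin p)}
    (hθ : θ ∈ interior M.Θ) (v : EuclideanSpace ℝ (Fin p)) :
    SubExp P₀ (fun x => M.grad θ x v) := by
  rcases eq_or_ne v 0 with rfl | hv
  · simpa using SubExp.const (μ := P₀) 0
  · obtain ⟨η, hη, M₂, -, h⟩ := hg
    have hv' : 0 < ‖v‖ := norm_pos_iff.2 hv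
    have h1 := h (‖v‖⁻¹ • v) (by rw [norm_smul, norm_inv, norm_norm, inv_mul_cancel₀ hv'.ne']) θ
      (interior_subset hθ)
    have hm := measurable_grad hsm hθ (‖v‖⁻¹ • v)
    have hu : SubExp P₀ (fun x => M.grad θ x (‖v‖⁻¹ • v)) := by
      refine ⟨hm, η, hη, Measurable.aestronglyMeasurable (by fun_prop), ?_⟩
      rw [hasFiniteIntegral_iff_ofReal (ae_of_all _ fun x => (Real.exp_pos _).le)]
      exact h1.trans_lt ENNReal.ofReal_lt_top
    have h2 := hu.const_mul ‖v‖
    refine h2.mono (measurable_grad hsm hθ v) fun x => le_of_eq ?_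
    rw [map_smul, smul_eq_mul, mul_inv_cancel_left₀ hv'.ne']

/-- Up to a deterministic error controlled by the third derivatives, a Hessian entry is a difference
quotient of two scores with a fixed step 1/k, and scores are sub-exponential. This gives two-sided
control of all entries. -/
lemma subExp_hess (hsm : M.SmoothCond) (hg : M.GradCond P₀) {θ : EuclideanSpace ℝ (Fin p)}
    (hθ : θ ∈ interior M.Θ) (u v : EuclideanSpace ℝ (Fin p)) :
    SubExp P₀ (fun x => M.hess θ x u v) := by
  obtain ⟨L, -, hL⟩ := hsm.exists_norm_third_le
  have hlim : Tendsto (fun k : ℕ => θ + (k : ℝ)⁻¹ • u) atTop (𝓝 θ) := by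
    have h1 : Tendsto (fun k : ℕ => ((k : ℝ))⁻¹) atTop (𝓝 0) := tendsto_inv_atTop_nhds_zero_nat
    simpa using (h1.smul_const u).const_add θ
  obtain ⟨k, hk, hk1⟩ := ((hlim.eventually (isOpen_interior.mem_nhds hθ)).and
    (eventually_ge_atTop 1)).exists
  have hk0 : (0 : ℝ) < k := by exact_mod_cast hk1
  have hS : SubExp P₀ (fun x => k * (M.grad (θ + (k : ℝ)⁻¹ • u) x v) + -k * (M.grad θ x v)) :=
    ((subExp_grad hsm hg hk v).const_mul k).add ((subExp_grad hsm hg hθ v).const_mul (-k))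
  refine (hS.abs.add (SubExp.const (k * (L * ‖(k : ℝ)⁻¹ • u‖ ^ 2 * ‖v‖)))).mono
    (measurable_hess hsm hθ u v) fun x => ?_
  have h := norm_grad_sub_taylor_le hsm hL x (interior_subset hθ) (interior_subset hk)
  rw [add_sub_cancel_left] at h
  have h2 := ((M.grad (θ + (k : ℝ)⁻¹ • u) x - M.grad θ x -
    M.hess θ x ((k : ℝ)⁻¹ • u)).le_opNorm v).trans (mul_le_mul_of_nonneg_right h (norm_nonneg v))
  simp only [sub_apply, map_smul, smul_apply, smul_eq_mul,
    Real.norm_eq_abs] at h2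
  have e : M.hess θ x u v = (k * (M.grad (θ + (k : ℝ)⁻¹ • u) x v) + -k * (M.grad θ x v)) -
      k * (M.grad (θ + (k : ℝ)⁻¹ • u) x v - M.grad θ x v - (k : ℝ)⁻¹ * M.hess θ x u v) := by
    field_simp; ring
  refine le_trans ?_ (le_abs_self _)
  conv_lhs => rw [e]
  refine (abs_sub _ _).trans ?_
  gcongr
  rw [abs_mul, abs_of_pos hk0]
  exact mul_le_mul_of_nonneg_left h2 hk0.le

/-- Integrate the Taylor lower bound for ℓ(θ⋆ + v/k) − ℓ(θ⋆), whose expectation is nonpositive by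
maximality, divide by 1/k and let k → ∞. No differentiation under the integral is involved; applying
it to −v as well gives equality. -/
lemma integral_grad_le_zero (hsm : M.SmoothCond) (hg : M.GradCond P₀)
    {θs : EuclideanSpace ℝ (Fin p)} (hθs : M.IsTrueParam P₀ θs) (v : EuclideanSpace ℝ (Fin p)) :
    ∫ x, M.grad θs x v ∂P₀ ≤ 0 := by
  obtain ⟨L, hL0, hL⟩ := hsm.exists_norm_third_le
  have hin := hθs.mem_interior
  have hi1 := (subExp_grad hsm hg hin v).integrable
  have hi2 := (subExp_hess hsm hg hin v v).integrable
  have hlim : Tendsto (fun k : ℕ => θs + (k : ℝ)⁻¹ • v) atTop (𝓝 θs) := by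
    have h1 : Tendsto (fun k : ℕ => ((k : ℝ))⁻¹) atTop (𝓝 0) := tendsto_inv_atTop_nhds_zero_nat
    simpa using (h1.smul_const v).const_add θs
  have hinv : Tendsto (fun k : ℕ => ((k : ℝ))⁻¹) atTop (𝓝 0) := tendsto_inv_atTop_nhds_zero_nat
  have hto : Tendsto (fun k : ℕ => L * ‖v‖ ^ 3 * ((k : ℝ)⁻¹) ^ 2 -
      (1 / 2) * (k : ℝ)⁻¹ * ∫ x, M.hess θs x v v ∂P₀) atTop (𝓝 0) := by
    simpa only [ne_eq, OfNat.ofNat_ne_zero, not_false_eq_true, zero_pow, mul_zero, zero_mul,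
      sub_zero] using ((hinv.pow 2).const_mul (L * ‖v‖ ^ 3)).sub
      ((hinv.const_mul (1 / 2)).mul_const (∫ x, M.hess θs x v v ∂P₀))
  refine ge_of_tendsto hto ?_
  filter_upwards [hlim.eventually (isOpen_interior.mem_nhds hin), eventually_ge_atTop 1] with k hk hk1
  have hk0 : (0 : ℝ) < k := by exact_mod_cast hk1
  set t := (k : ℝ)⁻¹ with ht
  have ht0 : 0 < t := by positivity
  have hmax : ∫ x, M.logLik (θs + t • v) x ∂P₀ ≤ ∫ x, M.logLik θs x ∂P₀ :=
    hθs.isMaxOn (interior_subset hk)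
  have hpt : ∀ x, t * M.grad θs x v + 1 / 2 * t ^ 2 * M.hess θs x v v - L * (t * ‖v‖) ^ 3 ≤
      M.logLik (θs + t • v) x - M.logLik θs x := by
    intro x
    have h := abs_logLik_sub_taylor_le hsm hL x (interior_subset hin) (interior_subset hk)
    rw [add_sub_cancel_left, norm_smul, Real.norm_of_nonneg ht0.le] at h
    simp only [map_smul, smul_apply, smul_eq_mul] at h
    have := (abs_le.1 h).1
    linarith
  have hll := (hθs.integrable _ (interior_subset hk)).sub (hθs.integrable _ (interior_subset hin))
  have ia : Integrable (fun x => t * M.grad θs x v + 1 / 2 * t ^ 2 * M.hess θs x v v) P₀ :=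
    (hi1.const_mul _).add (hi2.const_mul _)
  have hI := integral_mono (ia.sub (integrable_const (L * (t * ‖v‖) ^ 3))) hll hpt
  simp only [Pi.sub_apply] at hI
  rw [integral_sub ia (integrable_const _), integral_add (hi1.const_mul _) (hi2.const_mul _),
    integral_const_mul, integral_const_mul,
    integral_sub (hθs.integrable _ (interior_subset hk)) (hθs.integrable _ (interior_subset hin))]
    at hI
  simp only [integral_const, probReal_univ, smul_eq_mul, one_mul] at hI
  have h3 : t * (∫ x, M.grad θs x v ∂P₀) ≤ t * (L * ‖v‖ ^ 3 * t ^ 2 -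
      1 / 2 * t * ∫ x, M.hess θs x v v ∂P₀) := by nlinarith
  exact le_of_mul_le_mul_left h3 ht0

lemma integral_grad_eq_zero (hsm : M.SmoothCond) (hg : M.GradCond P₀)
    {θs : EuclideanSpace ℝ (Fin p)} (hθs : M.IsTrueParam P₀ θs) (v : EuclideanSpace ℝ (Fin p)) :
    ∫ x, M.grad θs x v ∂P₀ = 0 := by
  refine le_antisymm (integral_grad_le_zero hsm hg hθs v) ?_
  have h := integral_grad_le_zero hsm hg hθs (-v)
  simp only [map_neg, integral_neg] at h
  linarith

end Integrability

end BayesModel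


/-! ### The quadratic form of H -/

section QuadForm

variable {p : ℕ} (H : Matrix (Fin p) (Fin p) ℝ)

/-- The operator on `ℝᵖ` given by a matrix. -/
abbrev matrixCLM : EuclideanSpace ℝ (Fin p) →L[ℝ] EuclideanSpace ℝ (Fin p) :=
  Matrix.toEuclideanCLM (n := Fin p) (𝕜 := ℝ) H

lemma quadForm_eq_inner (v : EuclideanSpace ℝ (Fin p)) :
    quadForm H v = inner ℝ v (matrixCLM H v) := by
  rw [Matrix.inner_toEuclideanCLM]
  rfl

lemma inner_matrixCLM (u v : EuclideanSpace ℝ (Fin p)) :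
    inner ℝ u (matrixCLM H v) = ∑ i, ∑ j, u i * v j * H i j := by
  rw [Matrix.inner_toEuclideanCLM]
  simp only [dotProduct, Matrix.mulVec, Finset.mul_sum]
  refine Finset.sum_congr rfl fun i _ => Finset.sum_congr rfl fun j _ => ?_
  ring

lemma inner_matrixCLM_comm (hH : H.IsHermitian) (u v : EuclideanSpace ℝ (Fin p)) :
    inner ℝ u (matrixCLM H v) = inner ℝ v (matrixCLM H u) := by
  rw [inner_matrixCLM, inner_matrixCLM, Finset.sum_comm]
  refine Finset.sum_congr rfl fun i _ => Finset.sum_congr rfl fun j _ => ?_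
  have := hH.apply i j
  simp only [star_trivial] at this
  rw [this]; ring

/-- The spectrum of H − ρI is that of H shifted by ρ, hence nonnegative, so this Hermitian matrix is
positive semidefinite. -/
lemma quadForm_ge_of_spectrum (hH : H.IsHermitian) {ρ : ℝ} (hs : ∀ l ∈ spectrum ℝ H, ρ ≤ l)
    (v : EuclideanSpace ℝ (Fin p)) : ρ * ‖v‖ ^ 2 ≤ quadForm H v := by
  have hpos : (H - algebraMap ℝ (Matrix (Fin p) (Fin p) ℝ) ρ).PosSemidef := by
    rw [Matrix.posSemidef_iff_isHermitian_and_spectrum_nonneg]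
    refine ⟨hH.sub ?_, ?_⟩
    · rw [Matrix.IsHermitian, Matrix.algebraMap_eq_diagonal, Matrix.diagonal_conjTranspose]
      congr
    · intro l hl
      rw [← spectrum.sub_singleton_eq] at hl
      obtain ⟨k, hk, r, hr, rfl⟩ := hl
      rw [mem_singleton_iff] at hr
      subst hr
      exact sub_nonneg.2 (hs k hk)
  have h := (Matrix.posSemidef_iff_dotProduct_mulVec.1 hpos).2 v.ofLp
  rw [Matrix.sub_mulVec, dotProduct_sub, Algebra.algebraMap_eq_smul_one, Matrix.smul_mulVec,
    Matrix.one_mulVec, dotProduct_smul, smul_eq_mul, star_trivial] at h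
  have e : v.ofLp ⬝ᵥ v.ofLp = ‖v‖ ^ 2 := by
    rw [EuclideanSpace.norm_sq_eq]
    simp [dotProduct, sq]
  rw [e] at h
  unfold quadForm
  linarith

end QuadForm

namespace BayesModel

variable {p : ℕ} {𝒳 : Type*} [MeasurableSpace 𝒳] {M : BayesModel p 𝒳}
  {P₀ : Measure 𝒳} {θs : EuclideanSpace ℝ (Fin p)}

lemma fisher_isHermitian (hsm : M.SmoothCond) (hθ : θs ∈ M.Θ) : (M.fisher P₀ θs).IsHermitian := by
  ext i j
  simp only [Matrix.conjTranspose_apply, fisher, Matrix.of_apply, star_trivial]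
  simp_rw [hsm.hess_symm _ hθ (stdVec j) (stdVec i)]

/-- The bilinear form `(u, v) ↦ uᵀ H v` of a matrix. -/
def _root_.matrixBilin (H : Matrix (Fin p) (Fin p) ℝ) :
    EuclideanSpace ℝ (Fin p) →L[ℝ] EuclideanSpace ℝ (Fin p) →L[ℝ] ℝ :=
  ((ContinuousLinearMap.compL ℝ (EuclideanSpace ℝ (Fin p)) (EuclideanSpace ℝ (Fin p)) ℝ).flip
    (matrixCLM H)).comp (innerSL ℝ)

lemma _root_.matrixBilin_apply (H : Matrix (Fin p) (Fin p) ℝ) (u v : EuclideanSpace ℝ (Fin p)) :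
    matrixBilin H u v = inner ℝ u (matrixCLM H v) := rfl

end BayesModel


/-! ### Localisation and linearisation of a block maximiser: deterministic estimates -/

namespace BayesModel

section BlockDeterministic

set_option maxSynthPendingDepth 3

variable {p : ℕ} {𝒳 : Type*} [MeasurableSpace 𝒳] {M : BayesModel p 𝒳}

lemma inner_stdVec_matrixCLM (H : Matrix (Fin p) (Fin p) ℝ) (i j : Fin p) :
    inner ℝ (stdVec i) (matrixCLM H (stdVec j)) = H i j := by
  simp [Matrix.inner_toEuclideanCLM, stdVec]

/-- A maximiser of the block log-likelihood close to `θs` is within `O(δ)` of `θs`, and its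
linearisation error is `O(δ²)`, when the block averages of the first two derivatives are within `δ`
of their expectations. -/
lemma IsLocalMax.expansion (hsm : M.SmoothCond) {L : ℝ} (hL : ∀ x, ∀ θ ∈ M.Θ, ‖M.third θ x‖ ≤ L)
    {θs θ : EuclideanSpace ℝ (Fin p)} (hθs : θs ∈ M.Θ) (hθ : θ ∈ interior M.Θ)
    {H : Matrix (Fin p) (Fin p) ℝ} {ρ : ℝ} (hρ : 0 < ρ)
    (hH : ∀ v, ρ * ‖v‖ ^ 2 ≤ quadForm H v) (hsymm : H.IsHermitian)
    {r δ : ℝ} (hδ : 0 ≤ δ) (hr : ‖θ - θs‖ ≤ r) (hLr : L * r ≤ ρ / 8)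
    (hpδ : (p : ℝ) ^ 2 * δ ≤ ρ / 4) {n : ℕ} (hn : 0 < n) {x : Fin n → 𝒳}
    (h1 : ∀ k, |∑ i, M.grad θs (x i) (stdVec k)| ≤ n * δ)
    (h2 : ∀ k l, |∑ i, (M.hess θs (x i) (stdVec k) (stdVec l) + H k l)| ≤ n * δ)
    (hmax : M.IsLocalMax x θ) (v : EuclideanSpace ℝ (Fin p)) :
    |inner ℝ v (matrixCLM H (θ - θs)) - (n : ℝ)⁻¹ * ∑ i, M.grad θs (x i) v| ≤
      (16 * L * p ^ 2 / ρ ^ 2 + 4 * p ^ 3 / ρ) * δ ^ 2 * ‖v‖ := by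
  have hn0 : (0 : ℝ) < n := by exact_mod_cast hn
  have hθΘ := interior_subset hθ
  have hL0 : 0 ≤ L := (norm_nonneg _).trans (hL (x ⟨0, hn⟩) θs hθs)
  set h := θ - θs with hh
  set S : EuclideanSpace ℝ (Fin p) →L[ℝ] ℝ := ∑ i, M.grad θs (x i) with hS
  set A : EuclideanSpace ℝ (Fin p) →L[ℝ] EuclideanSpace ℝ (Fin p) →L[ℝ] ℝ :=
    (∑ i, M.hess θs (x i)) + (n : ℝ) • matrixBilin H with hA
  have hSn : ‖S‖ ≤ p * (n * δ) := norm_le_of_forall_stdVec _ fun k => by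
    rw [Real.norm_eq_abs, hS, sum_apply]; exact h1 k
  have hAn : ‖A‖ ≤ p * (p * (n * δ)) := by
    refine norm_le_of_forall_stdVec _ fun k => norm_le_of_forall_stdVec _ fun l => ?_
    have := h2 k l
    rw [Finset.sum_add_distrib, Finset.sum_const, Finset.card_univ, Fintype.card_fin,
      nsmul_eq_mul] at this
    simpa [hA, sum_apply, matrixBilin_apply, inner_stdVec_matrixCLM] using this
  have hAuv : ∀ u v, ∑ i, M.hess θs (x i) u v = A u v - n * inner ℝ u (matrixCLM H v) := by
    intro u v
    simp [hA, sum_apply, matrixBilin_apply]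
  have hSv : ∀ v, ∑ i, M.grad θs (x i) v = S v := fun v => by simp [hS, sum_apply]
  -- The likelihood at θ is at least that at θ⋆. After dividing by n, the quadratic term −(ρ/2)‖h‖²
  -- loses ρ/8 to the Hessian fluctuation and ρ/8 to the cubic remainder, leaving (ρ/4)‖h‖² ≤ pδ‖h‖.
  have hbound : ‖h‖ ≤ 4 * p * δ / ρ := by
    have hpt : ∀ i, M.logLik θ (x i) - M.logLik θs (x i) ≤ M.grad θs (x i) h +
        (1 / 2) * M.hess θs (x i) h h + L * ‖h‖ ^ 3 := by
      intro i
      have := (abs_le.1 (abs_logLik_sub_taylor_le hsm hL (x i) hθs hθΘ)).2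
      linarith
    have h0 : 0 ≤ ∑ i, (M.logLik θ (x i) - M.logLik θs (x i)) := by
      rw [Finset.sum_sub_distrib]
      exact sub_nonneg.2 (hmax.2 hθs)
    have hs := h0.trans (Finset.sum_le_sum fun i _ => hpt i)
    rw [Finset.sum_add_distrib, Finset.sum_add_distrib, ← Finset.mul_sum, hAuv, hSv,
      Finset.sum_const, Finset.card_univ, Fintype.card_fin, nsmul_eq_mul, ← quadForm_eq_inner] at hs
    have e1 : S h ≤ p * (n * δ) * ‖h‖ :=
      (le_abs_self _).trans (((S.le_opNorm h).trans (by gcongr)))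
    have e2 : A h h ≤ p * (p * (n * δ)) * ‖h‖ * ‖h‖ :=
      (le_abs_self _).trans ((A.le_opNorm₂ h h).trans (by gcongr))
    have e3 := hH h
    have e4 : L * ‖h‖ ^ 3 ≤ ρ / 8 * ‖h‖ ^ 2 := by
      calc L * ‖h‖ ^ 3 = (L * ‖h‖) * ‖h‖ ^ 2 := by ring
        _ ≤ ρ / 8 * ‖h‖ ^ 2 := by
          gcongr
          exact (mul_le_mul_of_nonneg_left hr hL0).trans hLr
    have e5 : p ^ 2 * δ * ‖h‖ ^ 2 ≤ ρ / 4 * ‖h‖ ^ 2 := by gcongr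
    have e6 : 0 ≤ n * (p * δ * ‖h‖ - ρ / 4 * ‖h‖ ^ 2) := by
      have f1 := mul_le_mul_of_nonneg_left e3 hn0.le
      have f2 := mul_le_mul_of_nonneg_left e4 hn0.le
      have f3 := mul_le_mul_of_nonneg_left e5 hn0.le
      nlinarith
    have e7 : 0 ≤ p * δ * ‖h‖ - ρ / 4 * ‖h‖ ^ 2 := nonneg_of_mul_nonneg_right e6 hn0
    rcases eq_or_lt_of_le (norm_nonneg h) with hz | hz
    · rw [← hz]; positivity
    · rw [le_div_iff₀ hρ]
      have : 0 ≤ ‖h‖ * (p * δ - ρ / 4 * ‖h‖) := by nlinarith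
      have := nonneg_of_mul_nonneg_right this hz
      linarith
  -- Interiority of θ is used here: the score equation may fail at a boundary maximiser.
  have hcrit : ∑ i, M.grad θ (x i) = 0 := by
    have hloc : _root_.IsLocalMax (fun t => ∑ i, M.logLik t (x i)) θ :=
      hmax.2.isLocalMax (mem_interior_iff_mem_nhds.1 hθ)
    have hd : HasFDerivAt (fun t => ∑ i, M.logLik t (x i)) (∑ i, M.grad θ (x i)) θ :=
      HasFDerivAt.fun_sum fun i _ => hsm.hasFDerivAt_logLik (x i) hθΘ
    exact hloc.hasFDerivAt_eq_zero hd
  have hg : ‖∑ i, (M.grad θ (x i) - M.grad θs (x i) - M.hess θs (x i) h)‖ ≤ n * (L * ‖h‖ ^ 2) := by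
    refine (norm_sum_le_of_le _ fun i _ => norm_grad_sub_taylor_le hsm hL (x i) hθs hθΘ).trans ?_
    simp [hh]
  rw [Finset.sum_sub_distrib, Finset.sum_sub_distrib, hcrit, zero_sub, ← hS] at hg
  have hgv := ((-S - ∑ i, M.hess θs (x i) h).le_opNorm v).trans
    (mul_le_mul_of_nonneg_right hg (norm_nonneg v))
  have hval : (-S - ∑ i, M.hess θs (x i) h) v =
      -S v - (A h v - n * inner ℝ v (matrixCLM H h)) := by
    rw [inner_matrixCLM_comm H hsymm, ← hAuv, sub_apply, neg_apply]
    congr 1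
    exact sum_apply _ _ _
  rw [hval, Real.norm_eq_abs] at hgv
  have hAhv : |A h v| ≤ p * (p * (n * δ)) * ‖h‖ * ‖v‖ := (A.le_opNorm₂ h v).trans (by gcongr)
  rw [hSv]
  have e : inner ℝ v (matrixCLM H h) - (n : ℝ)⁻¹ * S v = (n : ℝ)⁻¹ *
      ((-S v - (A h v - n * inner ℝ v (matrixCLM H h))) + A h v) := by
    field_simp; ring
  rw [e, abs_mul, abs_of_pos (inv_pos.2 hn0)]
  -- The Taylor remainder L‖h‖² and the Hessian fluctuation p²δ‖h‖ are both O(δ²) once ‖h‖ ≤ 4pδ/ρ.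
  have hfin : |(-S v - (A h v - n * inner ℝ v (matrixCLM H h))) + A h v| ≤
      n * ((16 * L * p ^ 2 / ρ ^ 2 + 4 * p ^ 3 / ρ) * δ ^ 2 * ‖v‖) := by
    refine (abs_add_le _ _).trans ((add_le_add hgv hAhv).trans ?_)
    calc n * (L * ‖h‖ ^ 2) * ‖v‖ + p * (p * (n * δ)) * ‖h‖ * ‖v‖
        ≤ n * (L * (4 * p * δ / ρ) ^ 2) * ‖v‖ + p * (p * (n * δ)) * (4 * p * δ / ρ) * ‖v‖ := by
          gcongr
      _ = _ := by field_simp; ring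
  calc _ ≤ (n : ℝ)⁻¹ * (n * ((16 * L * p ^ 2 / ρ ^ 2 + 4 * p ^ 3 / ρ) * δ ^ 2 * ‖v‖)) := by gcongr
    _ = _ := by rw [inv_mul_cancel_left₀ hn0.ne']

/-- A maximiser of the block log-likelihood is close to `θs` when the averages of the log-likelihood
over a finite net of `Θ` are close to their expectations. -/
lemma IsLocalMax.norm_sub_lt {θs θ : EuclideanSpace ℝ (Fin p)} (hθs : θs ∈ M.Θ)
    {t : Finset (EuclideanSpace ℝ (Fin p))} (ht : ∀ q ∈ t, q ∈ M.Θ)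
    {ε r c δ EG : ℝ} (hnet : ∀ θ ∈ M.Θ, ∃ q ∈ t, ‖θ - q‖ ≤ ε)
    {G : 𝒳 → ℝ} (hG0 : ∀ x, 0 ≤ G x) {l : EuclideanSpace ℝ (Fin p) → ℝ}
    (hG : ∀ x, ∀ θ ∈ M.Θ, ∀ θ' ∈ M.Θ, |M.logLik θ' x - M.logLik θ x| ≤ G x * ‖θ' - θ‖)
    (hl : ∀ q ∈ t, c * ‖q - θs‖ ^ 2 ≤ -l q) (hc : 0 < c) (hr : 0 < r) (hεr : ε ≤ r / 2)
    (hε : 0 ≤ ε) (hδ : δ + ε * (EG + δ) < c * r ^ 2 / 4)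
    {n : ℕ} (hn : 0 < n) {x : Fin n → 𝒳}
    (h1 : ∑ i, (G (x i) - EG) ≤ n * δ)
    (h2 : ∀ q ∈ t, ∑ i, (M.logLik q (x i) - M.logLik θs (x i) - l q) ≤ n * δ)
    (hmax : M.IsLocalMax x θ) : ‖θ - θs‖ < r := by
  by_contra hcon
  push Not at hcon
  have hn0 : (0 : ℝ) < n := by exact_mod_cast hn
  obtain ⟨q, hq, hqε⟩ := hnet θ hmax.1
  have h0 : 0 ≤ ∑ i, (M.logLik θ (x i) - M.logLik θs (x i)) := by
    rw [Finset.sum_sub_distrib]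
    exact sub_nonneg.2 (hmax.2 hθs)
  have hsum : ∑ i, (M.logLik θ (x i) - M.logLik q (x i)) ≤ ∑ i, G (x i) * ‖θ - q‖ :=
    Finset.sum_le_sum fun i _ => (le_abs_self _).trans (hG (x i) q (ht q hq) θ hmax.1)
  rw [← Finset.sum_mul] at hsum
  have hGs : ∑ i, G (x i) ≤ n * (EG + δ) := by
    rw [Finset.sum_sub_distrib, Finset.sum_const, Finset.card_univ, Fintype.card_fin,
      nsmul_eq_mul] at h1
    linarith
  have h2q := h2 q hq
  rw [Finset.sum_sub_distrib, Finset.sum_const, Finset.card_univ, Fintype.card_fin,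
      nsmul_eq_mul] at h2q
  have hsplit : ∑ i, (M.logLik θ (x i) - M.logLik θs (x i)) =
      ∑ i, (M.logLik θ (x i) - M.logLik q (x i)) + ∑ i, (M.logLik q (x i) - M.logLik θs (x i)) := by
    rw [← Finset.sum_add_distrib]
    exact Finset.sum_congr rfl fun i _ => by ring
  -- The net point near θ is still at distance r/2 from θ⋆, so its expected log-likelihood drops by
  -- at least c r²/4, more than the fluctuations allowed by `hδ`.
  have hqr : r / 2 ≤ ‖q - θs‖ := by
    have := norm_sub_le_norm_sub_add_norm_sub θ q θs
    linarith
  have hlq := hl q hq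
  have hsq : c * (r / 2) ^ 2 ≤ c * ‖q - θs‖ ^ 2 := by gcongr
  have hGε : (∑ i, G (x i)) * ‖θ - q‖ ≤ n * (ε * (EG + δ)) := by
    have hp : 0 ≤ ∑ i, G (x i) := Finset.sum_nonneg fun i _ => hG0 (x i)
    calc _ ≤ (∑ i, G (x i)) * ε := by gcongr
      _ ≤ n * (EG + δ) * ε := by gcongr
      _ = _ := by ring
  have : (n : ℝ) * (δ + ε * (EG + δ)) < n * (c * r ^ 2 / 4) := by gcongr
  have e1 : n * l q ≤ -(n * (c * r ^ 2 / 4)) := by nlinarith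
  linarith

end BlockDeterministic

end BayesModel


/-! ### Linearisation of a block maximiser with high probability -/

namespace BayesModel

section Block

variable {p : ℕ} {𝒳 : Type*} [MeasurableSpace 𝒳] {M : BayesModel p 𝒳}
  {P₀ : Measure 𝒳} [IsProbabilityMeasure P₀] {θs : EuclideanSpace ℝ (Fin p)}

lemma subExp_gradEnvelope (hsm : M.SmoothCond) (hg : M.GradCond P₀) (hθ : θs ∈ interior M.Θ)
    (D C : ℝ) : SubExp P₀ (fun x => (∑ i, |M.grad θs x (stdVec i)|) +
      D * (∑ i, ∑ j, |M.hess θs x (stdVec i) (stdVec j)|) + C) :=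
  ((SubExp.sum _ fun i _ => (subExp_grad hsm hg hθ (stdVec i)).abs).add
    ((SubExp.sum _ fun i _ => SubExp.sum _ fun j _ =>
      (subExp_hess hsm hg hθ (stdVec i) (stdVec j)).abs).const_mul D)).add (SubExp.const C)

/-- Asymptotic linearity of the block maximum-likelihood estimators, outside an event of
polynomially small probability. -/
theorem exists_measure_not_linear_le (hsm : M.SmoothCond) (hg : M.GradCond P₀)
    (hθs : M.IsTrueParam P₀ θs) (hgr : M.GrowthCond P₀ θs) {κ : ℝ} (hκ : 0 < κ) :
    ∃ D > 0, ∃ C > 0, ∃ n₀ : ℕ, ∀ n ≥ n₀,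
      (Measure.pi fun _ : Fin n => P₀).real {x | ¬ ∀ θ, M.IsLocalMax x θ → ∀ v,
        |inner ℝ v (matrixCLM (M.fisher P₀ θs) (θ - θs)) - (n : ℝ)⁻¹ * ∑ i, M.grad θs (x i) v| ≤
          C * (Real.log n / n) * ‖v‖} ≤ D * (n : ℝ) ^ (-κ) := by
  classical
  obtain ⟨hbdd, ⟨c, hc, hgrow⟩, ρ, hρ, -, hspec⟩ := hgr
  obtain ⟨L, hL0, hL⟩ := hsm.exists_norm_third_le
  have hin := hθs.mem_interior
  have hmem : θs ∈ M.Θ := interior_subset hin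
  set H := M.fisher P₀ θs with hHdef
  have hsymm : H.IsHermitian := fisher_isHermitian hsm hmem
  have hH : ∀ v, ρ * ‖v‖ ^ 2 ≤ quadForm H v :=
    quadForm_ge_of_spectrum H hsymm fun l hl => (hspec hl).1
  obtain ⟨D, hD⟩ : ∃ D : ℝ, ∀ t ∈ M.Θ, ‖t - θs‖ ≤ D := by
    obtain ⟨R, hR⟩ := hbdd.subset_closedBall θs
    exact ⟨R, fun t ht => by simpa [dist_eq_norm] using hR ht⟩
  have hD0 : 0 ≤ D := (norm_nonneg _).trans (hD θs hmem)
  obtain ⟨r₁, hr₁, hball⟩ := Metric.isOpen_iff.1 isOpen_interior θs hin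
  -- Within this radius θ is interior to Θ and the cubic Taylor term is absorbed by the curvature.
  set r := min r₁ (ρ / (8 * L)) with hr_def
  have hr : 0 < r := by positivity
  have hLr : L * r ≤ ρ / 8 := by
    have := min_le_right r₁ (ρ / (8 * L))
    calc L * r ≤ L * (ρ / (8 * L)) := by gcongr
      _ = ρ / 8 := by field_simp
  set G : 𝒳 → ℝ := fun x => (∑ i, |M.grad θs x (stdVec i)|) +
      D * (∑ i, ∑ j, |M.hess θs x (stdVec i) (stdVec j)|) + L * D ^ 2 with hGdef
  have hGsub : SubExp P₀ G := subExp_gradEnvelope hsm hg hin D _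
  have hG0 : ∀ x, 0 ≤ G x := fun x => by positivity
  have hGlip : ∀ x, ∀ θ ∈ M.Θ, ∀ θ' ∈ M.Θ, |M.logLik θ' x - M.logLik θ x| ≤ G x * ‖θ' - θ‖ :=
    fun x θ hθ θ' hθ' => abs_logLik_sub_le hsm hL x hmem hθ hθ' hD
  set EG := ∫ x, G x ∂P₀ with hEG
  have hEG0 : 0 ≤ EG := integral_nonneg hG0
  set ε := min (r / 2) (c * r ^ 2 / (16 * (EG + 1))) with hεdef
  have hε : 0 < ε := by positivity
  -- The net is taken inside Θ, where the growth condition is available. Its mesh is fixed,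
  -- independent of n, so finitely many averages suffice.
  obtain ⟨t, htΘ, htf, hcov⟩ := Metric.finite_approx_of_totallyBounded
    (hbdd.isCompact_closure.totallyBounded.subset subset_closure) ε hε
  have hnet : ∀ θ ∈ M.Θ, ∃ q ∈ htf.toFinset, ‖θ - q‖ ≤ ε := by
    intro θ hθ
    obtain ⟨q, hq, hqε⟩ := mem_iUnion₂.1 (hcov hθ)
    exact ⟨q, htf.mem_toFinset.2 hq, by rw [← dist_eq_norm]; exact (Metric.mem_ball.1 hqε).le⟩
  have htΘ' : ∀ q ∈ htf.toFinset, q ∈ M.Θ := fun q hq => htΘ (htf.mem_toFinset.1 hq)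
  have hqsub : ∀ q ∈ htf.toFinset, SubExp P₀ (fun x => M.logLik q x - M.logLik θs x) := by
    intro q hq
    refine (hGsub.const_mul ‖q - θs‖).mono
      ((measurable_logLik (htΘ' q hq)).sub (measurable_logLik hmem)) fun x => ?_
    refine (hGlip x θs hmem q (htΘ' q hq)).trans ?_
    rw [mul_comm]
    exact le_abs_self _
  set ι := Fin p ⊕ (Fin p × Fin p) ⊕ Option htf.toFinset
  -- All averages to be controlled, namely scores, Hessian entries, the Lipschitz envelope and the
  -- log-likelihoods at the net points, form one finite family, so a single concentration bound
  -- covers them.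
  set Y : ι → 𝒳 → ℝ := Sum.elim (fun k x => M.grad θs x (stdVec k))
    (Sum.elim (fun kl x => M.hess θs x (stdVec kl.1) (stdVec kl.2))
      (fun o => o.elim G fun q x => M.logLik q x - M.logLik θs x)) with hYdef
  have hY : ∀ k ∈ (Finset.univ : Finset ι), SubExp P₀ (Y k) := by
    rintro (k | ⟨k, l⟩ | _ | q) -
    · exact subExp_grad hsm hg hin _
    · exact subExp_hess hsm hg hin _ _
    · exact hGsub
    · exact hqsub q q.2
  obtain ⟨D₁, hD₁, b, hb, n₁, hconc⟩ := exists_measure_exists_sum_ge_sqrt_log_le Finset.univ hY hκ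
  have hsmall : ∀ η > 0, ∀ᶠ n : ℕ in atTop, b * Real.sqrt (Real.log n) / Real.sqrt n ≤ η := by
    intro η hη
    filter_upwards [eventually_mul_sqrt_log_le b hη, eventually_ge_atTop 1] with n h hn
    rw [div_le_iff₀ (Real.sqrt_pos.2 (by exact_mod_cast hn))]
    exact h
  -- For large n the common deviation δ = b√(log n / n) meets the smallness conditions of the two
  -- deterministic lemmas. The linearisation error O(δ²) is then O(log n / n).
  obtain ⟨n₂, hn₂⟩ := eventually_atTop.1 (((hsmall _ (show 0 < ρ / 4 / (p ^ 2 + 1) by positivity)).and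
    ((hsmall _ (show 0 < c * r ^ 2 / 16 by positivity)).and (hsmall 1 one_pos))).and
      (eventually_ge_atTop 3))
  refine ⟨D₁, hD₁, (16 * L * p ^ 2 / ρ ^ 2 + 4 * p ^ 3 / ρ + 1) * b ^ 2, by positivity, max n₁ n₂,
    fun n hn => ?_⟩
  refine (measureReal_mono ?_).trans (hconc n ((le_max_left _ _).trans hn))
  obtain ⟨⟨hs1, hs2, hs3⟩, hn3⟩ := hn₂ n ((le_max_right _ _).trans hn)
  have hl := one_le_log_of_three_le hn3
  have hn0 : (0 : ℝ) < n := by positivity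
  have hsq : Real.sqrt n * Real.sqrt n = n := Real.mul_self_sqrt hn0.le
  have hsqpos : 0 < Real.sqrt n := Real.sqrt_pos.2 hn0
  set δ := b * Real.sqrt (Real.log n) / Real.sqrt n with hδdef
  have hδ0 : 0 ≤ δ := by positivity
  have hnδ : b * Real.sqrt (Real.log n) * Real.sqrt n = n * δ := by
    rw [hδdef, ← mul_div_assoc, eq_div_iff hsqpos.ne', mul_assoc, hsq]; ring
  have hδ2 : δ ^ 2 = b ^ 2 * (Real.log n / n) := by
    rw [hδdef, div_pow, mul_pow, Real.sq_sqrt (by linarith), Real.sq_sqrt hn0.le]; ring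
  intro x hx
  by_contra hcon
  apply hx
  simp only [Finset.mem_univ, true_and, mem_ofPred_eq, not_exists, not_le, hnδ] at hcon
  intro θ hmax v
  have hd1 : ∀ k, |∑ i, M.grad θs (x i) (stdVec k)| ≤ n * δ := by
    intro k
    have := (hcon (Sum.inl k)).le
    simpa [hYdef, integral_grad_eq_zero hsm hg hθs] using this
  have hd2 : ∀ k l, |∑ i, (M.hess θs (x i) (stdVec k) (stdVec l) + H k l)| ≤ n * δ := by
    intro k l
    have := (hcon (Sum.inr (Sum.inl (k, l)))).le
    have e : H k l = -∫ y, M.hess θs y (stdVec k) (stdVec l) ∂P₀ := rfl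
    simp_rw [e, ← sub_eq_add_neg]
    exact this
  have hd3 : ∑ i, (G (x i) - EG) ≤ n * δ :=
    (le_abs_self _).trans (hcon (Sum.inr (Sum.inr none))).le
  have hd4 : ∀ q ∈ htf.toFinset, ∑ i, (M.logLik q (x i) - M.logLik θs (x i) -
      ∫ y, (M.logLik q y - M.logLik θs y) ∂P₀) ≤ n * δ := fun q hq =>
    (le_abs_self _).trans (hcon (Sum.inr (Sum.inr (some ⟨q, hq⟩)))).le
  have hfar : ‖θ - θs‖ < r := by
    refine hmax.norm_sub_lt (δ := δ) hmem htΘ' hnet hG0 hGlip (fun q hq => ?_) hc hr (min_le_left _ _) hε.le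
      ?_ (by omega) hd3 hd4
    · rw [integral_sub (hθs.integrable q (htΘ' q hq)) (hθs.integrable θs hmem)]
      have := hgrow q (htΘ' q hq)
      linarith
    · have h1 : ε * (EG + δ) ≤ c * r ^ 2 / 16 := by
        have h2 : ε ≤ c * r ^ 2 / (16 * (EG + 1)) := min_le_right _ _
        calc ε * (EG + δ) ≤ c * r ^ 2 / (16 * (EG + 1)) * (EG + 1) := by gcongr
          _ = _ := by field_simp
      have : 0 < c * r ^ 2 := by positivity
      linarith
  have hint : θ ∈ interior M.Θ := by
    apply hball
    rw [Metric.mem_ball, dist_eq_norm]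
    exact hfar.trans_le (min_le_left _ _)
  have hp2 : (p : ℝ) ^ 2 * δ ≤ ρ / 4 := by
    calc (p : ℝ) ^ 2 * δ ≤ (p ^ 2 + 1) * (ρ / 4 / (p ^ 2 + 1)) := by gcongr; linarith
      _ = ρ / 4 := by field_simp
  refine (hmax.expansion hsm hL hmem hint hρ hH hsymm hδ0 hfar.le hLr hp2 (by omega) hd1 hd2 v).trans ?_
  rw [hδ2, ← mul_assoc]
  exact mul_le_mul_of_nonneg_right (mul_le_mul_of_nonneg_right (mul_le_mul_of_nonneg_right
    (by linarith) (by positivity)) (by positivity)) (norm_nonneg v)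

end Block

end BayesModel


/-! ### Gaussian lower bound for score sums, with possibly singular covariance -/

/-- A right inverse on the finite-dimensional range is automatically continuous. Applied to the
score map into L², it replaces a direction by one with almost surely the same score and norm at most
a constant times the standard deviation of that score. -/
lemma LinearMap.exists_norm_preimage_le {E F : Type*} [NormedAddCommGroup E] [NormedSpace ℝ E]
    [FiniteDimensional ℝ E] [NormedAddCommGroup F] [NormedSpace ℝ F] (g : E →ₗ[ℝ] F) :
    ∃ K : ℝ, 0 ≤ K ∧ ∀ w, ∃ w', g w' = g w ∧ ‖w'‖ ≤ K * ‖g w‖ := by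
  obtain ⟨h, hh⟩ := g.rangeRestrict.exists_rightInverse_of_surjective g.range_rangeRestrict
  refine ⟨‖LinearMap.toContinuousLinearMap h‖, norm_nonneg (LinearMap.toContinuousLinearMap h), fun w => ⟨h (g.rangeRestrict w), ?_, ?_⟩⟩
  · have := congrArg Subtype.val (LinearMap.congr_fun hh (g.rangeRestrict w))
    simpa using this
  · exact (LinearMap.toContinuousLinearMap h).le_opNorm (g.rangeRestrict w)

lemma ae_sum_eq_of_ae_eq {𝒳 : Type*} [MeasurableSpace 𝒳] {μ : Measure 𝒳} [IsProbabilityMeasure μ]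
    {Y Z : 𝒳 → ℝ} (h : Y =ᵐ[μ] Z) (n : ℕ) :
    ∀ᵐ y : Fin n → 𝒳 ∂(Measure.pi fun _ => μ), ∑ i, Y (y i) = ∑ i, Z (y i) := by
  have : ∀ᵐ y : Fin n → 𝒳 ∂(Measure.pi fun _ => μ), ∀ i, Y (y i) = Z (y i) := by
    rw [ae_all_iff]
    intro i
    exact (measurePreserving_eval (fun _ : Fin n => μ) i).quasiMeasurePreserving.ae h
  filter_upwards [this] with y hy
  exact Finset.sum_congr rfl fun i _ => hy i

namespace BayesModel

section BlockSum

variable {p : ℕ} {𝒳 : Type*} [MeasurableSpace 𝒳] {M : BayesModel p 𝒳}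
  {P₀ : Measure 𝒳} [IsProbabilityMeasure P₀] {θs : EuclideanSpace ℝ (Fin p)}

lemma memLp_grad (hsm : M.SmoothCond) (hg : M.GradCond P₀) (hθ : θs ∈ interior M.Θ)
    (v : EuclideanSpace ℝ (Fin p)) : MemLp (fun x => M.grad θs x v) 2 P₀ := by
  have h := subExp_grad hsm hg hθ v
  rw [memLp_two_iff_integrable_sq h.measurable.aestronglyMeasurable]
  simpa using h.integrable_abs_pow 2

/-- The score in direction `v`, as a linear map from directions to `L²(P₀)`. -/
def gradLp (hsm : M.SmoothCond) (hg : M.GradCond P₀) (hθ : θs ∈ interior M.Θ) :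
    EuclideanSpace ℝ (Fin p) →ₗ[ℝ] Lp ℝ 2 P₀ where
  toFun v := (memLp_grad hsm hg hθ v).toLp _
  map_add' u v := by
    rw [← MemLp.toLp_add]
    congr 1; ext x; simp
  map_smul' c v := by
    rw [RingHom.id_apply, ← MemLp.toLp_const_smul]
    congr 1; ext x; simp

lemma norm_gradLp_sq (hsm : M.SmoothCond) (hg : M.GradCond P₀) (hθ : θs ∈ interior M.Θ)
    (v : EuclideanSpace ℝ (Fin p)) :
    ‖gradLp hsm hg hθ v‖ ^ 2 = ∫ x, M.grad θs x v ^ 2 ∂P₀ := by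
  rw [← real_inner_self_eq_norm_sq, L2.inner_def]
  refine integral_congr_ae ?_
  filter_upwards [(memLp_grad hsm hg hθ v).coeFn_toLp] with x hx
  have : (gradLp hsm hg hθ v : 𝒳 → ℝ) x = M.grad θs x v := hx
  rw [this]
  simp [sq]

/-- Gaussian lower bound, up to `O(log n / √n)`, for the distribution functions of the score sums of
a block, uniformly over bounded directions; the limiting covariance may be degenerate. -/
theorem exists_measure_sum_grad_le_ge (hsm : M.SmoothCond) (hg : M.GradCond P₀)
    (hθs : M.IsTrueParam P₀ θs) {x₀ : ℝ} (hx₀ : 0 < x₀) (hx₀' : x₀ < 1 / 2) {R : ℝ} (hR : 0 < R) :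
    ∃ A > 0, ∃ C > 0, ∃ n₀ : ℕ, ∀ n ≥ n₀, ∀ w : EuclideanSpace ℝ (Fin p), ‖w‖ ≤ R →
      ∀ x, 0 ≤ x → x ≤ x₀ → 1 / 2 + x - C * Real.log n / Real.sqrt n ≤
        (Measure.pi fun _ : Fin n => P₀).real
          {y | ∑ i, M.grad θs (y i) w ≤ A * x * Real.sqrt n} := by
  have hin := hθs.mem_interior
  set g := gradLp hsm hg hin with hgdef
  obtain ⟨K', hK', hpre⟩ := g.exists_norm_preimage_le
  set G : 𝒳 → ℝ := fun x => ∑ i, |M.grad θs x (stdVec i)| with hG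
  have hGsub : SubExp P₀ G := SubExp.sum _ fun i _ => (subExp_grad hsm hg hin (stdVec i)).abs
  have hG0 : ∀ x, 0 ≤ G x := fun x => Finset.sum_nonneg fun i _ => abs_nonneg _
  have hgradG : ∀ x v, |M.grad θs x v| ≤ G x * ‖v‖ := fun x v =>
    ((M.grad θs x).le_opNorm v).trans
      (mul_le_mul_of_nonneg_right (norm_le_sum_norm_stdVec _) (norm_nonneg v))
  have hm3 : 0 ≤ ∫ x, G x ^ 3 ∂P₀ := integral_nonneg fun x => pow_nonneg (hG0 x) 3
  have hG3 : Integrable (fun x => G x ^ 3) P₀ := by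
    refine (hGsub.integrable_abs_pow 3).congr (ae_of_all _ fun x => ?_)
    simp only [abs_of_nonneg (hG0 x)]
  -- Since the score of w' is at most G‖w'‖ ≤ G K' σ, the score divided by σ has third moment at
  -- most K, however small σ is.
  set K := 1 + K' ^ 3 * ∫ x, G x ^ 3 ∂P₀ with hK
  have hK1 : 1 ≤ K := by
    have : 0 ≤ K' ^ 3 * ∫ x, G x ^ 3 ∂P₀ := by positivity
    linarith
  obtain ⟨C, hC, n₀, hBE⟩ := gaussCdf_sub_le_measure_sum_le P₀ hK1
  obtain ⟨A₁, hA₁, hcdf⟩ := exists_gaussCdf_linear_lower hx₀ hx₀'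
  set σm := ‖LinearMap.toContinuousLinearMap g‖ * R + 1 with hσm
  have hσm0 : 0 < σm := by positivity
  -- The factor 2 undoes the s / 2 of the Berry–Esseen bound; σm bounds the standard deviation over
  -- ‖w‖ ≤ R.
  refine ⟨2 * A₁ * σm, by positivity, C, hC, max n₀ 3, fun n hn w hw x hx hxx => ?_⟩
  obtain ⟨w', hw', hw'n⟩ := hpre w
  have hae : (fun x => M.grad θs x w) =ᵐ[P₀] fun x => M.grad θs x w' := by
    have h1 := (memLp_grad hsm hg hin w).coeFn_toLp
    have h2 := (memLp_grad hsm hg hin w').coeFn_toLp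
    have h3 : (memLp_grad hsm hg hin w').toLp _ = (memLp_grad hsm hg hin w).toLp _ := hw'
    rw [h3] at h2
    exact h1.symm.trans h2
  have hset : (Measure.pi fun _ : Fin n => P₀).real
      {y | ∑ i, M.grad θs (y i) w ≤ 2 * A₁ * σm * x * Real.sqrt n} =
      (Measure.pi fun _ : Fin n => P₀).real
      {y | ∑ i, M.grad θs (y i) w' ≤ 2 * A₁ * σm * x * Real.sqrt n} := by
    apply measureReal_congr
    filter_upwards [ae_sum_eq_of_ae_eq hae n] with y hy
    exact congrArg (fun t => t ≤ 2 * A₁ * σm * x * Real.sqrt n) hy |>.to_iff |> propext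
  rw [hset]
  have hl := one_le_log_of_three_le ((le_max_right _ _).trans hn)
  have herr : 0 ≤ C * Real.log n / Real.sqrt n := by positivity
  -- In a degenerate direction σ = 0 forces w' = 0: the sum vanishes and the event is certain.
  rcases eq_or_lt_of_le (norm_nonneg (g w)) with hz | hσ
  · have hw0 : w' = 0 := by
      rw [← hz, mul_zero] at hw'n
      exact norm_le_zero_iff.1 hw'n
    have huniv : {y : Fin n → 𝒳 | ∑ i, M.grad θs (y i) w' ≤ 2 * A₁ * σm * x * Real.sqrt n} = univ := by
      refine eq_univ_of_forall fun y => ?_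
      simp only [hw0, map_zero, Finset.sum_const_zero, mem_ofPred_eq]
      positivity
    rw [huniv, probReal_univ]
    linarith
  · set σ := ‖g w‖ with hσdef
    have hσle : σ ≤ σm := by
      have h1 := (LinearMap.toContinuousLinearMap g).le_opNorm w
      have h2 : ‖LinearMap.toContinuousLinearMap g‖ * ‖w‖ ≤
        ‖LinearMap.toContinuousLinearMap g‖ * R := by gcongr
      exact (h1.trans h2).trans (by rw [hσm]; linarith)
    have hsub := subExp_grad hsm hg hin w'
    have hZ : SubExp P₀ (fun y => σ⁻¹ * M.grad θs y w') := hsub.const_mul _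
    have hvar : ∫ y, (σ⁻¹ * M.grad θs y w') ^ 2 ∂P₀ = 1 := by
      simp_rw [mul_pow]
      rw [integral_const_mul, ← norm_gradLp_sq hsm hg hin, ← hgdef, hw', ← hσdef]
      field_simp
    have hthird : ∫ y, |σ⁻¹ * M.grad θs y w'| ^ 3 ∂P₀ ≤ K := by
      calc ∫ y, |σ⁻¹ * M.grad θs y w'| ^ 3 ∂P₀ ≤ ∫ y, K' ^ 3 * G y ^ 3 ∂P₀ := by
            refine integral_mono (hZ.integrable_abs_pow 3) (hG3.const_mul _) fun y => ?_
            simp only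
            rw [← mul_pow]
            gcongr
            rw [abs_mul, abs_of_pos (inv_pos.2 hσ)]
            calc σ⁻¹ * |M.grad θs y w'| ≤ σ⁻¹ * (G y * (K' * σ)) := by
                  gcongr
                  exact (hgradG y w').trans (mul_le_mul_of_nonneg_left hw'n (hG0 y))
              _ = K' * G y := by field_simp
        _ = K' ^ 3 * ∫ y, G y ^ 3 ∂P₀ := integral_const_mul _ _
        _ ≤ K := by rw [hK]; linarith
    have hmean : ∫ y, σ⁻¹ * M.grad θs y w' ∂P₀ = 0 := by
      rw [integral_const_mul, integral_grad_eq_zero hsm hg hθs, mul_zero]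
    have hs0 : 0 ≤ 2 * A₁ * σm * x / σ := by positivity
    have h := hBE n ((le_max_left _ _).trans hn) _ hZ.measurable (hZ.integrable_abs_pow 3) hmean hvar
      hthird _ hs0
    have hlow : 1 / 2 + x ≤ gaussCdf 1 (2 * A₁ * σm * x / σ / 2) := by
      refine (hcdf x hx hxx).trans (gaussCdf_mono 1 ?_)
      calc A₁ * x = A₁ * x * 1 := (mul_one _).symm
        _ ≤ A₁ * x * (σm / σ) := by
          gcongr
          rwa [one_le_div hσ]
        _ = _ := by ring
    have heq : {y : Fin n → 𝒳 | ∑ i, σ⁻¹ * M.grad θs (y i) w' ≤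
        2 * A₁ * σm * x / σ * Real.sqrt n} =
        {y | ∑ i, M.grad θs (y i) w' ≤ 2 * A₁ * σm * x * Real.sqrt n} := by
      ext y
      simp only [mem_ofPred_eq]
      rw [← Finset.mul_sum, inv_mul_le_iff₀ hσ]
      have : σ * (2 * A₁ * σm * x / σ * Real.sqrt n) = 2 * A₁ * σm * x * Real.sqrt n := by
        field_simp
      rw [this]
    rw [heq] at h
    linarith

end BlockSum

end BayesModel


/-! ### Counting blocks: Markov, Hoeffding and Chernoff bounds -/

/-- The number of indices `j` with `ξ j ω ∈ S`, as a real number. -/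
def hitCount {J Ω 𝒴 : Type*} [Fintype J] (ξ : J → Ω → 𝒴) (S : Set 𝒴) (ω : Ω) : ℝ :=
  ∑ j, S.indicator (fun _ => (1 : ℝ)) (ξ j ω)

lemma hitCount_mono {J Ω 𝒴 : Type*} [Fintype J] {ξ : J → Ω → 𝒴} {S S' : Set 𝒴}
    (h : S ⊆ S') (ω : Ω) : hitCount ξ S ω ≤ hitCount ξ S' ω :=
  Finset.sum_le_sum fun j _ =>
    indicator_le_indicator_of_subset h (fun _ => zero_le_one) (ξ j ω)

lemma indicator_one_mem_Icc {𝒴 : Type*} (S : Set 𝒴) (y : 𝒴) :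
    S.indicator (fun _ => (1 : ℝ)) y ∈ Icc (0 : ℝ) 1 :=
  ⟨indicator_nonneg (fun _ _ => zero_le_one) y, indicator_le_self' (fun _ _ => zero_le_one) y⟩

lemma measurable_indicator_comp {J Ω 𝒴 : Type*} [MeasurableSpace Ω] [MeasurableSpace 𝒴]
    {ξ : J → Ω → 𝒴} (hξ : ∀ j, Measurable (ξ j)) {S : Set 𝒴} (hS : MeasurableSet S)
    (j : J) : Measurable fun ω => S.indicator (fun _ => (1 : ℝ)) (ξ j ω) :=
  (measurable_const.indicator hS).comp (hξ j)

lemma integral_indicator_comp {J Ω 𝒴 : Type*} [MeasurableSpace Ω] [MeasurableSpace 𝒴] {P : Measure Ω}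
    {Q : Measure 𝒴} {ξ : J → Ω → 𝒴} (hξ : ∀ j, Measurable (ξ j)) (hlaw : ∀ j, P.map (ξ j) = Q)
    {S : Set 𝒴} (hS : MeasurableSet S) (j : J) :
    ∫ ω, S.indicator (fun _ => (1 : ℝ)) (ξ j ω) ∂P = Q.real S := by
  rw [← hlaw j, ← integral_map (hξ j).aemeasurable
    (measurable_const.indicator hS).aestronglyMeasurable, integral_indicator_const _ hS]
  simp

section HitCount

variable {J Ω 𝒴 : Type*} [Fintype J] [MeasurableSpace Ω] [MeasurableSpace 𝒴]
  {P : Measure Ω} [IsProbabilityMeasure P] {Q : Measure 𝒴} {ξ : J → Ω → 𝒴}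

/-- Markov's inequality for the number of hits. -/
lemma measure_hitCount_ge_le_div [Nonempty J] [IsProbabilityMeasure Q]
    (hξ : ∀ j, Measurable (ξ j)) (hlaw : ∀ j, P.map (ξ j) = Q)
    {S : Set 𝒴} {q s : ℝ} (hq : Q.real S ≤ q) (hs : 0 < s) :
    P.real {ω | s * Fintype.card J ≤ hitCount ξ S ω} ≤ q / s := by
  -- S need not be measurable: in the application it quantifies over all maximisers. A measurable
  -- hull has the same measure and only increases the count.
  set S' := toMeasurable Q S
  have hS' : MeasurableSet S' := measurableSet_toMeasurable Q S
  have hint : ∀ j, Integrable (fun ω => S'.indicator (fun _ => (1 : ℝ)) (ξ j ω)) P := fun j =>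
    Integrable.of_mem_Icc 0 1 (measurable_indicator_comp hξ hS' j).aemeasurable
      (ae_of_all _ fun ω => indicator_one_mem_Icc S' _)
  have hmean : ∫ ω, hitCount ξ S' ω ∂P = Fintype.card J * Q.real S := by
    unfold hitCount
    rw [integral_finsetSum _ fun j _ => hint j]
    simp_rw [integral_indicator_comp hξ hlaw hS']
    have : Q.real S' = Q.real S := by simp [Measure.real, S', measure_toMeasurable]
    simp [this]
  have hN : (0 : ℝ) < Fintype.card J := by exact_mod_cast Fintype.card_pos
  have h := mul_meas_ge_le_integral_of_nonneg (μ := P) (f := hitCount ξ S')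
    (ae_of_all _ fun ω => Finset.sum_nonneg fun j _ => (indicator_one_mem_Icc S' _).1)
    (integrable_finsetSum _ fun j _ => hint j) (s * Fintype.card J)
  rw [hmean] at h
  have h2 : P.real {ω | s * Fintype.card J ≤ hitCount ξ S ω} ≤
      P.real {ω | s * Fintype.card J ≤ hitCount ξ S' ω} :=
    measureReal_mono fun ω hω => le_trans hω (hitCount_mono (subset_toMeasurable Q S) ω)
  rw [le_div_iff₀ hs]
  have h3 : P.real {ω | s * Fintype.card J ≤ hitCount ξ S' ω} * s ≤ Q.real S := by
    refine le_of_mul_le_mul_left ?_ hN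
    calc _ = s * Fintype.card J * P.real {ω | s * Fintype.card J ≤ hitCount ξ S' ω} := by ring
      _ ≤ _ := h
  nlinarith

/-- Hoeffding's inequality for the number of hits. -/
lemma measure_hitCount_le_le_exp [Nonempty J] (hξ : ∀ j, Measurable (ξ j))
    (hlaw : ∀ j, P.map (ξ j) = Q) (hind : iIndepFun ξ P) {S : Set 𝒴} (hS : MeasurableSet S)
    {h : ℝ} (hh : 0 ≤ h) :
    P.real {ω | hitCount ξ S ω ≤ (Q.real S - h) * Fintype.card J} ≤
      Real.exp (-(2 * h ^ 2 * Fintype.card J)) := by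
  have hN : (0 : ℝ) < Fintype.card J := by exact_mod_cast Fintype.card_pos
  have hind' : iIndepFun (fun j ω => Q.real S - S.indicator (fun _ => (1 : ℝ)) (ξ j ω)) P :=
    hind.comp (fun _ y => Q.real S - S.indicator (fun _ => (1 : ℝ)) y) fun _ =>
      measurable_const.sub (measurable_const.indicator hS)
  have hsub : ∀ j ∈ Finset.univ, HasSubgaussianMGF
      (fun ω => Q.real S - S.indicator (fun _ => (1 : ℝ)) (ξ j ω)) ((‖(1 : ℝ) - 0‖₊ / 2) ^ 2) P := by
    intro j _
    have := (hasSubgaussianMGF_of_mem_Icc (μ := P) (a := 0) (b := 1)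
      (measurable_indicator_comp hξ hS j).aemeasurable
      (ae_of_all _ fun ω => indicator_one_mem_Icc S _)).neg
    rw [integral_indicator_comp hξ hlaw hS] at this
    convert this using 1
    ext ω
    simp
  have hb := HasSubgaussianMGF.measure_sum_ge_le_of_iIndepFun hind' hsub
    (ε := h * Fintype.card J) (by positivity)
  refine le_trans (measureReal_mono fun ω hω => ?_) (hb.trans_eq ?_)
  · simp only [mem_ofPred_eq, hitCount] at hω ⊢
    rw [Finset.sum_sub_distrib]
    simp only [Finset.sum_const, Finset.card_univ, nsmul_eq_mul]
    linarith
  · congr 1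
    simp
    field_simp

/-- Chernoff's inequality for the number of hits of a rare event. -/
lemma measure_hitCount_ge_le_rpow [IsProbabilityMeasure Q] (hξ : ∀ j, Measurable (ξ j))
    (hlaw : ∀ j, P.map (ξ j) = Q) (hind : iIndepFun ξ P) {S : Set 𝒴} 
    {q k : ℝ} (hq : Q.real S ≤ q) (hq0 : 0 < q) (hk : 0 ≤ k) :
    P.real {ω | k ≤ hitCount ξ S ω} ≤ 2 ^ Fintype.card J * q ^ k := by
  rcases lt_or_ge 1 q with h1 | h1
  · refine measureReal_le_one.trans ?_
    have : (1 : ℝ) ≤ 2 ^ Fintype.card J := one_le_pow₀ (by norm_num)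
    nlinarith [Real.one_le_rpow h1.le hk]
  set S' := toMeasurable Q S
  have hS' : MeasurableSet S' := measurableSet_toMeasurable Q S
  have hQ' : Q.real S' ≤ q := by
    rwa [Measure.real, measure_toMeasurable]
  set Y : J → Ω → ℝ := fun j ω => S'.indicator (fun _ => (1 : ℝ)) (ξ j ω) with hY
  have hYm : ∀ j, Measurable (Y j) := measurable_indicator_comp hξ hS'
  have hindY : iIndepFun Y P :=
    hind.comp (fun _ y => S'.indicator (fun _ => (1 : ℝ)) y) fun _ => measurable_const.indicator hS'
  have hYI : ∀ j ω, Y j ω ∈ Icc (0 : ℝ) 1 := fun j ω => indicator_one_mem_Icc S' _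
  -- With exp t = 1/q each factor of the moment generating function is at most 1 + (1/q − 1)q ≤ 2.
  set t := -Real.log q with ht
  have ht0 : 0 ≤ t := by rw [ht]; linarith [Real.log_nonpos hq0.le h1]
  have hexp : Real.exp t = q⁻¹ := by rw [ht, Real.exp_neg, Real.exp_log hq0]
  have hmgf : ∀ j, mgf (Y j) P t ≤ 2 := by
    intro j
    have h2 : (fun ω => Real.exp (t * Y j ω)) = fun ω => 1 + (q⁻¹ - 1) * Y j ω := by
      ext ω
      by_cases hω : ξ j ω ∈ S'
      · simp [hY, hω, hexp]
      · simp [hY, hω]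
    unfold mgf
    rw [h2, integral_add (integrable_const _) ((Integrable.of_mem_Icc 0 1 (hYm j).aemeasurable
      (ae_of_all _ (hYI j))).const_mul _), integral_const_mul, integral_indicator_comp hξ hlaw hS']
    simp only [integral_const, probReal_univ, smul_eq_mul, mul_one]
    have h3 : (q⁻¹ - 1) * Q.real S' ≤ (q⁻¹ - 1) * q := by
      have := (one_le_inv₀ hq0).2 h1
      exact mul_le_mul_of_nonneg_left hQ' (by linarith)
    have h4 : (q⁻¹ - 1) * q = 1 - q := by field_simp
    linarith
  have hle := measure_ge_le_exp_mul_mgf (μ := P) (X := ∑ j, Y j) k ht0 (by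
    refine Integrable.of_mem_Icc 0 (Real.exp (t * Fintype.card J)) ?_ ?_
    · have : Measurable (∑ j, Y j) := by
        rw [Finset.sum_fn]; exact Finset.measurable_sum _ fun j _ => hYm j
      fun_prop
    · refine ae_of_all _ fun ω => ⟨(Real.exp_pos _).le, Real.exp_le_exp.2 ?_⟩
      refine mul_le_mul_of_nonneg_left ?_ ht0
      rw [Finset.sum_apply]
      calc ∑ j, Y j ω ≤ ∑ _j : J, (1 : ℝ) := Finset.sum_le_sum fun j _ => (hYI j ω).2
        _ = _ := by simp)
  refine le_trans (measureReal_mono fun ω hω => ?_) (hle.trans ?_)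
  · simp only [mem_ofPred_eq, Finset.sum_apply] at hω ⊢
    exact le_trans hω (hitCount_mono (subset_toMeasurable Q S) ω)
  · rw [hindY.mgf_sum hYm, mul_comm]
    refine mul_le_mul ?_ ?_ (Real.exp_pos _).le (by positivity)
    · calc ∏ j, mgf (Y j) P t ≤ ∏ _j : J, (2 : ℝ) :=
          Finset.prod_le_prod (fun j _ => mgf_nonneg) fun j _ => hmgf j
        _ = _ := by simp
    · rw [Real.rpow_def_of_pos hq0, ht]
      simp

end HitCount

/-- Rows of an independent array are independent, with product laws. -/
lemma iIndepFun_rows {J I Ω 𝒳 : Type*} [Fintype J] [Fintype I] [MeasurableSpace Ω]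
    [MeasurableSpace 𝒳] {P : Measure Ω} [IsProbabilityMeasure P] {μ : Measure 𝒳}
    [IsProbabilityMeasure μ] {X : J → I → Ω → 𝒳} (hX : ∀ j i, Measurable (X j i))
    (hlaw : ∀ j i, P.map (X j i) = μ) (hind : iIndepFun (fun q : J × I => X q.1 q.2) P) :
    iIndepFun (fun j ω i => X j i ω) P ∧
      ∀ j, P.map (fun ω i => X j i ω) = Measure.pi fun _ : I => μ := by
  have hm : ∀ j, Measurable fun ω i => X j i ω := fun j => measurable_pi_iff.2 (hX j)
  have hrow : ∀ j, P.map (fun ω i => X j i ω) = Measure.pi fun _ : I => μ := by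
    intro j
    have h := (hind.precomp (g := fun i : I => (j, i)) (Prod.mk_right_injective j))
    rw [iIndepFun_iff_map_fun_eq_pi_map (fun i => (hX j i).aemeasurable)] at h
    simp only [hlaw] at h
    exact h
  refine ⟨?_, hrow⟩
  rw [iIndepFun_iff_map_fun_eq_infinitePi_map hm]
  simp_rw [hrow]
  have h1 := (iIndepFun_iff_map_fun_eq_infinitePi_map
    (X := fun q : J × I => X q.1 q.2) (fun q => hX q.1 q.2)).1 hind
  simp only [hlaw] at h1
  have h2 := congrArg (Measure.map (MeasurableEquiv.curry J I 𝒳)) h1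
  rw [Measure.infinitePi_map_curry (fun (_ : J) (_ : I) => μ), Measure.map_map
    (MeasurableEquiv.curry J I 𝒳).measurable (measurable_pi_iff.2 fun q => hX q.1 q.2)] at h2
  simp only [Measure.infinitePi_eq_pi] at h2 ⊢
  exact h2


/-! ### Balancedness of the block estimators -/

/-- In every direction `v`, more than a fraction `1/2 + d` of the vectors `H (θ̂ⱼ - θ⋆)` have inner
product at most `‖v‖ ε` with `v`. -/
def IsBalanced {p : ℕ} (H : Matrix (Fin p) (Fin p) ℝ) (θs : EuclideanSpace ℝ (Fin p)) (d ε : ℝ)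
    {J : Type*} [Fintype J] (θhat : J → EuclideanSpace ℝ (Fin p)) : Prop :=
  ∀ v : EuclideanSpace ℝ (Fin p), (1 / 2 + d) * Fintype.card J <
    ((Finset.univ.filter fun j => inner ℝ v (matrixCLM H (θhat j - θs)) ≤ ‖v‖ * ε).card : ℝ)

lemma IsBalanced.mono {p : ℕ} {H : Matrix (Fin p) (Fin p) ℝ} {θs : EuclideanSpace ℝ (Fin p)}
    {d ε ε' : ℝ} {J : Type*} [Fintype J] {θhat : J → EuclideanSpace ℝ (Fin p)}
    (h : IsBalanced H θs d ε θhat) (hε : ε ≤ ε') : IsBalanced H θs d ε' θhat := by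
  intro v
  refine (h v).trans_le (Nat.cast_le.2 (Finset.card_le_card ?_))
  intro j hj
  simp only [Finset.mem_filter, Finset.mem_univ, true_and] at hj ⊢
  exact hj.trans (mul_le_mul_of_nonneg_left hε (norm_nonneg v))

lemma isBalanced_of_norm_eq_one {p : ℕ} {H : Matrix (Fin p) (Fin p) ℝ}
    {θs : EuclideanSpace ℝ (Fin p)} {d ε : ℝ} {J : Type*} [Fintype J] [Nonempty J]
    {θhat : J → EuclideanSpace ℝ (Fin p)} (hd : d < 1 / 2)
    (h : ∀ v : EuclideanSpace ℝ (Fin p), ‖v‖ = 1 → (1 / 2 + d) * Fintype.card J <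
      ((Finset.univ.filter fun j => inner ℝ v (matrixCLM H (θhat j - θs)) ≤ ε).card : ℝ)) :
    IsBalanced H θs d ε θhat := by
  intro v
  have hN : (0 : ℝ) < Fintype.card J := by exact_mod_cast Fintype.card_pos
  rcases eq_or_ne v 0 with rfl | hv
  · simp only [inner_zero_left, norm_zero, zero_mul, le_refl, Finset.filter_true, Finset.card_univ]
    nlinarith
  · have hv' : 0 < ‖v‖ := norm_pos_iff.2 hv
    refine (h (‖v‖⁻¹ • v) (by rw [norm_smul, norm_inv, norm_norm, inv_mul_cancel₀ hv'.ne'])).trans_le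
      (Nat.cast_le.2 (Finset.card_le_card ?_))
    intro j hj
    simp only [Finset.mem_filter, Finset.mem_univ, true_and, real_inner_smul_left] at hj ⊢
    rwa [inv_mul_le_iff₀ hv'] at hj

/-- Every block hitting G but not S satisfies q. This is how a small number of exceptional blocks is
tolerated instead of being excluded. -/
lemma hitCount_sub_le_card {J Ω 𝒴 : Type*} [Fintype J] {ξ : J → Ω → 𝒴} {G S : Set 𝒴} {ω : Ω}
    {q : J → Prop} [DecidablePred q] (h : ∀ j, ξ j ω ∈ G → ξ j ω ∉ S → q j) :
    hitCount ξ G ω - hitCount ξ S ω ≤ ((Finset.univ.filter q).card : ℝ) := by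
  classical
  rw [hitCount, hitCount, ← Finset.sum_sub_distrib, Finset.card_filter, Nat.cast_sum]
  refine Finset.sum_le_sum fun j _ => ?_
  by_cases h1 : ξ j ω ∈ G <;> by_cases h2 : ξ j ω ∈ S <;> by_cases h3 : q j <;>
    simp [h1, h2, h3]
  exact absurd (h j h1 h2) h3

lemma hitCount_compl {J Ω 𝒴 : Type*} [Fintype J] (ξ : J → Ω → 𝒴) (S : Set 𝒴) (ω : Ω) :
    hitCount ξ Sᶜ ω = Fintype.card J - hitCount ξ S ω := by
  rw [eq_sub_iff_add_eq, hitCount, hitCount, ← Finset.sum_add_distrib]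
  calc _ = ∑ _j : J, (1 : ℝ) := Finset.sum_congr rfl fun j _ =>
        congrFun (indicator_compl_add_self S fun _ => (1 : ℝ)) (ξ j ω)
    _ = _ := by simp

/-- Points of the grid `{-1, …, -1/n, 0, 1/n, …, 1}ᵖ`. -/
def gridPoint {p : ℕ} (n : ℕ) (k : Fin p → Fin (2 * n + 1)) : EuclideanSpace ℝ (Fin p) :=
  ∑ i, (((k i : ℕ) : ℝ) / n - 1) • BayesModel.stdVec i

/-- Rounding each coordinate down to the grid moves it by at most 1/n. The resulting error is below
the linearisation error, while the number of grid points is only polynomial in n. -/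
lemma exists_norm_sub_gridPoint_le {p n : ℕ} (hn : 0 < n) {w : EuclideanSpace ℝ (Fin p)}
    (hw : ‖w‖ = 1) : ∃ k, ‖w - gridPoint n k‖ ≤ p / n := by
  have hn' : (0 : ℝ) < n := by exact_mod_cast hn
  have hwi : ∀ i, |w i| ≤ 1 := fun i => by
    have := PiLp.norm_apply_le w i
    rwa [hw, Real.norm_eq_abs] at this
  have hnn : ∀ i, 0 ≤ n * (w i + 1) := fun i =>
    mul_nonneg hn'.le (by linarith [(abs_le.1 (hwi i)).1])
  refine ⟨fun i => ⟨⌊n * (w i + 1)⌋₊, ?_⟩, ?_⟩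
  · refine Nat.lt_succ_of_le (Nat.floor_le_of_le ?_)
    push_cast
    nlinarith [(abs_le.1 (hwi i)).2]
  · rw [gridPoint]
    nth_rewrite 1 [EuclideanSpace.sum_smul_stdVec w]
    rw [← Finset.sum_sub_distrib]
    refine (norm_sum_le _ _).trans ?_
    calc _ ≤ ∑ _i : Fin p, (1 : ℝ) / n := by
          refine Finset.sum_le_sum fun i _ => ?_
          have hst : ‖BayesModel.stdVec i‖ = 1 := by simp [BayesModel.stdVec]
          rw [← sub_smul, norm_smul, hst, mul_one, Real.norm_eq_abs, abs_le]
          have h1 := Nat.floor_le (hnn i)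
          have h2 := Nat.lt_floor_add_one (n * (w i + 1))
          have e : w i - ((⌊n * (w i + 1)⌋₊ : ℝ) / n - 1) =
            (n * (w i + 1) - ⌊n * (w i + 1)⌋₊) / n := by
            field_simp; ring
          simp only
          rw [e]
          constructor
          · have : 0 ≤ (n * (w i + 1) - ⌊n * (w i + 1)⌋₊) / n := div_nonneg (by linarith) hn'.le
            have : 0 ≤ 1 / (n : ℝ) := by positivity
            linarith
          · exact div_le_div_of_nonneg_right (by linarith) hn'.le
      _ = p / n := by simp [div_eq_mul_inv]

lemma inv_mul_mul_sqrt {n : ℝ} (hn : 0 < n) (y : ℝ) :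
    n⁻¹ * (y * Real.sqrt n) = y / Real.sqrt n := by
  rw [eq_div_iff (Real.sqrt_pos.2 hn).ne', mul_assoc, mul_assoc, Real.mul_self_sqrt hn.le]
  field_simp

lemma combined_bound_le {A g c c₁ c₂ d b a s : ℝ} (hA : 0 ≤ A) (hg : 0 ≤ g) (hc : 0 ≤ c)
    (hc₁ : 0 ≤ c₁) (hc₂ : 0 ≤ c₂) (hd : 0 ≤ d) (hb : 0 ≤ b) (ha : 0 ≤ a) (hs : 0 < s) :
    A * (d + g * b + c * a) / s + c₁ * a / s + c₂ * a / s ≤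
      (A * (1 + g + c) + c₁ + c₂) / s * (d + b + a) := by
  have t1 : d + g * b + c * a ≤ (1 + g + c) * (d + b + a) := by
    have : 0 ≤ g * d + g * a + b + a + c * d + c * b := by positivity
    nlinarith
  have t2 := mul_le_mul_of_nonneg_left t1 hA
  have t3 : c₁ * a ≤ c₁ * (d + b + a) := mul_le_mul_of_nonneg_left (by linarith) hc₁
  have t4 : c₂ * a ≤ c₂ * (d + b + a) := mul_le_mul_of_nonneg_left (by linarith) hc₂
  rw [← add_div, ← add_div, div_mul_eq_mul_div]
  exact div_le_div_of_nonneg_right (by linarith) hs.le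

namespace BayesModel

variable {p : ℕ} {𝒳 : Type*} [MeasurableSpace 𝒳] {M : BayesModel p 𝒳}
  {P₀ : Measure 𝒳} [IsProbabilityMeasure P₀] {θs : EuclideanSpace ℝ (Fin p)}

/-- The samples of a block for which the linearisation of the likelihood equations fails. -/
def nonlinearSet (M : BayesModel p 𝒳) (P₀ : Measure 𝒳) (θs : EuclideanSpace ℝ (Fin p)) (C : ℝ)
    (n : ℕ) : Set (Fin n → 𝒳) :=
  {x | ¬ ∀ θ, M.IsLocalMax x θ → ∀ v, |inner ℝ v (matrixCLM (M.fisher P₀ θs) (θ - θs)) -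
    (n : ℝ)⁻¹ * ∑ i, M.grad θs (x i) v| ≤ C * (Real.log n / n) * ‖v‖}

lemma exists_norm_matrixCLM_sub_le (hb : Bornology.IsBounded M.Θ) (hmem : θs ∈ M.Θ)
    (H : Matrix (Fin p) (Fin p) ℝ) :
    ∃ U : ℝ, 0 ≤ U ∧ ∀ θ ∈ M.Θ, ‖matrixCLM H (θ - θs)‖ ≤ U := by
  refine ⟨‖matrixCLM H‖ * Metric.diam M.Θ, by positivity, fun θ hθ => ?_⟩
  refine ((matrixCLM H).le_opNorm _).trans (mul_le_mul_of_nonneg_left ?_ (norm_nonneg _))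
  rw [← dist_eq_norm]
  exact Metric.dist_le_diam_of_mem hb hθ hmem

/-- Markov's inequality at level 1/√n makes the bound independent of the number of blocks. The lost
factor √n ≤ n is paid for by the extra 1 in the exponent γ + 1. -/
lemma measure_hitCount_nonlinearSet_le {C D γ : ℝ} {n : ℕ} (hn : 0 < n) (hD : 0 ≤ D)
    (hbad : (Measure.pi fun _ : Fin n => P₀).real (nonlinearSet M P₀ θs C n) ≤
      D * (n : ℝ) ^ (-(γ + 1)))
    {J : Type*} [Fintype J] [Nonempty J] {Ω : Type*} [MeasurableSpace Ω] {P : Measure Ω}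
    [IsProbabilityMeasure P] {ξ : J → Ω → Fin n → 𝒳} (hξ : ∀ j, Measurable (ξ j))
    (hlaw : ∀ j, P.map (ξ j) = Measure.pi fun _ : Fin n => P₀) :
    P.real {ω | 1 / Real.sqrt n * Fintype.card J ≤ hitCount ξ (nonlinearSet M P₀ θs C n) ω} ≤
      D * (n : ℝ) ^ (-γ) := by
  have hn' : (1 : ℝ) ≤ n := by exact_mod_cast hn
  have hs : 0 < Real.sqrt n := Real.sqrt_pos.2 (by linarith)
  refine (measure_hitCount_ge_le_div hξ hlaw hbad (by positivity)).trans ?_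
  rw [div_div_eq_mul_div, div_one, mul_assoc]
  refine mul_le_mul_of_nonneg_left ?_ hD
  have : Real.sqrt n ≤ n := Real.sqrt_le_self_iff.2 (Or.inr hn')
  calc (n : ℝ) ^ (-(γ + 1)) * Real.sqrt n ≤ (n : ℝ) ^ (-(γ + 1)) * n :=
        mul_le_mul_of_nonneg_left this (by positivity)
    _ = (n : ℝ) ^ (-γ) := by
        rw [← Real.rpow_add_one (by positivity)]
        congr 1; ring

/-- Balancedness of the block estimators when the number of blocks is large compared to `log n`. -/
theorem exists_measure_not_isBalanced_le_of_log_le (hsm : M.SmoothCond) (hg : M.GradCond P₀)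
    (hθs : M.IsTrueParam P₀ θs) (hgr : M.GrowthCond P₀ θs) {δ γ : ℝ} (hδ : 0 < δ)
    (hδ' : δ ≤ 1 / 2) (hγ : 0 < γ) :
    ∃ A : ℝ, 0 ≤ A ∧ ∃ D : ℝ, 0 ≤ D ∧ ∃ n₀ : ℕ, ∀ n ≥ n₀, ∀ m : ℕ, 1 ≤ m → ∀ d : ℝ, 0 ≤ d →
      d ≤ 1 / 2 - δ → Real.sqrt ((γ + p) * (Real.log n / m)) ≤ δ / 4 →
      ∀ {J : Type*} [Fintype J] [Nonempty J], m ≤ 2 * Fintype.card J →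
      ∀ {Ω : Type*} [MeasurableSpace Ω] {P : Measure Ω} [IsProbabilityMeasure P]
        {ξ : J → Ω → Fin n → 𝒳}, (∀ j, Measurable (ξ j)) →
        (∀ j, P.map (ξ j) = Measure.pi fun _ : Fin n => P₀) → iIndepFun ξ P →
        P.real {ω | ¬ ∀ θhat : J → EuclideanSpace ℝ (Fin p),
          (∀ j, M.IsLocalMax (ξ j ω) (θhat j)) → IsBalanced (M.fisher P₀ θs) θs d
            (A / Real.sqrt n * (d + Real.sqrt (Real.log n / m) + Real.log n / Real.sqrt n)) θhat} ≤
          D * (n : ℝ) ^ (-γ) := by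
  have hin := hθs.mem_interior
  obtain ⟨D₁, hD₁, C₁, hC₁, n₁, hbad⟩ :=
    exists_measure_not_linear_le hsm hg hθs hgr (κ := γ + 1) (by linarith)
  -- The level x₀ leaves a margin δ/2 above d ≤ 1/2 − δ; the radius 1 + p contains every grid point
  -- near a unit vector.
  obtain ⟨A₂, hA₂, C₂, hC₂, n₂, hsum⟩ := exists_measure_sum_grad_le_ge hsm hg hθs
    (x₀ := 1 / 2 - δ / 2) (by linarith) (by linarith) (R := 1 + p) (by positivity)
  obtain ⟨U, hU, hUb⟩ := exists_norm_matrixCLM_sub_le hgr.1 (interior_subset hin) (M.fisher P₀ θs)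
  obtain ⟨n₃, hn₃⟩ := eventually_atTop.1
    (eventually_mul_log_div_sqrt_le (C₂ + 2) (ε := δ / 4) (by positivity))
  refine ⟨A₂ * (1 + Real.sqrt (γ + p) + (C₂ + 2)) + C₁ * (1 + p) + p * U, by positivity,
    D₁ + 3 ^ p, by positivity, max (max n₁ n₂) (max n₃ 3),
    fun n hn m hm d hd hdδ hreg J _ _ hmJ Ω _ P _ ξ hξ hlaw hind => ?_⟩
  have hn1 : n₁ ≤ n := (le_max_left _ _).trans ((le_max_left _ _).trans hn)
  have hn2 : n₂ ≤ n := (le_max_right _ _).trans ((le_max_left _ _).trans hn)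
  have hn3 : n₃ ≤ n := (le_max_left _ _).trans ((le_max_right _ _).trans hn)
  have hn4 : 3 ≤ n := (le_max_right _ _).trans ((le_max_right _ _).trans hn)
  have hl := one_le_log_of_three_le hn4
  have hnpos : 0 < n := by omega
  have hn0 : (0 : ℝ) < n := by exact_mod_cast hnpos
  have hn1' : (1 : ℝ) ≤ n := by exact_mod_cast hnpos
  have hs : 0 < Real.sqrt n := Real.sqrt_pos.2 hn0
  have hm0 : (0 : ℝ) < m := by exact_mod_cast hm
  have hN : (0 : ℝ) < Fintype.card J := by exact_mod_cast Fintype.card_pos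
  have hmJ' : (m : ℝ) ≤ 2 * Fintype.card J := by exact_mod_cast hmJ
  set N : ℝ := (Fintype.card J : ℝ) with hNdef
  set ℓ := Real.log n with hℓ
  set h := Real.sqrt ((γ + p) * (ℓ / m)) with hh
  have hh0 : 0 ≤ h := Real.sqrt_nonneg _
  have hhs : h = Real.sqrt (γ + p) * Real.sqrt (ℓ / m) := Real.sqrt_mul (by positivity) _
  have hhsq : h ^ 2 = (γ + p) * (ℓ / m) := Real.sq_sqrt (by positivity)
  -- The excess is d, as required, plus h for the Hoeffding deviation, plus a term covering the
  -- Berry–Esseen error and the fraction 1/√n of nonlinear blocks. The assumptions on d, h and n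
  -- keep it below 1/2 − δ/2.
  set x := d + h + (C₂ + 2) * (ℓ / Real.sqrt n) with hx
  have hlog3 := hn₃ n hn3
  have hx0 : 0 ≤ x := by positivity
  have hxx : x ≤ 1 / 2 - δ / 2 := by rw [hx]; linarith
  set B := nonlinearSet M P₀ θs C₁ n with hB
  set Aset : (Fin p → Fin (2 * n + 1)) → Set (Fin n → 𝒳) := fun k =>
    {y | ∑ i, M.grad θs (y i) (gridPoint n k) ≤ A₂ * x * Real.sqrt n} with hAset
  set Q := Measure.pi fun _ : Fin n => P₀ with hQ
  have hAm : ∀ k, MeasurableSet (Aset k) := fun k => by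
    refine measurableSet_le (Finset.measurable_sum _ fun i _ => ?_) measurable_const
    exact (subExp_grad hsm hg hin _).measurable.comp (measurable_pi_apply i)
  set E₁ := {ω | 1 / Real.sqrt n * N ≤ hitCount ξ B ω} with hE₁
  set E₂ : (Fin p → Fin (2 * n + 1)) → Set Ω := fun k =>
    {ω | hitCount ξ (Aset k) ω ≤ (Q.real (Aset k) - h) * N} with hE₂
  have hPE₁ : P.real E₁ ≤ D₁ * (n : ℝ) ^ (-γ) :=
    measure_hitCount_nonlinearSet_le hnpos hD₁.le (hbad n hn1) hξ hlaw
  have hPE₂ : ∀ k, P.real (E₂ k) ≤ (n : ℝ) ^ (-(γ + p)) := by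
    intro k
    refine (measure_hitCount_le_le_exp hξ hlaw hind (hAm k) hh0).trans ?_
    rw [Real.rpow_def_of_pos hn0, ← hℓ]
    refine Real.exp_le_exp.2 ?_
    -- At least half the blocks are good, so 2h²N ≥ h²m = (γ + p) log n; the p log n pays for the
    -- union over the grid.
    have : (γ + p) * ℓ ≤ 2 * h ^ 2 * N := by
      rw [hhsq]
      calc (γ + p) * ℓ = (γ + p) * (ℓ / m) * m := by field_simp
        _ ≤ (γ + p) * (ℓ / m) * (2 * N) := by gcongr
        _ = _ := by ring
    rw [← hNdef]
    linarith
  have hPU : P.real (⋃ k, E₂ k) ≤ 3 ^ p * (n : ℝ) ^ (-γ) := by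
    refine (measureReal_iUnion_fintype_le _).trans ?_
    refine (Finset.sum_le_sum fun k _ => hPE₂ k).trans ?_
    rw [Finset.sum_const, Finset.card_univ, Fintype.card_fun, Fintype.card_fin, Fintype.card_fin,
      nsmul_eq_mul]
    push_cast
    calc (2 * (n : ℝ) + 1) ^ p * (n : ℝ) ^ (-(γ + p)) ≤ (3 * (n : ℝ)) ^ p * (n : ℝ) ^ (-(γ + p)) := by
          gcongr; linarith
      _ = 3 ^ p * ((n : ℝ) ^ (-(γ + p)) * (n : ℝ) ^ p) := by rw [mul_pow]; ring
      _ = 3 ^ p * (n : ℝ) ^ (-γ) := by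
          rw [← Real.rpow_natCast (n : ℝ) p, ← Real.rpow_add hn0]
          congr 2; ring
  refine le_trans (measureReal_mono (s₂ := E₁ ∪ ⋃ k, E₂ k) ?_) ?_
  swap
  · refine (measureReal_union_le _ _).trans ?_
    linarith
  intro ω hω
  by_contra hcon
  refine hω fun θhat hθhat => isBalanced_of_norm_eq_one (by linarith) fun w hw => ?_
  simp only [mem_union, mem_iUnion, not_or, not_exists] at hcon
  obtain ⟨k, hk⟩ := exists_norm_sub_gridPoint_le hnpos hw
  set w' := gridPoint n k with hw'
  have hpn : (p : ℝ) / n ≤ p := div_le_self (by positivity) hn1'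
  have hw'n : ‖w'‖ ≤ 1 + p := by
    have := norm_sub_norm_le w' w
    rw [norm_sub_rev, hw] at this
    linarith
  have h1 : hitCount ξ B ω < 1 / Real.sqrt n * N := not_le.1 hcon.1
  have h2 : (Q.real (Aset k) - h) * N < hitCount ξ (Aset k) ω := not_le.1 (hcon.2 k)
  have h3 := hsum n hn2 w' hw'n x hx0 hxx
  have h4 : 1 / Real.sqrt n ≤ ℓ / Real.sqrt n := by gcongr
  have hcount : (1 / 2 + d) * N < hitCount ξ (Aset k) ω - hitCount ξ B ω := by
    have h5 : 1 / 2 + d + 1 / Real.sqrt n ≤ Q.real (Aset k) - h := by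
      have : C₂ * ℓ / Real.sqrt n = C₂ * (ℓ / Real.sqrt n) := by ring
      have : 0 ≤ ℓ / Real.sqrt n := by positivity
      change _ ≤ Q.real (Aset k) at h3
      rw [hx] at h3
      linarith
    have h6 := mul_le_mul_of_nonneg_right h5 hN.le
    linarith
  refine hcount.trans_le (hitCount_sub_le_card fun j hjA hjB => ?_)
  have hlin := not_not.1 hjB (θhat j) (hθhat j) w'
  have hjA' : ∑ i, M.grad θs (ξ j ω i) w' ≤ A₂ * x * Real.sqrt n := hjA
  set u := matrixCLM (M.fisher P₀ θs) (θhat j - θs) with hu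
  have hsplit : inner ℝ w u = inner ℝ w' u + inner ℝ (w - w') u := by
    rw [← inner_add_left]; congr 1; abel
  -- Boundedness of Θ controls the change of direction deterministically, by O(1/n).
  have hin2 : inner ℝ (w - w') u ≤ p / n * U :=
    (real_inner_le_norm _ _).trans (mul_le_mul hk (hUb _ (hθhat j).1) (norm_nonneg _) (by positivity))
  have hin1 : inner ℝ w' u ≤ (n : ℝ)⁻¹ * (A₂ * x * Real.sqrt n) + C₁ * (ℓ / n) * (1 + p) := by
    have a1 := (abs_le.1 hlin).2
    have a2 := mul_le_mul_of_nonneg_left hjA' (inv_nonneg.2 hn0.le)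
    have a3 := mul_le_mul_of_nonneg_left hw'n (by positivity : 0 ≤ C₁ * (ℓ / n))
    linarith
  have hnn : (n : ℝ) = Real.sqrt n * Real.sqrt n := (Real.mul_self_sqrt hn0.le).symm
  have e1 : (n : ℝ)⁻¹ * (A₂ * x * Real.sqrt n) = A₂ * x / Real.sqrt n := inv_mul_mul_sqrt hn0 _
  have e2 : C₁ * (ℓ / n) * (1 + p) = (C₁ * (1 + p)) * (ℓ / Real.sqrt n) / Real.sqrt n := by
    have : ℓ / n = ℓ / Real.sqrt n / Real.sqrt n := by rw [div_div, ← hnn]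
    rw [this]; ring
  have e3 : (p : ℝ) / n * U ≤ p * U * (ℓ / Real.sqrt n) / Real.sqrt n := by
    have : ℓ / Real.sqrt n / Real.sqrt n = ℓ / n := by rw [div_div, ← hnn]
    calc (p : ℝ) / n * U = p * U * (1 / n) := by ring
      _ ≤ p * U * (ℓ / n) := by gcongr
      _ = _ := by rw [← this]; ring
  have hb0 : 0 ≤ Real.sqrt (ℓ / m) := Real.sqrt_nonneg _
  have hfin := combined_bound_le hA₂.le (Real.sqrt_nonneg (γ + p)) (by positivity : 0 ≤ C₂ + 2)
    (by positivity : 0 ≤ C₁ * (1 + p)) (by positivity : 0 ≤ p * U) hd hb0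
    (by positivity : 0 ≤ ℓ / Real.sqrt n) hs
  rw [← hhs, ← hx] at hfin
  rw [hsplit]
  linarith

end BayesModel


/-- Take logarithms: the terms without K are at most m log(2D) ≤ Cℓ log(2D), while the remaining one
gains at least cKδℓ/8 because N ≥ m/2. The choice of K leaves −γℓ. -/
lemma two_pow_mul_rpow_le {D c δ γ K C ℓ m N : ℝ} {k : ℕ} (hk : (k : ℝ) = N) (hD : 1 ≤ D)
    (hc : 0 < c) (hδ : 0 < δ) (hδ' : δ ≤ 1) (hℓ : 0 < ℓ) (hm : 0 < m) (hN : N ≤ m)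
    (hmN : m ≤ 2 * N) (hmℓ : m ≤ C * ℓ) (hK : 0 ≤ K)
    (hKeq : c * K * δ / 8 = γ + C * Real.log (2 * D)) :
    2 ^ k * (D * Real.exp (-c * (K * (ℓ / m)))) ^ (δ * N / 4) ≤ Real.exp (-γ * ℓ) := by
  have hL : 0 ≤ Real.log D := Real.log_nonneg hD
  have h2 : (0 : ℝ) ≤ Real.log 2 := Real.log_nonneg (by norm_num)
  have hN0 : 0 ≤ N := by linarith
  rw [← Real.rpow_natCast, hk, Real.rpow_def_of_pos (by norm_num : (0 : ℝ) < 2),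
    Real.rpow_def_of_pos (by positivity), ← Real.exp_add,
    Real.log_mul (by positivity) (Real.exp_pos _).ne', Real.log_exp]
  refine Real.exp_le_exp.2 ?_
  have a1 : Real.log 2 * N ≤ Real.log 2 * m := mul_le_mul_of_nonneg_left hN h2
  have a2 : Real.log D * (δ * N / 4) ≤ Real.log D * m := by
    refine mul_le_mul_of_nonneg_left ?_ hL
    nlinarith
  have a3 : c * K * δ / 8 * ℓ ≤ c * (K * (ℓ / m)) * (δ * N / 4) := by
    calc c * K * δ / 8 * ℓ = c * (K * (ℓ / m)) * δ / 8 * m := by field_simp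
      _ ≤ c * (K * (ℓ / m)) * δ / 8 * (2 * N) := by gcongr
      _ = _ := by ring
  have a4 : Real.log (2 * D) = Real.log 2 + Real.log D :=
    Real.log_mul (by norm_num) (by linarith)
  have a5 : (Real.log 2 + Real.log D) * m ≤ (Real.log 2 + Real.log D) * (C * ℓ) :=
    mul_le_mul_of_nonneg_left hmℓ (by linarith)
  rw [hKeq, a4] at a3
  nlinarith

namespace BayesModel

variable {p : ℕ} {𝒳 : Type*} [MeasurableSpace 𝒳] {M : BayesModel p 𝒳}
  {P₀ : Measure 𝒳} [IsProbabilityMeasure P₀] {θs : EuclideanSpace ℝ (Fin p)}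

/-- Balancedness of the block estimators when the number of blocks is at most of order `log n`. -/
theorem exists_measure_not_isBalanced_le_of_le_log (hsm : M.SmoothCond) (hg : M.GradCond P₀)
    (hθs : M.IsTrueParam P₀ θs) (hgr : M.GrowthCond P₀ θs) {δ γ C₄ : ℝ} (hδ : 0 < δ)
    (hδ' : δ ≤ 1 / 2) (hγ : 0 < γ) (hC₄ : 0 < C₄) :
    ∃ A : ℝ, 0 ≤ A ∧ ∃ D : ℝ, 0 ≤ D ∧ ∃ n₀ : ℕ, ∀ n ≥ n₀, ∀ m : ℕ, 1 ≤ m → ∀ d : ℝ, 0 ≤ d →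
      d ≤ 1 / 2 - δ → (m : ℝ) ≤ C₄ * Real.log n →
      ∀ {J : Type*} [Fintype J] [Nonempty J], Fintype.card J ≤ m → m ≤ 2 * Fintype.card J →
      ∀ {Ω : Type*} [MeasurableSpace Ω] {P : Measure Ω} [IsProbabilityMeasure P]
        {ξ : J → Ω → Fin n → 𝒳}, (∀ j, Measurable (ξ j)) →
        (∀ j, P.map (ξ j) = Measure.pi fun _ : Fin n => P₀) → iIndepFun ξ P →
        P.real {ω | ¬ ∀ θhat : J → EuclideanSpace ℝ (Fin p),
          (∀ j, M.IsLocalMax (ξ j ω) (θhat j)) → IsBalanced (M.fisher P₀ θs) θs d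
            (A / Real.sqrt n * (d + Real.sqrt (Real.log n / m) + Real.log n / Real.sqrt n)) θhat} ≤
          D * (n : ℝ) ^ (-γ) := by
  have hin := hθs.mem_interior
  obtain ⟨D₁, hD₁, C₁, hC₁, n₁, hbad⟩ :=
    exists_measure_not_linear_le hsm hg hθs hgr (κ := γ + 1) (by linarith)
  obtain ⟨D₃, hD₃, c₃, hc₃, htail⟩ := exists_measure_exists_sum_ge_le
    (μ := P₀) (Y := fun (k : Fin p) x => M.grad θs x (stdVec k)) Finset.univ
    fun k _ => subExp_grad hsm hg hin (stdVec k)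
  set D := max D₃ 1 with hD
  have hD1 : 1 ≤ D := le_max_right _ _
  have hL : 0 ≤ Real.log (2 * D) := Real.log_nonneg (by linarith)
  set K := 8 * (γ + C₄ * Real.log (2 * D)) / (c₃ * δ) with hK
  have hK0 : 0 ≤ K := by positivity
  have hKeq : c₃ * K * δ / 8 = γ + C₄ * Real.log (2 * D) := by rw [hK]; field_simp
  obtain ⟨n₂, hn₂⟩ := eventually_atTop.1
    (eventually_mul_sqrt_log_le (Real.sqrt K) (ε := c₃) hc₃)
  obtain ⟨n₃, hn₃⟩ := eventually_atTop.1
    (eventually_mul_log_div_sqrt_le 1 (ε := δ / 4) (by positivity))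
  refine ⟨p * Real.sqrt K + C₁, by positivity, D₁ + 1, by positivity, max (max n₁ n₂) (max n₃ 3),
    fun n hn m hm d hd hdδ hreg J _ _ hJm hmJ Ω _ P _ ξ hξ hlaw hind => ?_⟩
  have hn1 : n₁ ≤ n := (le_max_left _ _).trans ((le_max_left _ _).trans hn)
  have hn2 : n₂ ≤ n := (le_max_right _ _).trans ((le_max_left _ _).trans hn)
  have hn3 : n₃ ≤ n := (le_max_left _ _).trans ((le_max_right _ _).trans hn)
  have hn4 : 3 ≤ n := (le_max_right _ _).trans ((le_max_right _ _).trans hn)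
  have hl := one_le_log_of_three_le hn4
  have hnpos : 0 < n := by omega
  have hn0 : (0 : ℝ) < n := by exact_mod_cast hnpos
  have hs : 0 < Real.sqrt n := Real.sqrt_pos.2 hn0
  have hm1 : (1 : ℝ) ≤ m := by exact_mod_cast hm
  have hm0 : (0 : ℝ) < m := by linarith
  have hN : (0 : ℝ) < Fintype.card J := by exact_mod_cast Fintype.card_pos
  have hmJ' : (m : ℝ) ≤ 2 * Fintype.card J := by exact_mod_cast hmJ
  have hJm' : (Fintype.card J : ℝ) ≤ m := by exact_mod_cast hJm
  set N : ℝ := (Fintype.card J : ℝ) with hNdef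
  set ℓ := Real.log n with hℓ
  have hℓ0 : 0 < ℓ := by linarith
  set B := nonlinearSet M P₀ θs C₁ n with hB
  set r := Real.sqrt K * Real.sqrt (ℓ / m) with hr
  have hr0 : 0 ≤ r := by positivity
  have hr2 : r ^ 2 = K * (ℓ / m) := by
    rw [hr, mul_pow, Real.sq_sqrt hK0, Real.sq_sqrt (by positivity)]
  have hrle : r ≤ c₃ * Real.sqrt n := by
    refine le_trans ?_ (hn₂ n hn2)
    exact mul_le_mul_of_nonneg_left (Real.sqrt_le_sqrt (div_le_self hℓ0.le hm1))
      (Real.sqrt_nonneg _)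
  -- With so few blocks the central limit theorem is not needed: the scale √(log n / m) is bounded
  -- below, and it suffices that all but a fraction δ/4 of the blocks have every score coordinate
  -- below r√n.
  set S : Set (Fin n → 𝒳) := {y | ∃ k : Fin p, r * Real.sqrt n ≤ |∑ i, M.grad θs (y i) (stdVec k)|}
    with hS
  have hQS : (Measure.pi fun _ : Fin n => P₀).real S ≤ D * Real.exp (-c₃ * (K * (ℓ / m))) := by
    have h := htail n r hr0 hrle
    simp only [integral_grad_eq_zero hsm hg hθs, sub_zero, Finset.mem_univ, true_and] at h
    rw [hr2] at h
    exact h.trans (mul_le_mul_of_nonneg_right (le_max_left _ _) (Real.exp_pos _).le)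
  have hP1 : P.real {ω | 1 / Real.sqrt n * N ≤ hitCount ξ B ω} ≤ D₁ * (n : ℝ) ^ (-γ) :=
    measure_hitCount_nonlinearSet_le hnpos hD₁.le (hbad n hn1) hξ hlaw
  have hP2 : P.real {ω | δ * N / 4 ≤ hitCount ξ S ω} ≤ (n : ℝ) ^ (-γ) := by
    refine (measure_hitCount_ge_le_rpow hξ hlaw hind hQS (by positivity) (by positivity)).trans ?_
    refine (two_pow_mul_rpow_le hNdef.symm hD1 hc₃ hδ (by linarith) hℓ0 hm0 hJm' hmJ' hreg hK0
      hKeq).trans_eq ?_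
    rw [Real.rpow_def_of_pos hn0, ← hℓ, mul_comm]
  refine le_trans (measureReal_mono (s₂ := {ω | 1 / Real.sqrt n * N ≤ hitCount ξ B ω} ∪
    {ω | δ * N / 4 ≤ hitCount ξ S ω}) ?_) ?_
  swap
  · refine (measureReal_union_le _ _).trans ?_
    linarith
  intro ω hω
  by_contra hcon
  refine hω fun θhat hθhat => isBalanced_of_norm_eq_one (by linarith) fun w hw => ?_
  rw [mem_union, not_or] at hcon
  have h1 : hitCount ξ B ω < 1 / Real.sqrt n * N := not_le.1 hcon.1
  have h2 : hitCount ξ S ω < δ * N / 4 := not_le.1 hcon.2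
  have h3 : 1 / Real.sqrt n ≤ ℓ / Real.sqrt n := by gcongr
  have h4 := hn₃ n hn3
  rw [one_mul, ← hℓ] at h4
  -- Since 1/2 + d ≤ 1 − δ, two exceptional fractions of at most δ/4 each can be discarded.
  have hcount : (1 / 2 + d) * N < hitCount ξ Sᶜ ω - hitCount ξ B ω := by
    rw [hitCount_compl, ← hNdef]
    have h5 : 1 / Real.sqrt n * N ≤ δ / 4 * N := mul_le_mul_of_nonneg_right (h3.trans h4) hN.le
    have h6 : (1 / 2 + d) * N ≤ (1 - δ) * N := mul_le_mul_of_nonneg_right (by linarith) hN.le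
    nlinarith
  refine hcount.trans_le (hitCount_sub_le_card fun j hjS hjB => ?_)
  have hlin := (abs_le.1 (not_not.1 hjB (θhat j) (hθhat j) w)).2
  rw [hw, mul_one] at hlin
  have hjS' : ∀ k : Fin p, ‖(∑ i, M.grad θs (ξ j ω i)) (stdVec k)‖ ≤ r * Real.sqrt n := by
    intro k
    rw [sum_apply, Real.norm_eq_abs]
    by_contra hk
    exact hjS ⟨k, (not_le.1 hk).le⟩
  have hT := norm_le_of_forall_stdVec _ hjS'
  have hsum : ∑ i, M.grad θs (ξ j ω i) w ≤ p * (r * Real.sqrt n) := by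
    have := (∑ i, M.grad θs (ξ j ω i)).le_opNorm w
    rw [hw, mul_one, sum_apply] at this
    exact (le_abs_self _).trans (this.trans hT)
  have e1 : (n : ℝ)⁻¹ * ∑ i, M.grad θs (ξ j ω i) w ≤ p * r / Real.sqrt n := by
    rw [← inv_mul_mul_sqrt hn0, mul_assoc]
    exact mul_le_mul_of_nonneg_left hsum (inv_nonneg.2 hn0.le)
  have e2 : C₁ * (ℓ / n) = C₁ * (ℓ / Real.sqrt n) / Real.sqrt n := by
    have : ℓ / n = ℓ / Real.sqrt n / Real.sqrt n := by rw [div_div, Real.mul_self_sqrt hn0.le]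
    rw [this]; ring
  have hfin := combined_bound_le (zero_le_one : (0:ℝ) ≤ 1) le_rfl le_rfl
    (by positivity : 0 ≤ p * Real.sqrt K) hC₁.le hd (Real.sqrt_nonneg (ℓ / m))
    (by positivity : 0 ≤ ℓ / Real.sqrt n) hs
  set a := ℓ / Real.sqrt n
  set b := Real.sqrt (ℓ / m)
  have ha : 0 ≤ a := by positivity
  have hb : 0 ≤ b := Real.sqrt_nonneg _
  calc inner ℝ w (matrixCLM (M.fisher P₀ θs) (θhat j - θs))
      ≤ p * r / Real.sqrt n + C₁ * a / Real.sqrt n := by linarith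
    _ = (p * Real.sqrt K * b + C₁ * a) / Real.sqrt n := by rw [hr]; ring
    _ ≤ ((p * Real.sqrt K + C₁) * (d + b + a)) / Real.sqrt n := by
      refine div_le_div_of_nonneg_right ?_ hs.le
      have : 0 ≤ p * Real.sqrt K * (d + a) + C₁ * (d + b) := by positivity
      linarith
    _ = _ := by ring

/-- With probability at least `1 - O(n^{-γ})` the block estimators are balanced, at the optimal scale. -/
theorem exists_measure_not_isBalanced_le (hsm : M.SmoothCond) (hg : M.GradCond P₀)
    (hθs : M.IsTrueParam P₀ θs) (hgr : M.GrowthCond P₀ θs) {δ γ : ℝ} (hδ : 0 < δ)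
    (hδ' : δ ≤ 1 / 2) (hγ : 0 < γ) :
    ∃ A : ℝ, 0 ≤ A ∧ ∃ D : ℝ, 0 ≤ D ∧ ∃ n₀ : ℕ, ∀ n ≥ n₀, ∀ m : ℕ, 1 ≤ m → ∀ d : ℝ, 0 ≤ d →
      d ≤ 1 / 2 - δ →
      ∀ {J : Type*} [Fintype J] [Nonempty J], Fintype.card J ≤ m → m ≤ 2 * Fintype.card J →
      ∀ {Ω : Type*} [MeasurableSpace Ω] {P : Measure Ω} [IsProbabilityMeasure P]
        {ξ : J → Ω → Fin n → 𝒳}, (∀ j, Measurable (ξ j)) →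
        (∀ j, P.map (ξ j) = Measure.pi fun _ : Fin n => P₀) → iIndepFun ξ P →
        P.real {ω | ¬ ∀ θhat : J → EuclideanSpace ℝ (Fin p),
          (∀ j, M.IsLocalMax (ξ j ω) (θhat j)) → IsBalanced (M.fisher P₀ θs) θs d
            (A / Real.sqrt n * (d + Real.sqrt (Real.log n / m) + Real.log n / Real.sqrt n)) θhat} ≤
          D * (n : ℝ) ^ (-γ) := by
  obtain ⟨A, hA, D, hD, n₁, h1⟩ :=
    exists_measure_not_isBalanced_le_of_log_le hsm hg hθs hgr hδ hδ' hγ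
  -- This C₄ makes the regimes complementary: √((γ + p) log n / m) > δ/4 means m < C₄ log n.
  obtain ⟨A', hA', D', hD', n₂, h2⟩ := exists_measure_not_isBalanced_le_of_le_log hsm hg hθs hgr
    (C₄ := 16 * (γ + p) / δ ^ 2) hδ hδ' hγ (by positivity)
  refine ⟨max A A', hA.trans (le_max_left _ _), max D D', hD.trans (le_max_left _ _), max n₁ (max n₂ 1),
    fun n hn m hm d hd hdδ J _ _ hJm hmJ Ω _ P _ ξ hξ hlaw hind => ?_⟩
  have hn1 : n₁ ≤ n := (le_max_left _ _).trans hn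
  have hn2 : n₂ ≤ n := (le_max_left _ _).trans ((le_max_right _ _).trans hn)
  have hn3 : (1 : ℝ) ≤ n := by
    exact_mod_cast (le_max_right _ _).trans ((le_max_right _ _).trans hn)
  have hm0 : (0 : ℝ) < m := by exact_mod_cast hm
  have hlog : 0 ≤ Real.log n := Real.log_nonneg hn3
  have hpow : 0 ≤ (n : ℝ) ^ (-γ) := Real.rpow_nonneg (by linarith) _
  have key : ∀ a ≤ max A A', ∀ ω, (¬ ∀ θhat : J → EuclideanSpace ℝ (Fin p),
      (∀ j, M.IsLocalMax (ξ j ω) (θhat j)) → IsBalanced (M.fisher P₀ θs) θs d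
        (max A A' / Real.sqrt n *
          (d + Real.sqrt (Real.log n / m) + Real.log n / Real.sqrt n)) θhat) →
      ¬ ∀ θhat : J → EuclideanSpace ℝ (Fin p),
      (∀ j, M.IsLocalMax (ξ j ω) (θhat j)) → IsBalanced (M.fisher P₀ θs) θs d
        (a / Real.sqrt n * (d + Real.sqrt (Real.log n / m) + Real.log n / Real.sqrt n)) θhat := by
    intro a ha ω hω hcon
    refine hω fun θhat hθ => (hcon θhat hθ).mono ?_
    gcongr
  rcases le_or_gt (Real.sqrt ((γ + p) * (Real.log n / m))) (δ / 4) with hreg | hreg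
  · refine (measureReal_mono fun ω hω => key A (le_max_left _ _) ω hω).trans
      ((h1 n hn1 m hm d hd hdδ hreg hmJ hξ hlaw hind).trans ?_)
    exact mul_le_mul_of_nonneg_right (le_max_left _ _) hpow
  · refine (measureReal_mono fun ω hω => key A' (le_max_right _ _) ω hω).trans
      ((h2 n hn2 m hm d hd hdδ ?_ hJm hmJ hξ hlaw hind).trans ?_)
    · have h := (Real.lt_sqrt (by positivity)).1 hreg
      rw [← mul_div_assoc, lt_div_iff₀ hm0] at h
      rw [div_mul_eq_mul_div, le_div_iff₀ (by positivity)]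
      nlinarith
    · exact mul_le_mul_of_nonneg_right (le_max_right _ _) hpow

end BayesModel


/-! ### Quantiles and the min-max argument -/

lemma quantile_le {ι : Type*} {τ t : ℝ} {s : Finset ι} {x : ι → ℝ} (hτ : 0 < τ) (hs : s.Nonempty)
    (h : τ * (s.card : ℝ) ≤ ((s.filter fun j => x j ≤ t).card : ℝ)) : quantile τ s x ≤ t := by
  -- The infimum needs a lower bound: τ > 0 forces every t' in the set to dominate at least one
  -- value, hence the minimum.
  refine csInf_le ⟨s.inf' hs x, fun t' ht' => ?_⟩ h
  have hpos : (0 : ℝ) < τ * s.card := mul_pos hτ (by exact_mod_cast hs.card_pos)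
  have hc : 0 < (s.filter fun j => x j ≤ t').card := by exact_mod_cast hpos.trans_le ht'
  obtain ⟨j, hj⟩ := Finset.card_pos.1 hc
  rw [Finset.mem_filter] at hj
  exact (Finset.inf'_le x hj.1).trans hj.2

lemma le_quantile {ι : Type*} {τ t : ℝ} {s : Finset ι} {x : ι → ℝ} (hτ : τ ≤ 1) (hs : s.Nonempty)
    (h : ((s.filter fun j => x j < t).card : ℝ) < τ * (s.card : ℝ)) : t ≤ quantile τ s x := by
  -- Nonemptiness: τ ≤ 1 puts the maximum of the values in the set.
  refine le_csInf ⟨s.sup' hs x, ?_⟩ fun t' ht' => ?_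
  · have : (s.filter fun j => x j ≤ s.sup' hs x) = s :=
      Finset.filter_true_of_mem fun j hj => Finset.le_sup' x hj
    rw [mem_ofPred_eq, this]
    exact mul_le_of_le_one_left (Nat.cast_nonneg _) hτ
  · by_contra hlt
    have hsub : (s.filter fun j => x j ≤ t') ⊆ s.filter fun j => x j < t := fun j hj => by
      rw [Finset.mem_filter] at hj ⊢
      exact ⟨hj.1, hj.2.trans_lt (not_le.1 hlt)⟩
    have h1 : ((s.filter fun j => x j ≤ t').card : ℝ) ≤ ((s.filter fun j => x j < t).card : ℝ) :=
      Nat.cast_le.2 (Finset.card_le_card hsub)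
    exact absurd (le_trans ht' h1) (not_le.2 h)

section MinMax

variable {p m : ℕ} {H : Matrix (Fin p) (Fin p) ℝ} {θs : EuclideanSpace ℝ (Fin p)}
  {B : Finset (Fin m)} {θhat : Fin m → EuclideanSpace ℝ (Fin p)} {d ε ρ τ : ℝ}

lemma IsBalanced.count_compl
    (hbal : IsBalanced H θs d ε fun j : {j : Fin m // j ∉ B} => θhat j)
    (v : EuclideanSpace ℝ (Fin p)) : (1 / 2 + d) * (Bᶜ.card : ℝ) <
      ((Bᶜ.filter fun j => inner ℝ v (matrixCLM H (θhat j - θs)) ≤ ‖v‖ * ε).card : ℝ) := by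
  have h := hbal v
  have hmem : ∀ j, j ∈ Bᶜ ↔ j ∉ B := fun j => Finset.mem_compl
  rw [Finset.card_filter, Finset.sum_subtype Bᶜ hmem, ← Finset.card_filter]
  rwa [Fintype.card_of_subtype Bᶜ hmem] at h

lemma quadForm_sub_sub (hH : H.IsHermitian) (a u : EuclideanSpace ℝ (Fin p)) :
    quadForm H (a - u) = quadForm H a - 2 * inner ℝ a (matrixCLM H u) + quadForm H u := by
  simp only [quadForm_eq_inner, map_sub, inner_sub_left, inner_sub_right]
  have : inner ℝ u (matrixCLM H a) = inner ℝ a (matrixCLM H u) := by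
    rw [inner_matrixCLM_comm H hH, real_inner_comm]
  rw [this]
  ring

/-- With v = θg − θ⋆ the jth value is 2vᵀHuⱼ − vᵀHv. On the more than 1/2 + d ≥ τ balanced blocks it
is at most 2‖v‖ε − ρ‖v‖², whose maximum over ‖v‖ is ε²/ρ. -/
lemma lossQuantile_center_le (hH : H.IsHermitian) (hρ : 0 < ρ)
    (hq : ∀ v, ρ * ‖v‖ ^ 2 ≤ quadForm H v) (hB : Bᶜ.Nonempty) (hτ : 0 < τ) (hτd : τ ≤ 1 / 2 + d)
    (hbal : IsBalanced H θs d ε fun j : {j : Fin m // j ∉ B} => θhat j)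
    (θg : EuclideanSpace ℝ (Fin p)) : lossQuantile H B θhat τ θs θg ≤ ε ^ 2 / ρ := by
  refine quantile_le hτ hB ?_
  have h := hbal.count_compl (θg - θs)
  refine (mul_le_mul_of_nonneg_right hτd (Nat.cast_nonneg _)).trans (h.le.trans
    (Nat.cast_le.2 (Finset.card_le_card fun j hj => ?_)))
  rw [Finset.mem_filter] at hj ⊢
  refine ⟨hj.1, ?_⟩
  have e1 := quadForm_sub_sub hH (θg - θs) (θhat j - θs)
  have e2 := quadForm_sub_sub hH 0 (θhat j - θs)
  rw [sub_sub_sub_cancel_right] at e1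
  rw [zero_sub, neg_sub, inner_zero_left] at e2
  have e3 : quadForm H 0 = 0 := by simp [quadForm_eq_inner]
  rw [e1, e2, e3, le_div_iff₀ hρ]
  have h1 := hq (θg - θs)
  have h2 := hj.2
  have h3 : ρ * (ρ * ‖θg - θs‖ ^ 2) ≤ ρ * quadForm H (θg - θs) := mul_le_mul_of_nonneg_left h1 hρ.le
  have h4 := mul_le_mul_of_nonneg_left h2 hρ.le
  nlinarith [sq_nonneg (ρ * ‖θg - θs‖ - ε)]

/-- With v = θf − θ⋆ the jth value is vᵀHv − 2vᵀHuⱼ. It can fall below the bound only on unbalanced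
blocks, whose fraction is less than 1/2 − d ≤ τ. -/
lemma le_lossQuantile_center (hH : H.IsHermitian)
    (hq : ∀ v, ρ * ‖v‖ ^ 2 ≤ quadForm H v) (hB : Bᶜ.Nonempty) (hτ : τ ≤ 1) (hτd : 1 / 2 - d ≤ τ)
    (hbal : IsBalanced H θs d ε fun j : {j : Fin m // j ∉ B} => θhat j)
    (θf : EuclideanSpace ℝ (Fin p)) :
    ρ * ‖θf - θs‖ ^ 2 - 2 * (‖θf - θs‖ * ε) ≤ lossQuantile H B θhat τ θf θs := by
  refine le_quantile hτ hB ?_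
  have h := hbal.count_compl (θf - θs)
  have hsplit := Finset.card_filter_add_card_filter_not (s := Bᶜ)
    (fun j => inner ℝ (θf - θs) (matrixCLM H (θhat j - θs)) ≤ ‖θf - θs‖ * ε)
  have hsplit' : ((Bᶜ.filter fun j =>
      inner ℝ (θf - θs) (matrixCLM H (θhat j - θs)) ≤ ‖θf - θs‖ * ε).card : ℝ) +
      ((Bᶜ.filter fun j =>
      ¬ inner ℝ (θf - θs) (matrixCLM H (θhat j - θs)) ≤ ‖θf - θs‖ * ε).card : ℝ) = Bᶜ.card := by
    exact_mod_cast hsplit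
  have hle : (((Bᶜ.filter fun j => quadForm H (θf - θhat j) - quadForm H (θs - θhat j) <
      ρ * ‖θf - θs‖ ^ 2 - 2 * (‖θf - θs‖ * ε)).card : ℕ) : ℝ) ≤ ((Bᶜ.filter fun j =>
      ¬ inner ℝ (θf - θs) (matrixCLM H (θhat j - θs)) ≤ ‖θf - θs‖ * ε).card : ℝ) := by
    refine Nat.cast_le.2 (Finset.card_le_card fun j hj => ?_)
    rw [Finset.mem_filter] at hj ⊢
    refine ⟨hj.1, fun hcon => ?_⟩
    have e1 := quadForm_sub_sub hH (θf - θs) (θhat j - θs)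
    have e2 := quadForm_sub_sub hH 0 (θhat j - θs)
    rw [sub_sub_sub_cancel_right] at e1
    rw [zero_sub, neg_sub, inner_zero_left] at e2
    have e3 : quadForm H 0 = 0 := by simp [quadForm_eq_inner]
    have h5 := hj.2
    rw [e1, e2, e3] at h5
    linarith [hq (θf - θs)]
  have h6 := mul_le_mul_of_nonneg_right hτd (Nat.cast_nonneg (α := ℝ) Bᶜ.card)
  linarith

/-- On the event that the block estimators are balanced, the min-max estimator is close to the
centre, with small worst-case loss. -/
lemma IsMinMaxEstimator.norm_sub_le_and_worstLoss_le {T : Set (EuclideanSpace ℝ (Fin p))}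
    (hH : H.IsHermitian) (hρ : 0 < ρ) (hε : 0 ≤ ε)
    (hq : ∀ v, ρ * ‖v‖ ^ 2 ≤ quadForm H v) (hB : Bᶜ.Nonempty) (hτ0 : 0 < τ) (hτ1 : τ ≤ 1)
    (hd : |τ - 1 / 2| ≤ d) (hsT : θs ∈ T)
    (hbal : IsBalanced H θs d ε fun j : {j : Fin m // j ∉ B} => θhat j)
    {θf : EuclideanSpace ℝ (Fin p)} (hθf : IsMinMaxEstimator H B θhat τ T θf) :
    ‖θf - θs‖ ≤ 3 * ε / ρ ∧ worstLoss H B θhat τ T θf ≤ ((ε ^ 2 / ρ : ℝ) : EReal) := by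
  obtain ⟨hd1, hd2⟩ := abs_le.1 hd
  have hw : worstLoss H B θhat τ T θf ≤ ((ε ^ 2 / ρ : ℝ) : EReal) := by
    refine (hθf.2 hsT).trans (iSup₂_le fun θg _ => EReal.coe_le_coe_iff.2 ?_)
    exact lossQuantile_center_le hH hρ hq hB hτ0 (by linarith) hbal θg
  refine ⟨?_, hw⟩
  have h1 : ((lossQuantile H B θhat τ θf θs : ℝ) : EReal) ≤ ((ε ^ 2 / ρ : ℝ) : EReal) :=
    (le_iSup₂ (f := fun θg (_ : θg ∈ T) => ((lossQuantile H B θhat τ θf θg : ℝ) : EReal)) θs hsT).trans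
      hw
  have h2 := (le_lossQuantile_center hH hq hB hτ1 (by linarith) hbal θf).trans
    (EReal.coe_le_coe_iff.1 h1)
  rw [le_div_iff₀ hρ] at h2
  rw [le_div_iff₀ hρ]
  -- With X = ρ‖θf − θ⋆‖ the inequality reads X² − 2εX ≤ ε², which fails for X > 3ε ≥ 0.
  by_contra hcon
  have h3 : 3 * ε < ‖θf - θs‖ * ρ := not_le.1 hcon
  nlinarith

end MinMax

lemma sq_add_add_le (a b c : ℝ) : (a + b + c) ^ 2 ≤ 3 * (a ^ 2 + b ^ 2 + c ^ 2) := by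
  nlinarith [sq_nonneg (a - b), sq_nonneg (b - c), sq_nonneg (a - c)]

end

/-! ### The theorem -/

theorem mainTheorem7 {p : ℕ} {𝒳 : Type*} [MeasurableSpace 𝒳] (M : BayesModel p 𝒳)
    (P₀ : Measure 𝒳) [IsProbabilityMeasure P₀] (θs : EuclideanSpace ℝ (Fin p))
    (hθs : M.IsTrueParam P₀ θs)
    (hprior : M.PriorCond θs) (hgrowth : M.GrowthCond P₀ θs) (hgrad : M.GradCond P₀)
    (hhess : M.HessCond P₀) (hsmooth : M.SmoothCond)
    (T : Set (EuclideanSpace ℝ (Fin p))) (hT : T = M.Θ ∨ T = Set.univ)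
    (δ : ℝ) (hδ : 0 < δ) (γ : ℝ) (hγ : 0 < γ) :
    ∃ C₁ > (0 : ℝ), ∃ C₂ > (0 : ℝ), ∃ C₃ > (0 : ℝ),
      ∀ (m n : ℕ), 1 ≤ m → 1 ≤ n →
      ∀ τ ∈ Set.Icc δ (1 - δ),
      ∀ α : ℝ, 0 ≤ α → α < 1 / 2 →
      ∀ B : Finset (Fin m), B.card = ⌊α * (m : ℝ)⌋₊ →
      ∀ (Ω : Type*) [MeasurableSpace Ω] (P : Measure Ω) [IsProbabilityMeasure P]
        (X : Fin m → Fin n → Ω → 𝒳), IsCleanSample P P₀ B X →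
        P {ω | ¬ ∀ θhat : Fin m → EuclideanSpace ℝ (Fin p),
            (∀ j, j ∉ B → M.IsLocalMax (fun i => X j i ω) (θhat j)) →
            ∀ θf, IsMinMaxEstimator (M.fisher P₀ θs) B θhat τ T θf →
              ‖θf - θs‖ ≤ C₁ / Real.sqrt n *
                (|τ - 1 / 2| + Real.sqrt (Real.log n / m) + Real.log n / Real.sqrt n) ∧
              worstLoss (M.fisher P₀ θs) B θhat τ T θf ≤
                ((C₂ / n * (|τ - 1 / 2| ^ 2 + Real.log n / m + Real.log n ^ 2 / n) : ℝ) : EReal)}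
          ≤ ENNReal.ofReal (C₃ * (n : ℝ) ^ (-γ)) := by
  -- For δ > 1/2 no τ is admissible.
  rcases lt_or_ge (1 / 2) δ with hδ2 | hδ2
  · refine ⟨1, one_pos, 1, one_pos, 1, one_pos, fun m n _ _ τ hτ => ?_⟩
    linarith [hτ.1, hτ.2]
  have hmem := interior_subset hθs.mem_interior
  have hsT : θs ∈ T := by
    rcases hT with rfl | rfl
    · exact hmem
    · exact mem_univ _
  obtain ⟨A, hA, D, hD, n₀, hmain⟩ :=
    BayesModel.exists_measure_not_isBalanced_le hsmooth hgrad hθs hgrowth hδ hδ2 hγ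
  obtain ⟨-, -, ρ, hρ, -, hspec⟩ := id hgrowth
  have hH := BayesModel.fisher_isHermitian (P₀ := P₀) hsmooth hmem
  have hq := quadForm_ge_of_spectrum (M.fisher P₀ θs) hH fun l hl => (hspec hl).1
  -- C₁ carries the 3/ρ of the min-max bound, and C₂ the 3 from squaring a sum of three terms; the
  -- added 1 ensures positivity when A = 0. The second part of C₃ makes the bound trivial for n <
  -- n₀.
  refine ⟨3 * A / ρ + 1, by positivity, 3 * A ^ 2 / ρ + 1, by positivity, D + (n₀ + 1 : ℝ) ^ γ,
    by positivity, fun m n hm hn τ hτ α hα hα2 B hBcard Ω _ P _ X hX => ?_⟩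
  have hn1 : (1 : ℝ) ≤ n := by exact_mod_cast hn
  have hn0 : (0 : ℝ) < n := by linarith
  have hm0 : (0 : ℝ) < m := by exact_mod_cast hm
  rw [← ofReal_measureReal]
  refine ENNReal.ofReal_le_ofReal ?_
  rcases lt_or_ge n n₀ with hlt | hge
  · refine measureReal_le_one.trans ?_
    have h1 : (1 : ℝ) ≤ (n₀ + 1 : ℝ) ^ γ * (n : ℝ) ^ (-γ) := by
      rw [Real.rpow_neg hn0.le, ← div_eq_mul_inv, one_le_div (by positivity)]
      refine Real.rpow_le_rpow hn0.le ?_ hγ.le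
      have : (n : ℝ) ≤ n₀ := by exact_mod_cast hlt.le
      linarith
    have h2 : 0 ≤ D * (n : ℝ) ^ (-γ) := by positivity
    linarith
  have hcardJ : Fintype.card {j : Fin m // j ∉ B} = m - B.card := by
    rw [Fintype.card_of_subtype Bᶜ fun j => Finset.mem_compl, Finset.card_compl, Fintype.card_fin]
  -- Because α < 1/2, more than half of the blocks are good; in particular there is at least one.
  have hBm : 2 * B.card < m := by
    have h1 : ((⌊α * (m : ℝ)⌋₊ : ℕ) : ℝ) ≤ α * m := Nat.floor_le (by positivity)
    rw [← hBcard] at h1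
    have h2 : 2 * (B.card : ℝ) < m := by nlinarith
    exact_mod_cast h2
  have : Nonempty {j : Fin m // j ∉ B} := Fintype.card_pos_iff.1 (by omega)
  have hBne : Bᶜ.Nonempty := by
    obtain ⟨j⟩ := this
    exact ⟨j.1, Finset.mem_compl.2 j.2⟩
  obtain ⟨hind, hrow⟩ := iIndepFun_rows (X := fun (j : {j : Fin m // j ∉ B}) i => X j i)
    (fun j i => hX.measurable j j.2 i) (fun j i => hX.law j j.2 i) hX.indep
  have hτd : |τ - 1 / 2| ≤ 1 / 2 - δ := abs_le.2 ⟨by linarith [hτ.1], by linarith [hτ.2]⟩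
  have hbound := hmain n hge m hm |τ - 1 / 2| (abs_nonneg _) hτd
    (J := {j : Fin m // j ∉ B}) (by omega) (by omega)
    (fun j => measurable_pi_iff.2 fun i => hX.measurable j j.2 i) hrow hind
  have hpow : 0 ≤ (n₀ + 1 : ℝ) ^ γ * (n : ℝ) ^ (-γ) := by positivity
  refine le_trans (le_trans (measureReal_mono ?_) hbound) (by linarith)
  intro ω hω hbal
  refine hω ?_
  intro θhat hθhat θf hθf
  have hlog : 0 ≤ Real.log n := Real.log_nonneg hn1
  have hs : 0 < Real.sqrt n := Real.sqrt_pos.2 hn0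
  set d := |τ - 1 / 2| with hd
  have hd0 : 0 ≤ d := abs_nonneg _
  set b := Real.sqrt (Real.log n / m) with hb
  have hb0 : 0 ≤ b := Real.sqrt_nonneg _
  have hb2 : b ^ 2 = Real.log n / m := Real.sq_sqrt (by positivity)
  have ha2 : (Real.log n / Real.sqrt n) ^ 2 = Real.log n ^ 2 / n := by
    rw [div_pow, Real.sq_sqrt hn0.le]
  have ha0 : 0 ≤ Real.log n / Real.sqrt n := by positivity
  obtain ⟨h1, h2⟩ := hθf.norm_sub_le_and_worstLoss_le hH hρ (by positivity) hq hBne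
    (by linarith [hτ.1]) (by linarith [hτ.2]) le_rfl hsT
    (hbal (fun j => θhat j) fun j => hθhat j j.2)
  refine ⟨h1.trans ?_, h2.trans (EReal.coe_le_coe_iff.2 ?_)⟩
  · rw [← mul_assoc, mul_div_right_comm]
    refine mul_le_mul_of_nonneg_right ?_ (by positivity)
    calc 3 * (A / Real.sqrt n) / ρ = 3 * A / ρ / Real.sqrt n := by ring
      _ ≤ _ := div_le_div_of_nonneg_right (by linarith) hs.le
  · rw [← hb2, ← ha2]
    have hsq := sq_add_add_le d b (Real.log n / Real.sqrt n)
    have hc : 0 ≤ A ^ 2 / n / ρ := by positivity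
    have hS : 0 ≤ (d ^ 2 + b ^ 2 + (Real.log n / Real.sqrt n) ^ 2) / n := by positivity
    calc (A / Real.sqrt n * (d + b + Real.log n / Real.sqrt n)) ^ 2 / ρ
        = A ^ 2 / n / ρ * (d + b + Real.log n / Real.sqrt n) ^ 2 := by
          rw [mul_pow, div_pow, Real.sq_sqrt hn0.le]; ring
      _ ≤ A ^ 2 / n / ρ * (3 * (d ^ 2 + b ^ 2 + (Real.log n / Real.sqrt n) ^ 2)) :=
          mul_le_mul_of_nonneg_left hsq hc
      _ = 3 * A ^ 2 / ρ * ((d ^ 2 + b ^ 2 + (Real.log n / Real.sqrt n) ^ 2) / n) := by ring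
      _ ≤ (3 * A ^ 2 / ρ + 1) * ((d ^ 2 + b ^ 2 + (Real.log n / Real.sqrt n) ^ 2) / n) := by
          gcongr; linarith
      _ = _ := by ring
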